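/- \textbf{Setting.} A stream is a list $p_1,\dots,p_m\in[n]$; $f^{(t)}_j=\#\{i\le t: p_i=j\}$, $F_2^{(t)}=\sum_j (f^{(t)}_j)^2$, $f=f^{(m)}$, $F_2=F_2^{(m)}$. An item $H$ is a $K$-heavy hitter if $f_H^2\ge K^2\sum_{j\ne H}f_j^2$. A random function is $k$-wise independent if its values at any at most $k$ points are independent and uniform. \textbf{Tracker} (with $\rho\ge 1$ rows). Draw 8-wise independent signs $S\in\{-1,1\}^{\rho\times n}$ and put $\hat F_2^{(t)}=\frac1\rho\sum_{i\le\rho}\langle S_i,f^{(t)}\rangle^2$. \textbf{HH1} with guess $\sigma$ on a list of items. Let $R=3\lfloor\log_2(\min\{n,\sigma^2\}+1)\rfloor$, draw a pairwise independent $h:[n]\to\{0,1\}^R$ and 4-wise independent $Z\in\{-1,1\}^n$, and set $X_0=X_1=0$, $r=1$, $H=-1$. Read the items in order while $r<R$. If the item $x$ satisfies $h(x)_i=b_i$ for all $i\le r-1$, set $H\gets x$ and add $Z_x$ to $X_{h(x)_r}$; if then $|X_0+X_1|\ge\frac1{32}\sigma(\frac34)^r$, record $b_r=\mathbf 1(|X_1|>|X_0|)$,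 draw a fresh $Z$, reset $X_0=X_1=0$ and increase $r$ by one. The output is $H$. \textbf{HH2.} Run the tracker. At the beginning start a copy of HH1 with guess $\sigma=1$ (copy number $-1$). For $k=0,1,2,\dots$ let $t_k=\min\{t:\hat F_2^{(t)}\ge 2^k\}$ (so $t_0=1$); at time $t_k$ start copy number $k$ of HH1, with fresh independent randomness and guess $\sigma=(\hat F_2^{(t_k)})^{1/2}$, on the items $p_{t_k},p_{t_k+1},\dots$, and discard copy number $k-2$. Thus only the two most recent copies are kept. If $k$ is the number of the last copy started by time $m$, return the output of copy number $k-1$. \textbf{Lemma (HH2 correctness).} There are a constant $K>0$ and a constant number $\rho$ of tracker rows such that the following holds. \begin{enumerate} \item For all $n$, all streams and all families with the above independence, with probability at least $1-\frac1{20}$ we have $|\hat F_2^{(t)}-F_2^{(t)}|\le\frac1{100}F_2$ for all $0\le t\le m$. \item For all $n$, all streams and all families with the above independence, if the stream contains a $K$-heavy hitter $H$ (so $H$ occurs in the stream), then HH2 returns $H$ with probability at least $0.6$. \item HH2 is a one-pass algorithm with $O(1)$ words of memory and $O(1)$ update time. That is, there are a constant $C$ and a fixed word RAM program, neither depending on $n$,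 $m$ or the stream, such that for every $n$ there are families as above for which, on every stream, the output of the program has the same distribution as that of HH2; the program uses at most $C$ registers, never stores an integer of absolute value larger than $(n+m+2)^C$ (a word has $O(\log(n+m))$ bits), and makes at most $C$ steps per stream item. Its unit-cost steps are addition, subtraction, multiplication, division, remainder, left shift, bit length, comparison, loading a constant, and drawing a random word with a given number of bits. \end{enumerate} -/

import Mathlib

namespace BPTree

/-! ### Insertion-only streams -/

/-- The frequency of item `j` in the stream `p`. -/
def freq {n : ℕ} (p : List (Fin n)) (j : Fin n) : ℕ := p.count j

/-- The second frequency moment of the stream `p`. -/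
def F2 {n : ℕ} (p : List (Fin n)) : ℝ := ∑ j, (freq p j : ℝ) ^ 2

/-- `H` is an `α`-heavy hitter of the stream `p`. -/
def IsHeavyHitter {n : ℕ} (α : ℝ) (p : List (Fin n)) (H : Fin n) : Prop :=
  α ^ 2 * ∑ j ∈ Finset.univ.erase H, (freq p j : ℝ) ^ 2 ≤ (freq p H : ℝ) ^ 2

/-! ### Families of limited independence -/

/-- A random function `α → β` is `k`-wise independent with uniform marginals: its values at any at
most `k` points are independent and uniform on `β`. -/
def KWise {α β : Type} [Fintype β] (k : ℕ) (F : PMF (α → β)) : Prop :=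
  ∀ T : Finset α, T.card ≤ k → ∀ v : α → β,
    F.toOuterMeasure {f | ∀ a ∈ T, f a = v a} = ((Fintype.card β : ENNReal)⁻¹) ^ T.card

/-- The families that the algorithm samples from, for the universe `[n]` and a sketch with `rows`
rows. Signs are elements of `ℤˣ = {1, -1}`. -/
structure Families (n rows : ℕ) where
  /-- random labels `[n] → {0,1}^R`, the most significant bit having index `0` -/
  hash : (R : ℕ) → PMF (Fin n → (Fin R → Bool))
  /-- random signs of the Bernoulli processes -/
  sign : PMF (Fin n → ℤˣ)
  /-- random signs of the second moment sketch -/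
  sketch : PMF (Fin rows × Fin n → ℤˣ)
  hash_kWise : ∀ R, KWise 2 (hash R)
  sign_kWise : KWise 4 sign
  sketch_kWise : KWise 8 sketch

/-! ### The second moment tracker -/

/-- The linear sketch of the stream `p` with sign matrix `S`, not normalised. -/
def sketchOf {n rows : ℕ} (S : Fin rows × Fin n → ℤˣ) (p : List (Fin n)) : Fin rows → ℤ :=
  fun i => (p.map fun x => ((S (i, x) : ℤˣ) : ℤ)).sum

/-- The estimate of the second moment read off a sketch: the mean of the squared coordinates. -/
noncomputable def estimate {rows : ℕ} (Y : Fin rows → ℤ) : ℝ := (∑ i, (Y i : ℝ) ^ 2) / rows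

/-! ### HH1 -/

/-- The state of a running copy of HH1. Rounds `r` and bits are numbered from `1`; `H = none` plays
the role of the initial value `-1`. -/
structure HH1State (n : ℕ) where
  σ : ℝ
  R : ℕ
  /-- `h x i` is the `i`-th bit of the label of `x`, for `1 ≤ i ≤ R` -/
  h : Fin n → ℕ → Bool
  Z : Fin n → ℤˣ
  b : ℕ → Bool
  X0 : ℤ
  X1 : ℤ
  r : ℕ
  H : Option (Fin n)

/-- The `i`-th bit, for `1 ≤ i ≤ R`, of a label with `R` bits. -/
def labelBit {R : ℕ} (v : Fin R → Bool) (i : ℕ) : Bool :=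
  if hi : i - 1 < R then v ⟨i - 1, hi⟩ else false

/-- The number of label bits used by HH1 with guess `σ`. -/
noncomputable def numBits (n : ℕ) (σ : ℝ) : ℕ :=
  3 * ⌊Real.logb 2 (min (n : ℝ) (σ ^ 2) + 1)⌋₊

/-- Start a new copy of HH1 with guess `σ`. -/
noncomputable def HH1State.start {n rows : ℕ} (fam : Families n rows) (σ : ℝ) :
    PMF (HH1State n) :=
  (fam.hash (numBits n σ)).bind fun h => fam.sign.map fun Z =>
    { σ := σ, R := numBits n σ, h := fun x => labelBit (h x), Z := Z, b := fun _ => false,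
      X0 := 0, X1 := 0, r := 1, H := none }

/-- The label of `x` agrees with all the bits recorded so far. -/
def HH1State.Active {n : ℕ} (s : HH1State n) (x : Fin n) : Prop :=
  ∀ i ∈ Finset.Icc 1 (s.r - 1), s.h x i = s.b i

/-- The stream item `x` is added to `X0` or `X1`, according to bit `r` of its label, and becomes
the candidate `H`. -/
def HH1State.count {n : ℕ} (s : HH1State n) (x : Fin n) : HH1State n :=
  { s with
    H := some x
    X0 := if s.h x s.r then s.X0 else s.X0 + ((s.Z x : ℤˣ) : ℤ)
    X1 := if s.h x s.r then s.X1 + ((s.Z x : ℤˣ) : ℤ) else s.X1 }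

/-- The end of a round: record one bit, refresh the signs, reset the counters. -/
noncomputable def HH1State.nextRound {n rows : ℕ} (fam : Families n rows) (s : HH1State n) :
    PMF (HH1State n) :=
  fam.sign.map fun Z =>
    { s with b := Function.update s.b s.r (decide (|s.X0| < |s.X1|)), Z := Z,
             X0 := 0, X1 := 0, r := s.r + 1 }

open Classical in
/-- HH1 reads the item `x`. Nothing changes any more once `r = R`. The constants are `c = 1/32` and
`β = 3/4`. -/
noncomputable def HH1State.step {n rows : ℕ} (fam : Families n rows) (s : HH1State n)
    (x : Fin n) : PMF (HH1State n) :=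
  if s.r < s.R ∧ s.Active x then
    if (1 / 32 : ℝ) * s.σ * (3 / 4 : ℝ) ^ s.r ≤ |(((s.count x).X0 + (s.count x).X1 : ℤ) : ℝ)| then
      (s.count x).nextRound fam
    else PMF.pure (s.count x)
  else PMF.pure s

/-! ### HH2 -/

/-- The state of HH2: the second moment sketch, the exponent `next` of the next power of `2` to be
reached by the estimate, and the two most recent copies of HH1. If `k` is the number of the last
restart then `next = k + 1`, and `cur`, `prev` are the copies with numbers `k`, `k - 1`; the copy
started at the very beginning has number `-1`. -/
structure HH2State (n rows : ℕ) where
  S : Fin rows × Fin n → ℤˣ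
  Y : Fin rows → ℤ
  next : ℕ
  prev : HH1State n
  cur : HH1State n

/-- Before the first item: draw the signs of the sketch and start HH1 with guess `1`. The field
`prev` is a placeholder here, discarded at the first item, where the estimate is `1 = 2 ^ 0`. -/
noncomputable def HH2State.start {n rows : ℕ} (fam : Families n rows) : PMF (HH2State n rows) :=
  fam.sketch.bind fun S => (HH1State.start fam 1).map fun c =>
    { S := S, Y := 0, next := 0, prev := c, cur := c }

/-- Update the second moment sketch. -/
def HH2State.track {n rows : ℕ} (s : HH2State n rows) (x : Fin n) : HH2State n rows :=
  { s with Y := fun i => s.Y i + ((s.S (i, x) : ℤˣ) : ℤ) }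

/-- `j` times in a row: start a new copy of HH1 whose guess is the square root of the current
estimate, and discard the older one of the two copies that were kept. -/
noncomputable def HH2State.restart {n rows : ℕ} (fam : Families n rows) :
    ℕ → HH2State n rows → PMF (HH2State n rows)
  | 0, s => PMF.pure s
  | j + 1, s => (HH1State.start fam √(estimate s.Y)).bind fun c =>
      HH2State.restart fam j { s with prev := s.cur, cur := c, next := s.next + 1 }

/-- The number of exponents `k ≥ next` with `2 ^ k ≤ estimate`, that is, of the powers of `2` which
the estimate reaches now for the first time. -/
noncomputable def HH2State.crossings {n rows : ℕ} (s : HH2State n rows) : ℕ :=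
  Set.ncard {k : ℕ | s.next ≤ k ∧ (2 : ℝ) ^ k ≤ estimate s.Y}

/-- HH2 reads the item `x`: it updates the tracker, restarts HH1 once for every power of `2` just
reached, and passes `x` on to the two copies it keeps. -/
noncomputable def HH2State.step {n rows : ℕ} (fam : Families n rows) (s : HH2State n rows)
    (x : Fin n) : PMF (HH2State n rows) :=
  (HH2State.restart fam (s.track x).crossings (s.track x)).bind fun s' =>
    (s'.prev.step fam x).bind fun a => (s'.cur.step fam x).map fun c =>
      { s' with prev := a, cur := c }

/-- The random state of HH2 after one pass over the stream `p`. -/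
noncomputable def HH2State.run {n rows : ℕ} (fam : Families n rows) (p : List (Fin n)) :
    PMF (HH2State n rows) :=
  p.foldl (fun D x => D.bind fun s => s.step fam x) (HH2State.start fam)

/-- The output distribution of HH2 on the stream `p`: the candidate of the penultimate copy. -/
noncomputable def HH2 {n rows : ℕ} (fam : Families n rows) (p : List (Fin n)) :
    PMF (Option (Fin n)) :=
  (HH2State.run fam p).map fun s => s.prev.H

/-! ### Word RAM programs with a step count -/

/-- Word operations. -/
inductive WordOp
  | add | sub | mul | div | mod | shiftLeft | bitLength

/-- The value of a word operation; `bitLength` ignores its second argument. -/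
def WordOp.eval : WordOp → ℤ → ℤ → ℤ
  | .add, a, b => a + b
  | .sub, a, b => a - b
  | .mul, a, b => a * b
  | .div, a, b => a / b
  | .mod, a, b => a % b
  | .shiftLeft, a, b => a * 2 ^ b.toNat
  | .bitLength, a, _ => a.natAbs.size

/-- Loop-free programs over a set `Reg` of registers. -/
inductive Code (Reg : Type)
  /-- do nothing -/
  | skip : Code Reg
  /-- `d := c` for a fixed integer `c` -/
  | const (d : Reg) (c : ℤ) : Code Reg
  /-- `d := o a b` -/
  | op (o : WordOp) (d a b : Reg) : Code Reg
  /-- `d :=` a uniformly random integer with `a` bits -/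
  | rand (d a : Reg) : Code Reg
  /-- sequential composition -/
  | seq (P Q : Code Reg) : Code Reg
  /-- if `a ≤ b` then `P` else `Q` -/
  | ite (a b : Reg) (P Q : Code Reg) : Code Reg

/-- A machine state: the contents of the registers, the number of steps made so far, and the
largest absolute value that has ever been written to a register. -/
structure Machine (Reg : Type) where
  regs : Reg → ℤ
  time : ℕ
  peak : ℕ

/-- Store `v` in the register `d`. -/
def Machine.store {Reg : Type} [DecidableEq Reg] (M : Machine Reg) (d : Reg) (v : ℤ) :
    Machine Reg :=
  { M with regs := Function.update M.regs d v, peak := max M.peak v.natAbs }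

/-- Count one step. -/
def Machine.tick {Reg : Type} (M : Machine Reg) : Machine Reg := { M with time := M.time + 1 }

/-- Execution of a program; every instruction and every comparison takes one step. -/
noncomputable def Code.exec {Reg : Type} [DecidableEq Reg] :
    Code Reg → Machine Reg → PMF (Machine Reg)
  | .skip, M => PMF.pure M
  | .const d c, M => PMF.pure (M.tick.store d c)
  | .op o d a b, M => PMF.pure (M.tick.store d (o.eval (M.regs a) (M.regs b)))
  | .rand d a, M =>
      (PMF.uniformOfFintype (Fin (2 ^ (M.regs a).toNat))).map fun v =>
        M.tick.store d ((v : ℕ) : ℤ)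
  | .seq P Q, M => (P.exec M).bind fun M' => Q.exec M'
  | .ite a b P Q, M => if M.regs a ≤ M.regs b then P.exec M.tick else Q.exec M.tick

/-- A one-pass streaming program. The size `n` of the universe is put into the register `inp`
before `setup` is executed, and each stream item before `update` is executed. The current answer is
always found in the register `out`. -/
structure StreamProgram (Reg : Type) where
  inp : Reg
  out : Reg
  setup : Code Reg
  update : Code Reg

/-- The random machine state after one pass over the stream `p`. -/
noncomputable def StreamProgram.run {Reg : Type} [DecidableEq Reg] (P : StreamProgram Reg) {n : ℕ}
    (p : List (Fin n)) : PMF (Machine Reg) :=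
  p.foldl (fun D x => D.bind fun M => P.update.exec (M.store P.inp ((x : ℕ) : ℤ)))
    (P.setup.exec (Machine.store { regs := fun _ => 0, time := 0, peak := 0 } P.inp (n : ℤ)))

/-- Answers as integers: an item is its number, `-1` stands for no answer. -/
def encode {n : ℕ} : Option (Fin n) → ℤ
  | none => -1
  | some x => ((x : ℕ) : ℤ)

/-- The streaming program `P` implements HH2 for the given families: on every stream its answer has
the distribution of the output of HH2. -/
def StreamProgram.Implements {Reg : Type} [DecidableEq Reg] (P : StreamProgram Reg) {n rows : ℕ}
    (fam : Families n rows) : Prop :=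
  ∀ p : List (Fin n), ((P.run p).map fun M => M.regs P.out) = (HH2 fam p).map encode

end BPTree

namespace BPTree

/-! ### Expectations and probabilities -/

/-! Everything probabilistic rests on one chaining bound, `exists_maximal`: if the fourth moment of
every increment of a process is at most a constant times the squared increment of a monotone clock,
then the maximum of the process obeys the same bound with a larger constant. Random signs satisfy
the hypothesis by an elementary hypercontractive inequality, for linear forms under 4-wise and for
quadratic forms under 8-wise independence. The error of the tracker is a quadratic form and its
clock is the second moment of the prefix (`tracker_accuracy`). The signed count of a set of items is
a linear form and its clock is the second moment of that set (`prob_signSum_large`).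

HH1 is analysed with the labels fixed. While the recorded bits agree with the label of `H`, the
counter on the side of `H` is plus or minus the count of `H`, up to the noise of the items that
still share the recorded prefix. If the noise on each side stays within a quarter of the threshold,
the round records the bit of `H` and uses up at most 3/2 of the threshold, plus one, occurrences of
`H` (`HH1State.run_round`). The thresholds form a geometric series, so a fixed fraction of σ
occurrences suffices for all rounds. Each round halves the expected second moment of the surviving
items but multiplies the squared threshold by 9/16 > 1/2, so the failure probabilities of the rounds
are summable as well. In the last round at most half an occurring survivor is expected, and it has
the sign opposite to that of `H` with probability at least 1/2; if all of them do, `H` itself ends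
the round and is the output. Altogether HH1 fails with probability at most 13/50 (`hh1_fail_le`).

For HH2 the signs of the sketch are fixed first. Then the restart times are deterministic and the
copies of HH1 are independent, so the output has the law of one single copy, the last but one
(`HH2State.runFrom_map_prev`). If the tracker is accurate, this copy has a guess comparable to the
square root of the final second moment, and it starts so early that enough occurrences of `H` are
still to come (`copy_fail_le`). If no other item occurs, every copy finds `H` with certainty. The
failure probability is at most 1/20 + 13/50.

For the implementation, the families are leading bits of random polynomials modulo a power of two
(`polyFamilies`), which need only uniform random words. The simulation has three layers: HH2 on
integer data, where squaring removes roots and real thresholds (`StoreData.map_run`); a structured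
program acting on these data (`updateCode_sem`, `setupCode_sem`); and its translation to machine
code (`HCode.compile_exec`). Invariants of the integer data keep all stored numbers polynomially
bounded. -/

/-- Expectation of a real function on a finite probability space. -/
noncomputable def ex {Ω : Type} [Fintype Ω] (D : PMF Ω) (f : Ω → ℝ) : ℝ :=
  ∑ a, (D a).toReal * f a

/-- Probability of an event as a real number. -/
noncomputable def prob {Ω : Type} (D : PMF Ω) (S : Set Ω) : ℝ := (D.toOuterMeasure S).toReal

section Ex

variable {Ω : Type} [Fintype Ω] (D : PMF Ω)

theorem ex_add (f g : Ω → ℝ) : ex D (fun a => f a + g a) = ex D f + ex D g := by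
  simp [ex, mul_add, Finset.sum_add_distrib]

theorem ex_mul_left (c : ℝ) (f : Ω → ℝ) : ex D (fun a => c * f a) = c * ex D f := by
  simp only [ex, Finset.mul_sum]
  exact Finset.sum_congr rfl fun a _ => by ring

theorem ex_sum {ι : Type} (s : Finset ι) (f : ι → Ω → ℝ) :
    ex D (fun a => ∑ i ∈ s, f i a) = ∑ i ∈ s, ex D (f i) := by
  simp only [ex, Finset.mul_sum]
  exact Finset.sum_comm

theorem ex_mono {f g : Ω → ℝ} (h : ∀ a, f a ≤ g a) : ex D f ≤ ex D g :=
  Finset.sum_le_sum fun a _ => mul_le_mul_of_nonneg_left (h a) ENNReal.toReal_nonneg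

theorem ex_nonneg {f : Ω → ℝ} (h : ∀ a, 0 ≤ f a) : 0 ≤ ex D f :=
  Finset.sum_nonneg fun a _ => mul_nonneg ENNReal.toReal_nonneg (h a)

theorem ex_const (c : ℝ) : ex D (fun _ => c) = c := by
  have h : ∑ a, (D a).toReal = 1 := by
    rw [← ENNReal.toReal_sum fun a _ => D.apply_ne_top a, ← tsum_fintype (L := .unconditional Ω),
      D.tsum_coe]
    rfl
  simp [ex, ← Finset.sum_mul, h]

/-- Cauchy-Schwarz. -/
theorem ex_mul_sq_le (f g : Ω → ℝ) :
    ex D (fun a => f a * g a) ^ 2 ≤ ex D (fun a => f a ^ 2) * ex D (fun a => g a ^ 2) := by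
  refine Finset.sum_sq_le_sum_mul_sum_of_sq_le_mul _ (fun a _ => ?_) (fun a _ => ?_) fun a _ => ?_
  · exact mul_nonneg ENNReal.toReal_nonneg (sq_nonneg _)
  · exact mul_nonneg ENNReal.toReal_nonneg (sq_nonneg _)
  · exact le_of_eq (by ring)

end Ex

section Prob

variable {Ω Ω' : Type}

theorem prob_nonneg (D : PMF Ω) (S : Set Ω) : 0 ≤ prob D S := ENNReal.toReal_nonneg

theorem toOuterMeasure_le_one (D : PMF Ω) (S : Set Ω) : D.toOuterMeasure S ≤ 1 := by
  rw [PMF.toOuterMeasure_apply, ← D.tsum_coe]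
  exact ENNReal.tsum_le_tsum fun a => Set.indicator_le_self _ _ _

theorem toOuterMeasure_ne_top (D : PMF Ω) (S : Set Ω) : D.toOuterMeasure S ≠ ⊤ :=
  ((toOuterMeasure_le_one D S).trans_lt ENNReal.one_lt_top).ne

theorem prob_le_one (D : PMF Ω) (S : Set Ω) : prob D S ≤ 1 :=
  ENNReal.toReal_mono ENNReal.one_ne_top (toOuterMeasure_le_one D S)

theorem prob_mono (D : PMF Ω) {S T : Set Ω} (h : S ⊆ T) : prob D S ≤ prob D T :=
  ENNReal.toReal_mono (toOuterMeasure_ne_top D T) (D.toOuterMeasure.mono h)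

theorem prob_union_le (D : PMF Ω) (S T : Set Ω) : prob D (S ∪ T) ≤ prob D S + prob D T := by
  rw [prob, prob, prob, ← ENNReal.toReal_add (toOuterMeasure_ne_top _ _)
    (toOuterMeasure_ne_top _ _)]
  exact ENNReal.toReal_mono (ENNReal.add_ne_top.2 ⟨toOuterMeasure_ne_top _ _,
    toOuterMeasure_ne_top _ _⟩) (MeasureTheory.measure_union_le S T)

theorem prob_biUnion_le {ι : Type} (D : PMF Ω) (s : Finset ι) (S : ι → Set Ω) :
    prob D (⋃ i ∈ s, S i) ≤ ∑ i ∈ s, prob D (S i) := by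
  classical
  induction s using Finset.induction_on with
  | empty => simp [prob]
  | insert a s ha ih =>
    rw [Finset.sum_insert ha, Finset.set_biUnion_insert]
    exact (prob_union_le _ _ _).trans (by gcongr)

theorem prob_compl (D : PMF Ω) (S : Set Ω) : prob D Sᶜ = 1 - prob D S := by
  have h : D.toOuterMeasure S + D.toOuterMeasure Sᶜ = 1 := by
    rw [PMF.toOuterMeasure_apply, PMF.toOuterMeasure_apply, ← ENNReal.tsum_add, ← D.tsum_coe]
    refine tsum_congr fun a => ?_
    by_cases ha : a ∈ S <;> simp [ha]
  have := congrArg ENNReal.toReal h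
  rw [ENNReal.toReal_add (toOuterMeasure_ne_top _ _) (toOuterMeasure_ne_top _ _)] at this
  simp only [prob]
  simp at this
  linarith

theorem prob_eq_ex [Fintype Ω] (D : PMF Ω) (S : Set Ω) :
    prob D S = ex D (S.indicator fun _ => 1) := by
  classical
  rw [prob, PMF.toOuterMeasure_apply_fintype, ENNReal.toReal_sum, ex]
  · refine Finset.sum_congr rfl fun a _ => ?_
    by_cases ha : a ∈ S <;> simp [ha]
  · intro a _
    by_cases ha : a ∈ S <;> simp [ha, D.apply_ne_top a]

theorem prob_bind [Fintype Ω] (D : PMF Ω) (f : Ω → PMF Ω') (S : Set Ω') :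
    prob (D.bind f) S = ex D fun a => prob (f a) S := by
  rw [prob, PMF.toOuterMeasure_bind_apply, tsum_fintype, ENNReal.toReal_sum, ex]
  · simp [prob]
  · intro a _
    exact ENNReal.mul_ne_top (D.apply_ne_top a) (toOuterMeasure_ne_top _ _)

theorem prob_map (D : PMF Ω) (f : Ω → Ω') (S : Set Ω') :
    prob (D.map f) S = prob D (f ⁻¹' S) := by
  rw [prob, PMF.toOuterMeasure_map_apply, prob]

theorem prob_pure (a : Ω) (S : Set Ω) [Decidable (a ∈ S)] :
    prob (PMF.pure a) S = if a ∈ S then 1 else 0 := by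
  rw [prob, PMF.toOuterMeasure_pure_apply]
  split_ifs <;> simp

theorem prob_bind_le [Fintype Ω] (D : PMF Ω) (f : Ω → PMF Ω') (S : Set Ω') (B : Set Ω) {δ : ℝ}
    (hδ : 0 ≤ δ) (h : ∀ a ∉ B, prob (f a) S ≤ δ) : prob (D.bind f) S ≤ prob D B + δ := by
  rw [prob_bind, prob_eq_ex, ← ex_const D δ, ← ex_add]
  refine ex_mono D fun a => ?_
  by_cases ha : a ∈ B
  · simpa [ha] using (prob_le_one (f a) S).trans (by linarith)
  · simpa [ha] using h a ha

theorem mul_prob_le_ex [Fintype Ω] (D : PMF Ω) (S : Set Ω) (M : Ω → ℝ) {l : ℝ}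
    (hM : ∀ a, 0 ≤ M a) (h : ∀ a ∈ S, l ≤ M a) : l * prob D S ≤ ex D M := by
  rw [prob_eq_ex, ← ex_mul_left]
  refine ex_mono D fun a => ?_
  by_cases ha : a ∈ S
  · simpa [ha] using h a ha
  · simpa [ha] using hM a

end Prob

/-! ### A maximal inequality -/

/-- Convexity with weights 1/6 and 5/6, hence the constants 6³ and (6/5)³. The coefficient of `b ^
4` has to be below 2 for the recursion in the maximal inequality to contract. -/
theorem add_pow_four_le (a b : ℝ) : (a + b) ^ 4 ≤ 216 * a ^ 4 + 1.728 * b ^ 4 := by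
  have h1 : (a + b) ^ 2 ≤ 6 * a ^ 2 + 1.2 * b ^ 2 := by nlinarith [sq_nonneg (5 * a - b)]
  have h2 : (6 * a ^ 2 + 1.2 * b ^ 2) ^ 2 ≤ 216 * a ^ 4 + 1.728 * b ^ 4 := by
    nlinarith [sq_nonneg (5 * 5 * a ^ 2 - b ^ 2)]
  calc (a + b) ^ 4 = ((a + b) ^ 2) ^ 2 := by ring
    _ ≤ (6 * a ^ 2 + 1.2 * b ^ 2) ^ 2 := by gcongr
    _ ≤ _ := h2

/-- Móricz' maximal inequality for fourth moments. -/
theorem exists_maximal {Ω : Type} [Fintype Ω] (D : PMF Ω) (X : ℕ → Ω → ℝ) (G : ℕ → ℝ) {A : ℝ}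
    (hA : 0 ≤ A) (m : ℕ) (hG : ∀ s t, s ≤ t → t ≤ m → G s ≤ G t)
    (hX : ∀ s t, s ≤ t → t ≤ m →
      ex D (fun ω => (X t ω - X s ω) ^ 4) ≤ A * (G t - G s) ^ 2) (s u : ℕ) (hsu : s ≤ u)
    (hu : u ≤ m) :
    ∃ M : Ω → ℝ, (∀ ω, 0 ≤ M ω) ∧ (∀ ω, ∀ t, s ≤ t → t ≤ u → (X t ω - X s ω) ^ 4 ≤ M ω) ∧
      ex D M ≤ 1600 * A * (G u - G s) ^ 2 := by
  classical
  induction hk : u - s using Nat.strong_induction_on generalizing s u with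
  | _ k ih =>
  rcases hsu.eq_or_lt with rfl | hlt
  · refine ⟨fun _ => 0, fun _ => le_rfl, fun ω t h1 h2 => ?_, ?_⟩
    · obtain rfl : t = s := le_antisymm h2 h1
      simp
    · rw [ex_const]; simp
  have hg : 0 ≤ G u - G s := sub_nonneg.2 (hG s u hsu hu)
  -- The index `h` is the first at which half of the clock has elapsed, so the stretches from `s` to
  -- `h - 1` and from `h` to `u` carry at most half of the clock each.
  have hex : ∃ h, s < h ∧ (G u - G s) / 2 ≤ G h - G s := ⟨u, hlt, by linarith⟩
  set h := Nat.find hex with hdef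
  obtain ⟨hsh, hh⟩ := Nat.find_spec hex
  rw [← hdef] at hsh hh
  have hhu : h ≤ u := Nat.find_min' hex ⟨hlt, by linarith⟩
  have hpre : G (h - 1) - G s ≤ (G u - G s) / 2 := by
    rcases (Nat.le_sub_one_of_lt hsh).eq_or_lt with he | hl
    · rw [← he, sub_self]; linarith
    · by_contra hc
      exact Nat.find_min hex (m := h - 1) (by omega) ⟨hl, (not_le.1 hc).le⟩
  obtain ⟨M1, h10, h11, h12⟩ := ih (h - 1 - s) (by omega) s (h - 1) (by omega) (by omega) rfl
  obtain ⟨M2, h20, h21, h22⟩ := ih (u - h) (by omega) h u hhu hu rfl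
  refine ⟨fun ω => 216 * (X h ω - X s ω) ^ 4 + 1.728 * (M1 ω + M2 ω), fun ω => ?_,
    fun ω t h1 h2 => ?_, ?_⟩
  · have := h10 ω
    have := h20 ω
    positivity
  · have p1 := h10 ω
    have p2 := h20 ω
    by_cases ht : t < h
    · have q1 := h11 ω t h1 (by omega)
      have : 0 ≤ (X h ω - X s ω) ^ 4 := by positivity
      linarith
    · have q1 := h21 ω t (by omega) h2
      have q2 := add_pow_four_le (X h ω - X s ω) (X t ω - X h ω)
      rw [show X h ω - X s ω + (X t ω - X h ω) = X t ω - X s ω by ring] at q2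
      linarith
  · rw [ex_add, ex_mul_left, ex_mul_left, ex_add]
    have e1 := hX s h hsh.le (hhu.trans hu)
    have g1 : G h - G s ≤ G u - G s := by linarith [hG h u hhu hu]
    have g2 : 0 ≤ G h - G s := by linarith
    have g3 : 0 ≤ G (h - 1) - G s := by linarith [hG s (h - 1) (by omega) (by omega)]
    have g4 : 0 ≤ G u - G h := by linarith [hG h u hhu hu]
    have k1 : (G h - G s) ^ 2 ≤ (G u - G s) ^ 2 := by gcongr
    have k2 : (G (h - 1) - G s) ^ 2 ≤ ((G u - G s) / 2) ^ 2 := by gcongr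
    have k3 : (G u - G h) ^ 2 ≤ ((G u - G s) / 2) ^ 2 := by gcongr; linarith
    have k1' := mul_le_mul_of_nonneg_left k1 hA
    have k2' := mul_le_mul_of_nonneg_left k2 hA
    have k3' := mul_le_mul_of_nonneg_left k3 hA
    have : 0 ≤ A * (G u - G s) ^ 2 := by positivity
    -- The recursion closes because 216 + 1.728 · 2 · 1600 / 4 = 1598.4 ≤ 1600; the factor 1/4 is
    -- the square of the halved clock.
    nlinarith

/-- If a function is dominated by its fourth moment then it is rarely large. -/
theorem prob_le_of_fourth_moment {Ω : Type} [Fintype Ω] (D : PMF Ω) (S : Set Ω) (M : Ω → ℝ)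
    {l v : ℝ} (hl : 0 < l) (hv : 0 ≤ v) (hM : ∀ a, 0 ≤ M a) (h : ∀ a ∈ S, l ^ 4 ≤ M a)
    (hE : ex D M ≤ v ^ 2) : prob D S ≤ v / l ^ 2 := by
  have h1 := (mul_prob_le_ex D S M hM h).trans hE
  have h0 := prob_nonneg D S
  have h3 := prob_le_one D S
  rw [le_div_iff₀ (by positivity)]
  by_contra hc
  push Not at hc
  have : v ^ 2 < (prob D S * l ^ 2) ^ 2 := by gcongr
  -- Markov's inequality bounds the probability by `v ^ 2 / l ^ 4`. As a probability dominates its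
  -- square, its square obeys this bound too, which gives an estimate linear in `v`, hence summable
  -- against second moments.
  have h4 : prob D S ^ 2 ≤ prob D S := by nlinarith
  nlinarith [mul_le_mul_of_nonneg_right h4 (show 0 ≤ l ^ 4 by positivity)]

end BPTree
namespace BPTree

/-! ### Limited independence -/

section KWise

variable {α β : Type} [Fintype β]

/-- If all patterns on `T` are equally likely then the values on `T` are independent and uniform. -/
theorem toOuterMeasure_pattern_of_forall_eq [Nonempty β] (D : PMF (α → β)) (T : Finset α)
    (h : ∀ v v' : α → β, D.toOuterMeasure {f | ∀ a ∈ T, f a = v a} =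
      D.toOuterMeasure {f | ∀ a ∈ T, f a = v' a}) (v : α → β) :
    D.toOuterMeasure {f | ∀ a ∈ T, f a = v a} = ((Fintype.card β : ENNReal)⁻¹) ^ T.card := by
  classical
  let D' : PMF (T → β) := D.map fun f a => f a
  have key : ∀ v : α → β, D.toOuterMeasure {f | ∀ a ∈ T, f a = v a} = D' fun a => v a := by
    intro v
    rw [← PMF.toOuterMeasure_apply_singleton, PMF.toOuterMeasure_map_apply]
    congr 1
    ext f
    simp [funext_iff]
  have hconst : ∀ w : T → β, D' w = D' fun a => v a := by
    intro w
    let e : α → β := fun a => if ha : a ∈ T then w ⟨a, ha⟩ else v a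
    have hw : w = fun a : T => e a := by
      funext a
      simp [e, a.2]
    rw [hw, ← key, ← key, h]
  have hs := D'.tsum_coe
  rw [tsum_fintype, Finset.sum_congr rfl fun w _ => hconst w, Finset.sum_const, Finset.card_univ,
    Fintype.card_fun, Fintype.card_coe, nsmul_eq_mul, Nat.cast_pow] at hs
  rw [key, ← ENNReal.inv_pow]
  exact ENNReal.eq_inv_of_mul_eq_one_left (by rw [mul_comm]; exact hs)

theorem KWise.map_equiv {γ : Type} [Fintype γ] {k : ℕ} {D : PMF (α → β)} (h : KWise k D)
    (e : β ≃ γ) : KWise k (D.map fun f a => e (f a)) := by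
  intro T hT v
  rw [PMF.toOuterMeasure_map_apply, ← Fintype.card_congr e, ← h T hT fun a => e.symm (v a)]
  congr 1
  ext f
  simp [Equiv.eq_symm_apply]

/-- Such an expectation is a sum over the patterns on `T`, with weights that `k`-wise independence
prescribes. Moment bounds can therefore be proved for the uniform distribution and transferred to
any family. -/
theorem KWise.ex_eq [Fintype α] [DecidableEq α] [DecidableEq β] [Inhabited β] {k : ℕ}
    {D D' : PMF (α → β)} (hD : KWise k D) (hD' : KWise k D') (T : Finset α) (hT : T.card ≤ k)
    (f : (α → β) → ℝ) (hf : ∀ z z', (∀ a ∈ T, z a = z' a) → f z = f z') : ex D f = ex D' f := by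
  have key : ∀ E : PMF (α → β), KWise k E → ex E f = ∑ w : T → β,
      f (fun a => if ha : a ∈ T then w ⟨a, ha⟩ else default) *
        (((Fintype.card β : ENNReal)⁻¹) ^ T.card).toReal := by
    intro E hE
    rw [ex, ← Finset.sum_fiberwise Finset.univ (fun (z : α → β) (a : T) => z a)]
    refine Finset.sum_congr rfl fun w _ => ?_
    set e : α → β := fun a => if ha : a ∈ T then w ⟨a, ha⟩ else default with he
    have hiff : ∀ z : α → β, ((fun a : T => z a) = w) ↔ ∀ a ∈ T, z a = e a := by
      intro z
      rw [funext_iff]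
      constructor
      · intro h a ha
        simp [he, ha, ← h ⟨a, ha⟩]
      · intro h a
        simp [h a a.2, he]
    rw [← hE T hT e, PMF.toOuterMeasure_apply_fintype, ENNReal.toReal_sum, Finset.mul_sum,
      Finset.sum_filter]
    · refine Finset.sum_congr rfl fun z _ => ?_
      by_cases hz : ∀ a ∈ T, z a = e a
      · rw [if_pos ((hiff z).2 hz), Set.indicator_of_mem (show z ∈ {f | ∀ a ∈ T, f a = e a} from hz),
          hf z e hz, mul_comm]
      · rw [if_neg (mt (hiff z).1 hz),
          Set.indicator_of_notMem (show z ∉ {f | ∀ a ∈ T, f a = e a} from hz)]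
        simp
    · intro z _
      refine ne_top_of_le_ne_top (E.apply_ne_top z) (Set.indicator_le_self _ _ _)
  rw [key D hD, key D' hD']

/-- Invariance of an expectation under a symmetry of the uniform distribution. -/
theorem ex_uniform_equiv {Ω : Type} [Fintype Ω] [Nonempty Ω] (e : Ω ≃ Ω) (f : Ω → ℝ) :
    ex (PMF.uniformOfFintype Ω) (fun z => f (e z)) = ex (PMF.uniformOfFintype Ω) f := by
  simp only [ex, PMF.uniformOfFintype_apply, ← Finset.mul_sum]
  rw [Equiv.sum_comp e f]

theorem toOuterMeasure_uniform_equiv {Ω : Type} [Fintype Ω] [Nonempty Ω] (e : Ω ≃ Ω)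
    (S : Set Ω) : (PMF.uniformOfFintype Ω).toOuterMeasure (e ⁻¹' S) =
      (PMF.uniformOfFintype Ω).toOuterMeasure S := by
  classical
  rw [PMF.toOuterMeasure_apply, PMF.toOuterMeasure_apply,
    ← Equiv.tsum_eq e (S.indicator (PMF.uniformOfFintype Ω))]
  refine tsum_congr fun z => ?_
  by_cases hz : e z ∈ S <;> simp [hz]

/-- The uniform distribution on functions into a finite group is `k`-wise independent. -/
theorem kWise_uniform [Fintype α] [DecidableEq α] [Group β] (k : ℕ) :
    KWise k (PMF.uniformOfFintype (α → β)) := by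
  intro T _ v
  refine toOuterMeasure_pattern_of_forall_eq _ T (fun v v' => ?_) v
  rw [← toOuterMeasure_uniform_equiv (Equiv.mulLeft (v * v'⁻¹)) {f | ∀ a ∈ T, f a = v a}]
  congr 1
  ext f
  simp [mul_assoc, eq_comm, inv_mul_eq_iff_eq_mul]

end KWise

/-! ### Hypercontractivity for linear and quadratic forms of random signs -/

section Bonami

variable {α : Type} [Fintype α] [DecidableEq α]

/-- Sign as a real number. -/
def sg (u : ℤˣ) : ℝ := ((u : ℤ) : ℝ)

theorem sg_sq (u : ℤˣ) : sg u * sg u = 1 := by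
  rcases Int.units_eq_one_or u with rfl | rfl <;> simp [sg]

/-- Flipping the sign at `a` preserves the uniform distribution and negates the integrand. -/
theorem ex_sg_mul_eq_zero (a : α) (f : (α → ℤˣ) → ℝ)
    (hf : ∀ z z', (∀ b, b ≠ a → z b = z' b) → f z = f z') :
    ex (PMF.uniformOfFintype (α → ℤˣ)) (fun z => sg (z a) * f z) = 0 := by
  have h := ex_uniform_equiv (Equiv.mulLeft (Pi.mulSingle a (-1) : α → ℤˣ))
    fun z => sg (z a) * f z
  have h2 : ∀ z : α → ℤˣ, sg ((Equiv.mulLeft (Pi.mulSingle a (-1) : α → ℤˣ)) z a) *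
      f ((Equiv.mulLeft (Pi.mulSingle a (-1) : α → ℤˣ)) z) = (-1) * (sg (z a) * f z) := by
    intro z
    rw [hf _ z]
    · simp [sg]
    · intro b hb
      simp [Pi.mulSingle_eq_of_ne hb]
  simp only [h2] at h
  rw [ex_mul_left] at h
  linarith

/-- The induction step of Bonami's inequality. Odd powers of the separated sign average to zero, and
Cauchy-Schwarz bounds the mixed term `f ^ 2 * g ^ 2` by `3 * P * R`; then 9P² + 18PR + R² ≤ 9(P +
R)². -/
theorem ex_add_sg_mul_pow_four (a : α) (f g : (α → ℤˣ) → ℝ)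
    (hf : ∀ z z', (∀ b, b ≠ a → z b = z' b) → f z = f z')
    (hg : ∀ z z', (∀ b, b ≠ a → z b = z' b) → g z = g z') {P R : ℝ} (hP : 0 ≤ P) (hR : 0 ≤ R)
    (h1 : ex (PMF.uniformOfFintype (α → ℤˣ)) (fun z => f z ^ 4) ≤ 9 * P ^ 2)
    (h2 : ex (PMF.uniformOfFintype (α → ℤˣ)) (fun z => g z ^ 4) ≤ R ^ 2) :
    ex (PMF.uniformOfFintype (α → ℤˣ)) (fun z => (f z + sg (z a) * g z) ^ 4)
      ≤ 9 * (P + R) ^ 2 := by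
  set U := PMF.uniformOfFintype (α → ℤˣ)
  have e : ∀ z : α → ℤˣ, (f z + sg (z a) * g z) ^ 4 =
      (f z ^ 4 + (6 * (f z ^ 2 * g z ^ 2) + g z ^ 4)) +
        sg (z a) * (4 * f z ^ 3 * g z + 4 * f z * g z ^ 3) := by
    intro z
    have h := sg_sq (z a)
    generalize sg (z a) = s at h
    have h' : s ^ 2 = 1 := by rw [pow_two, h]
    have h3 : s ^ 3 = s := by rw [pow_succ, h', one_mul]
    have h4 : s ^ 4 = 1 := by rw [show s ^ 4 = (s ^ 2) ^ 2 by ring, h', one_pow]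
    ring_nf
    rw [h', h3, h4]
    ring
  simp only [e]
  rw [ex_add, ex_sg_mul_eq_zero a, ex_add, ex_add, ex_mul_left]
  · have cs := ex_mul_sq_le U (fun z => f z ^ 2) fun z => g z ^ 2
    simp only [← pow_mul, Nat.reduceMul] at cs
    have f0 : 0 ≤ ex U fun z => f z ^ 4 := ex_nonneg U fun z => by positivity
    have g0 : 0 ≤ ex U fun z => g z ^ 4 := ex_nonneg U fun z => by positivity
    have cs' : ex U (fun z => f z ^ 2 * g z ^ 2) ≤ 3 * P * R := by
      refine le_of_sq_le_sq ?_ (by positivity)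
      calc _ ≤ _ := cs
        _ ≤ (9 * P ^ 2) * R ^ 2 := by gcongr
        _ = _ := by ring
    nlinarith [mul_nonneg hP hR, sq_nonneg R]
  · intro z z' h
    rw [hf z z' h, hg z z' h]

theorem ex_linear_pow_four_uniform (c : α → ℝ) (s : Finset α) :
    ex (PMF.uniformOfFintype (α → ℤˣ)) (fun z => (∑ a ∈ s, c a * sg (z a)) ^ 4)
      ≤ 9 * (∑ a ∈ s, c a ^ 2) ^ 2 := by
  induction s using Finset.induction_on with
  | empty => simp [ex]
  | insert a s ha ih =>
    have h := ex_add_sg_mul_pow_four a (fun z => ∑ b ∈ s, c b * sg (z b)) (fun _ => c a)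
      (fun z z' h => Finset.sum_congr rfl fun b hb => by rw [h b fun e => ha (e ▸ hb)])
      (fun _ _ _ => rfl) (P := ∑ b ∈ s, c b ^ 2) (R := c a ^ 2)
      (Finset.sum_nonneg fun _ _ => sq_nonneg _) (sq_nonneg _) ih
      (by rw [ex_const]; exact le_of_eq (by ring))
    rw [Finset.sum_insert ha, add_comm (c a ^ 2)]
    refine le_trans (le_of_eq ?_) h
    congr 1
    funext z
    rw [Finset.sum_insert ha]
    ring

/-- Separating one sign leaves a linear form with coefficients `2 * A a b`, whose fourth moment is
at most `R ^ 2` with R = 12 ∑ `A a b ^ 2`. The double sum grows by 2 ∑ `A a b ^ 2`, which explains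
the factor 6. -/
theorem ex_quadratic_pow_four_uniform (A : α → α → ℝ) (hA : ∀ a b, A a b = A b a)
    (h0 : ∀ a, A a a = 0) (s : Finset α) :
    ex (PMF.uniformOfFintype (α → ℤˣ))
      (fun z => (∑ a ∈ s, ∑ b ∈ s, A a b * (sg (z a) * sg (z b))) ^ 4)
      ≤ 9 * (6 * ∑ a ∈ s, ∑ b ∈ s, A a b ^ 2) ^ 2 := by
  induction s using Finset.induction_on with
  | empty => simp [ex]
  | insert a s ha ih =>
    have h := ex_add_sg_mul_pow_four a
      (fun z => ∑ a ∈ s, ∑ b ∈ s, A a b * (sg (z a) * sg (z b)))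
      (fun z => ∑ b ∈ s, (2 * A a b) * sg (z b))
      (fun z z' h => Finset.sum_congr rfl fun b hb => Finset.sum_congr rfl fun b' hb' => by
        rw [h b fun e => ha (e ▸ hb), h b' fun e => ha (e ▸ hb')])
      (fun z z' h => Finset.sum_congr rfl fun b hb => by rw [h b fun e => ha (e ▸ hb)])
      (P := 6 * ∑ a ∈ s, ∑ b ∈ s, A a b ^ 2) (R := 3 * ∑ b ∈ s, (2 * A a b) ^ 2)
      (by positivity) (by positivity) ih
      ((ex_linear_pow_four_uniform _ s).trans (le_of_eq (by ring)))
    have e1 : ∀ z : α → ℤˣ,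
        ∑ x ∈ insert a s, ∑ b ∈ insert a s, A x b * (sg (z x) * sg (z b)) =
        ∑ x ∈ s, ∑ b ∈ s, A x b * (sg (z x) * sg (z b)) +
          sg (z a) * ∑ b ∈ s, (2 * A a b) * sg (z b) := by
      intro z
      simp only [Finset.sum_insert ha, h0, Finset.sum_add_distrib]
      rw [Finset.mul_sum, zero_mul, zero_add, ← add_assoc, ← Finset.sum_add_distrib, add_comm]
      congr 1
      refine Finset.sum_congr rfl fun b _ => ?_
      rw [hA b a]
      ring
    have e2 : ∑ x ∈ insert a s, ∑ b ∈ insert a s, A x b ^ 2 =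
        ∑ x ∈ s, ∑ b ∈ s, A x b ^ 2 + 2 * ∑ b ∈ s, A a b ^ 2 := by
      simp only [Finset.sum_insert ha, h0, Finset.sum_add_distrib]
      simp only [hA _ a]
      ring
    rw [e2]
    simp only [e1]
    refine h.trans (le_of_eq ?_)
    simp only [mul_pow, ← Finset.mul_sum]
    ring

theorem sum_pow_four {ι : Type} (s : Finset ι) (x : ι → ℝ) :
    (∑ i ∈ s, x i) ^ 4 = ∑ i ∈ s, ∑ j ∈ s, ∑ k ∈ s, ∑ l ∈ s, x i * x j * (x k * x l) := by
  rw [show (4 : ℕ) = 2 + 2 from rfl, pow_add, pow_two, Finset.sum_mul_sum]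
  rw [Finset.sum_mul]
  refine Finset.sum_congr rfl fun i _ => ?_
  rw [Finset.sum_mul]
  exact Finset.sum_congr rfl fun j _ => by simp only [Finset.mul_sum]

/-- The fourth moment of a sum is determined by the distribution of four summands at a time. -/
theorem KWise.ex_sum_pow_four {ι : Type} {D D' : PMF (α → ℤˣ)} {k : ℕ} (hD : KWise (4 * k) D)
    (hD' : KWise (4 * k) D') (s : Finset ι) (x : ι → (α → ℤˣ) → ℝ) (T : ι → Finset α)
    (hT : ∀ i, (T i).card ≤ k) (hx : ∀ i z z', (∀ a ∈ T i, z a = z' a) → x i z = x i z') :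
    ex D (fun z => (∑ i ∈ s, x i z) ^ 4) = ex D' fun z => (∑ i ∈ s, x i z) ^ 4 := by
  simp only [sum_pow_four, ex_sum]
  refine Finset.sum_congr rfl fun i _ => Finset.sum_congr rfl fun j _ =>
    Finset.sum_congr rfl fun l _ => Finset.sum_congr rfl fun r _ => ?_
  refine hD.ex_eq hD' (T i ∪ T j ∪ (T l ∪ T r)) ?_ _ fun z z' h => ?_
  · have := Finset.card_union_le (T i ∪ T j) (T l ∪ T r)
    have := Finset.card_union_le (T i) (T j)
    have := Finset.card_union_le (T l) (T r)
    have := hT i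
    have := hT j
    have := hT l
    have := hT r
    omega
  · rw [hx i z z' fun a ha => h a (by simp [ha]), hx j z z' fun a ha => h a (by simp [ha]),
      hx l z z' fun a ha => h a (by simp [ha]), hx r z z' fun a ha => h a (by simp [ha])]

theorem KWise.ex_linear_pow_four {D : PMF (α → ℤˣ)} (hD : KWise 4 D) (c : α → ℝ)
    (s : Finset α) :
    ex D (fun z => (∑ a ∈ s, c a * sg (z a)) ^ 4) ≤ 9 * (∑ a ∈ s, c a ^ 2) ^ 2 := by
  rw [KWise.ex_sum_pow_four (k := 1) hD (kWise_uniform 4) s (fun a z => c a * sg (z a))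
    (fun a => {a}) (by simp) fun a z z' h => by rw [h a (by simp)]]
  exact ex_linear_pow_four_uniform c s

theorem KWise.ex_quadratic_pow_four {D : PMF (α → ℤˣ)} (hD : KWise 8 D) (A : α → α → ℝ)
    (hA : ∀ a b, A a b = A b a) (h0 : ∀ a, A a a = 0) :
    ex D (fun z => (∑ a, ∑ b, A a b * (sg (z a) * sg (z b))) ^ 4)
      ≤ 9 * (6 * ∑ a, ∑ b, A a b ^ 2) ^ 2 := by
  have h := ex_quadratic_pow_four_uniform A hA h0 Finset.univ
  simp only [← Fintype.sum_prod_type'] at h ⊢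
  rw [KWise.ex_sum_pow_four (k := 2) hD (kWise_uniform 8) Finset.univ
    (fun (p : α × α) z => A p.1 p.2 * (sg (z p.1) * sg (z p.2))) (fun p => {p.1, p.2})
    (fun p => Finset.card_le_two) fun p z z' h => by rw [h p.1 (by simp), h p.2 (by simp)]]
  exact h

end Bonami
end BPTree
namespace BPTree

/-! ### Accuracy of the tracker -/

section Tracker

variable {n : ℕ}

theorem sum_map_eq_sum_freq (l : List (Fin n)) (f : Fin n → ℝ) :
    (l.map f).sum = ∑ x, (freq l x : ℝ) * f x := by
  rw [Finset.sum_list_map_count, ← Finset.sum_subset (Finset.subset_univ l.toFinset)]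
  · simp [freq]
  · intro x _ hx
    simp [freq, List.count_eq_zero_of_not_mem (mt List.mem_toFinset.2 hx)]

theorem freq_mono {l l' : List (Fin n)} (h : l.Sublist l') (j : Fin n) : freq l j ≤ freq l' j :=
  h.count_le j

theorem F2_mono {l l' : List (Fin n)} (h : l.Sublist l') : F2 l ≤ F2 l' := by
  unfold F2
  gcongr with j _
  exact freq_mono h j

theorem F2_nonneg (l : List (Fin n)) : 0 ≤ F2 l := Finset.sum_nonneg fun _ _ => sq_nonneg _

theorem one_le_F2 {l : List (Fin n)} {x : Fin n} (h : x ∈ l) : 1 ≤ F2 l := by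
  have h1 : (1 : ℝ) ≤ freq l x := by exact_mod_cast List.count_pos_iff.2 h
  calc (1 : ℝ) ≤ (freq l x : ℝ) ^ 2 := by nlinarith
    _ ≤ F2 l := Finset.single_le_sum (f := fun j => (freq l j : ℝ) ^ 2)
      (fun _ _ => sq_nonneg _) (Finset.mem_univ x)

theorem take_sublist_take (l : List (Fin n)) {s t : ℕ} (h : s ≤ t) :
    (l.take s).Sublist (l.take t) := by
  have : l.take s = (l.take t).take s := by rw [List.take_take, min_eq_left h]
  rw [this]
  exact List.take_sublist _ _

theorem sketchOf_eq {rows : ℕ} (S : Fin rows × Fin n → ℤˣ) (p : List (Fin n)) (i : Fin rows) :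
    (sketchOf S p i : ℝ) = ∑ x, (freq p x : ℝ) * sg (S (i, x)) := by
  rw [← sum_map_eq_sum_freq, sketchOf, Int.cast_list_sum, List.map_map]
  rfl

/-- The matrix of the quadratic form that describes the error of the estimate. -/
noncomputable def errMatrix {rows : ℕ} (p : List (Fin n)) (a b : Fin rows × Fin n) : ℝ :=
  if a.1 = b.1 ∧ a.2 ≠ b.2 then (freq p a.2 : ℝ) * freq p b.2 / rows else 0

/-- The diagonal terms of each squared row add up to the second moment exactly, because signs square
to one. What remains is an off-diagonal quadratic form, as the fourth moment bound requires. -/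
theorem estimate_sub_F2 {rows : ℕ} (hr : 0 < rows) (S : Fin rows × Fin n → ℤˣ)
    (p : List (Fin n)) :
    estimate (sketchOf S p) - F2 p =
      ∑ a, ∑ b, errMatrix p a b * (sg (S a) * sg (S b)) := by
  have hr' : (rows : ℝ) ≠ 0 := by positivity
  have key : ∀ i : Fin rows, (sketchOf S p i : ℝ) ^ 2 - F2 p =
      ∑ x, ∑ y, if x ≠ y then (freq p x : ℝ) * freq p y * (sg (S (i, x)) * sg (S (i, y)))
        else 0 := by
    intro i
    rw [sketchOf_eq, pow_two, Finset.sum_mul_sum, F2, ← Finset.sum_sub_distrib]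
    refine Finset.sum_congr rfl fun x _ => ?_
    have : (freq p x : ℝ) ^ 2 = ∑ y, if x = y then
        (freq p x : ℝ) * sg (S (i, x)) * ((freq p y : ℝ) * sg (S (i, y))) else 0 := by
      rw [Finset.sum_ite_eq, if_pos (Finset.mem_univ x)]
      linear_combination (-(freq p x : ℝ) ^ 2) * sg_sq (S (i, x))
    rw [this, ← Finset.sum_sub_distrib]
    refine Finset.sum_congr rfl fun y _ => ?_
    by_cases h : x = y
    · simp [h]
    · simp only [h, if_false, ne_eq, not_false_iff, if_true]
      ring
  have h1 : estimate (sketchOf S p) - F2 p =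
      ∑ i : Fin rows, ((sketchOf S p i : ℝ) ^ 2 - F2 p) / rows := by
    rw [← Finset.sum_div, Finset.sum_sub_distrib, estimate]
    simp
    field_simp
  rw [h1, Fintype.sum_prod_type]
  refine Finset.sum_congr rfl fun i _ => ?_
  rw [key, Finset.sum_div]
  refine Finset.sum_congr rfl fun x _ => ?_
  rw [Finset.sum_div, Fintype.sum_prod_type_right]
  refine Finset.sum_congr rfl fun y _ => ?_
  rw [Finset.sum_eq_single i]
  · simp only [errMatrix]
    by_cases h : x = y <;> simp [h]
    ring
  · intro j _ hj
    simp [errMatrix, hj.symm]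
  · simp

/-- Entrywise (a − b)² ≤ a² − b² for 0 ≤ b ≤ a, so the increments are controlled by a telescoping
quantity. Averaging over the rows leaves the factor 1 / `rows`. -/
theorem sum_errMatrix_sub_sq_le {rows : ℕ} (hr : 0 < rows) {p q : List (Fin n)}
    (h : q.Sublist p) :
    ∑ a : Fin rows × Fin n, ∑ b, (errMatrix p a b - errMatrix q a b) ^ 2 ≤
      (F2 p ^ 2 - F2 q ^ 2) / rows := by
  have hr' : (rows : ℝ) ≠ 0 := by positivity
  have hc : ∑ i : Fin rows, ∑ x : Fin n, ∑ y : Fin n,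
      (((freq p x : ℝ) ^ 2 * (freq p y : ℝ) ^ 2 - (freq q x : ℝ) ^ 2 * (freq q y : ℝ) ^ 2) /
        (rows : ℝ) ^ 2) = (F2 p ^ 2 - F2 q ^ 2) / rows := by
    simp only [← Finset.sum_div, Finset.sum_sub_distrib, ← Finset.sum_mul_sum]
    simp [F2]
    field_simp
  rw [← hc, Fintype.sum_prod_type]
  refine Finset.sum_le_sum fun i _ => Finset.sum_le_sum fun x _ => ?_
  rw [Fintype.sum_prod_type_right]
  refine Finset.sum_le_sum fun y _ => ?_
  rw [Finset.sum_eq_single i]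
  · have hx : (freq q x : ℝ) ≤ freq p x := by exact_mod_cast freq_mono h x
    have hy : (freq q y : ℝ) ≤ freq p y := by exact_mod_cast freq_mono h y
    have hxy : (freq q x : ℝ) * freq q y ≤ freq p x * freq p y := by gcongr
    have h0 : (0 : ℝ) ≤ freq q x * freq q y := by positivity
    simp only [errMatrix]
    by_cases e : x = y
    · simp only [e, ne_eq, not_true_eq_false, and_false, if_false, sub_zero]
      subst e
      have : (0 : ℝ) ≤ (freq p x : ℝ) ^ 2 * freq p x ^ 2 - (freq q x : ℝ) ^ 2 * freq q x ^ 2 := by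
        nlinarith
      simpa using div_nonneg this (sq_nonneg (rows : ℝ))
    · simp only [e, ne_eq, not_false_iff, and_true, if_true]
      rw [← sub_div, div_pow]
      gcongr
      nlinarith
  · intro j _ hj
    simp [errMatrix, hj.symm]
  · simp

/-- The tracker has accuracy `1/100` at all times with probability at least `19/20`. -/
theorem tracker_accuracy {rows : ℕ} (hr : 300000000 ≤ rows) {D : PMF (Fin rows × Fin n → ℤˣ)}
    (hD : KWise 8 D) (p : List (Fin n)) :
    19 / 20 ≤ prob D {S | ∀ t ≤ p.length,
      |estimate (sketchOf S (p.take t)) - F2 (p.take t)| ≤ 1 / 100 * F2 p} := by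
  have hr0 : 0 < rows := by omega
  have hrR : (300000000 : ℝ) ≤ rows := by exact_mod_cast hr
  have hz : ∀ S : Fin rows × Fin n → ℤˣ, estimate (sketchOf S (p.take 0)) - F2 (p.take 0) = 0 := by
    intro S
    simp [estimate, sketchOf, F2, freq]
  rcases p with _ | ⟨x0, p'⟩
  · have : {S : Fin rows × Fin n → ℤˣ | ∀ t ≤ ([] : List (Fin n)).length,
      |estimate (sketchOf S (([] : List (Fin n)).take t)) - F2 (([] : List (Fin n)).take t)|
        ≤ 1 / 100 * F2 ([] : List (Fin n))} = Set.univ := by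
      ext S
      simp only [Set.mem_ofPred_eq, Set.mem_univ, iff_true]
      intro t ht
      rw [Nat.le_zero.1 ht, hz S]
      simp [F2, freq]
    rw [this, ← compl_compl Set.univ, prob_compl]
    simp [prob]
    norm_num
  set p := x0 :: p'
  have hF : 1 ≤ F2 p := one_le_F2 (x := x0) (by simp [p])
  set F := F2 p
  -- The difference of the squared second moments is at most `2 * F` times the difference of the
  -- second moments, so the second moment of the prefix can serve as the clock; 1296 = 9 · (6 · 2)².
  have hinc : ∀ s t, s ≤ t → t ≤ p.length → ex D (fun S =>
      (estimate (sketchOf S (p.take t)) - F2 (p.take t) -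
        (estimate (sketchOf S (p.take s)) - F2 (p.take s))) ^ 4) ≤
      1296 * F ^ 2 / rows ^ 2 * (F2 (p.take t) - F2 (p.take s)) ^ 2 := by
    intro s t hst _
    have hsub := take_sublist_take p hst
    have h1 := hD.ex_quadratic_pow_four
      (fun a b => errMatrix (p.take t) a b - errMatrix (p.take s) a b)
      (fun a b => by simp only [errMatrix, eq_comm, ne_eq, mul_comm]) (fun a => by simp [errMatrix])
    have h2 := sum_errMatrix_sub_sq_le hr0 hsub
    have h3 : F2 (p.take t) ≤ F := F2_mono (List.take_sublist t p)
    have h4 := F2_mono hsub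
    have h5 := F2_nonneg (p.take s)
    have h6 : (F2 (p.take t) ^ 2 - F2 (p.take s) ^ 2) / rows ≤
        2 * F * (F2 (p.take t) - F2 (p.take s)) / rows := by
      gcongr
      nlinarith
    have e : ∀ S : Fin rows × Fin n → ℤˣ, estimate (sketchOf S (p.take t)) - F2 (p.take t) -
        (estimate (sketchOf S (p.take s)) - F2 (p.take s)) = ∑ a, ∑ b,
          (errMatrix (p.take t) a b - errMatrix (p.take s) a b) * (sg (S a) * sg (S b)) := by
      intro S
      simp only [estimate_sub_F2 hr0, sub_mul, Finset.sum_sub_distrib]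
    simp only [e]
    refine h1.trans ?_
    calc _ ≤ 9 * (6 * (2 * F * (F2 (p.take t) - F2 (p.take s)) / rows)) ^ 2 := by
          have : 0 ≤ ∑ a : Fin rows × Fin n, ∑ b,
            (errMatrix (p.take t) a b - errMatrix (p.take s) a b) ^ 2 := by positivity
          gcongr
          exact h2.trans h6
      _ = _ := by ring
  obtain ⟨M, hM0, hM1, hM2⟩ := exists_maximal D
    (fun t S => estimate (sketchOf S (p.take t)) - F2 (p.take t)) (fun t => F2 (p.take t))
    (A := 1296 * F ^ 2 / rows ^ 2) (by positivity) p.length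
    (fun s t hst _ => F2_mono (take_sublist_take p hst)) hinc 0 p.length (Nat.zero_le _) le_rfl
  -- Here 1440² = 1600 · 1296. The resulting bound is 14400000 / `rows`, which is below 1/20 once
  -- there are 288000000 rows.
  have hb := prob_le_of_fourth_moment D {S | ∀ t ≤ p.length,
    |estimate (sketchOf S (p.take t)) - F2 (p.take t)| ≤ 1 / 100 * F}ᶜ M
    (l := 1 / 100 * F) (v := 1440 * F ^ 2 / rows) (by positivity) (by positivity) hM0 ?_ ?_
  · rw [prob_compl] at hb
    have : 1440 * F ^ 2 / rows / (1 / 100 * F) ^ 2 = 14400000 / rows := by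
      field_simp
      norm_num
    rw [this] at hb
    have : (14400000 : ℝ) / rows ≤ 1 / 20 := by
      rw [div_le_div_iff₀ (by positivity) (by norm_num)]
      linarith
    linarith
  · intro S hS
    simp only [Set.mem_compl_iff, Set.mem_ofPred_eq, not_forall, not_le] at hS
    obtain ⟨t, ht, hlt⟩ := hS
    have h1 := hM1 S t (Nat.zero_le _) ht
    rw [hz S, sub_zero] at h1
    refine le_trans ?_ h1
    rw [← Even.pow_abs (by decide : Even 4)
      (estimate (sketchOf S (p.take t)) - F2 (p.take t))]
    gcongr
  · refine hM2.trans (le_of_eq ?_)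
    simp only [List.take_length, List.take_zero]
    have : F2 ([] : List (Fin n)) = 0 := by simp [F2, freq]
    rw [this]
    change 1600 * (1296 * F ^ 2 / rows ^ 2) * (F - 0) ^ 2 = _
    ring

/-! ### Signed counts of a set of items -/

/-- The sum of the signs of the items of `l` that belong to `A`. -/
def signSum (Z : Fin n → ℤˣ) (A : Finset (Fin n)) (l : List (Fin n)) : ℤ :=
  (l.map fun x => if x ∈ A then ((Z x : ℤˣ) : ℤ) else 0).sum

theorem signSum_eq (Z : Fin n → ℤˣ) (A : Finset (Fin n)) (l : List (Fin n)) :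
    (signSum Z A l : ℝ) = ∑ j ∈ A, (freq l j : ℝ) * sg (Z j) := by
  rw [signSum, Int.cast_list_sum, List.map_map, sum_map_eq_sum_freq]
  rw [← Finset.sum_subset (Finset.subset_univ A)]
  · exact Finset.sum_congr rfl fun x hx => by simp [hx, sg]
  · intro x _ hx
    simp [hx]

/-- The squared frequency increments are at most the increments of the squared frequencies, so the
second moment restricted to `A` is a valid clock; 120² = 1600 · 9. -/
theorem prob_signSum_large {D : PMF (Fin n → ℤˣ)} (hD : KWise 4 D) (A : Finset (Fin n))
    (q : List (Fin n)) {l : ℝ} (hl : 0 < l) :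
    prob D {Z | ∃ t ≤ q.length, l < |(signSum Z A (q.take t) : ℝ)|} ≤
      120 * (∑ j ∈ A, (freq q j : ℝ) ^ 2) / l ^ 2 := by
  set g := ∑ j ∈ A, (freq q j : ℝ) ^ 2
  have hinc : ∀ s t, s ≤ t → t ≤ q.length → ex D (fun Z =>
      ((signSum Z A (q.take t) : ℝ) - signSum Z A (q.take s)) ^ 4) ≤
      9 * (∑ j ∈ A, (freq (q.take t) j : ℝ) ^ 2 - ∑ j ∈ A, (freq (q.take s) j : ℝ) ^ 2) ^ 2 := by
    intro s t hst _
    have h1 := hD.ex_linear_pow_four (fun j => (freq (q.take t) j : ℝ) - freq (q.take s) j) A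
    simp only [signSum_eq, ← Finset.sum_sub_distrib, ← sub_mul]
    refine h1.trans ?_
    gcongr with j _
    have : (freq (q.take s) j : ℝ) ≤ freq (q.take t) j := by
      exact_mod_cast freq_mono (take_sublist_take q hst) j
    have : (0 : ℝ) ≤ freq (q.take s) j := by positivity
    nlinarith
  obtain ⟨M, hM0, hM1, hM2⟩ := exists_maximal D
    (fun t Z => (signSum Z A (q.take t) : ℝ)) (fun t => ∑ j ∈ A, (freq (q.take t) j : ℝ) ^ 2)
    (A := 9) (by norm_num) q.length
    (fun s t hst _ => by gcongr with j _; exact freq_mono (take_sublist_take q hst) j)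
    hinc 0 q.length (Nat.zero_le _) le_rfl
  refine prob_le_of_fourth_moment D _ M hl (by positivity) hM0 ?_ ?_
  · rintro Z ⟨t, ht, hlt⟩
    have h1 := hM1 Z t (Nat.zero_le _) ht
    refine le_trans ?_ h1
    have : signSum Z A (q.take 0) = 0 := by simp [signSum]
    rw [this, Int.cast_zero, sub_zero, ← Even.pow_abs (by decide : Even 4)
      (signSum Z A (q.take t) : ℝ)]
    gcongr
  · refine hM2.trans (le_of_eq ?_)
    simp only [List.take_length, List.take_zero]
    simp only [freq, List.count_nil]
    change 1600 * 9 * (g - _) ^ 2 = _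
    simp
    ring

end Tracker
end BPTree
namespace BPTree

/-! ### One round of HH1 -/

section Round

variable {n : ℕ}

theorem freq_append (l l' : List (Fin n)) (j : Fin n) : freq (l ++ l') j = freq l j + freq l' j :=
  List.count_append

theorem freq_cons (x : Fin n) (l : List (Fin n)) (j : Fin n) :
    freq (x :: l) j = freq l j + if x = j then 1 else 0 := by
  simp [freq, List.count_cons]

theorem signSum_append_singleton (Z : Fin n → ℤˣ) (A : Finset (Fin n)) (l : List (Fin n))
    (x : Fin n) : signSum Z A (l ++ [x]) = signSum Z A l + if x ∈ A then ((Z x : ℤˣ) : ℤ) else 0 := by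
  simp [signSum]

/-- HH1 reads a list of items. -/
noncomputable def HH1State.run {rows : ℕ} (fam : Families n rows) :
    List (Fin n) → HH1State n → PMF (HH1State n)
  | [], s => PMF.pure s
  | x :: l, s => (s.step fam x).bind (HH1State.run fam l)

open Classical in
/-- The items other than `H` whose labels agree with that of `H` on the first `r - 1` bits. -/
noncomputable def survivors (h : Fin n → ℕ → Bool) (H : Fin n) (r : ℕ) : Finset (Fin n) :=
  Finset.univ.filter fun j => j ≠ H ∧ ∀ i ∈ Finset.Icc 1 (r - 1), h j i = h H i

theorem mem_survivors {h : Fin n → ℕ → Bool} {H : Fin n} {r : ℕ} {j : Fin n} :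
    j ∈ survivors h H r ↔ j ≠ H ∧ ∀ i ∈ Finset.Icc 1 (r - 1), h j i = h H i := by
  simp [survivors]

/-- The survivors that are counted together with `H` in round `r`. -/
noncomputable def sameSide (h : Fin n → ℕ → Bool) (H : Fin n) (r : ℕ) : Finset (Fin n) :=
  (survivors h H r).filter fun j => h j r = h H r

/-- The survivors that are not counted together with `H` in round `r`. -/
noncomputable def otherSide (h : Fin n → ℕ → Bool) (H : Fin n) (r : ℕ) : Finset (Fin n) :=
  (survivors h H r).filter fun j => ¬ h j r = h H r

/-- The threshold of round `r`. -/
noncomputable def thr (σ : ℝ) (r : ℕ) : ℝ := (1 / 32 : ℝ) * σ * (3 / 4 : ℝ) ^ r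

theorem thr_pos {σ : ℝ} (hσ : 0 < σ) (r : ℕ) : 0 < thr σ r := by
  unfold thr
  positivity

/-- A state of HH1 in round `r`, all of whose recorded bits agree with the label of `H`. -/
structure HH1State.Good (h : Fin n → ℕ → Bool) (H : Fin n) (σ : ℝ) (R r : ℕ)
    (s : HH1State n) : Prop where
  σ_eq : s.σ = σ
  R_eq : s.R = R
  h_eq : s.h = h
  r_eq : s.r = r
  b_eq : ∀ i ∈ Finset.Icc 1 (r - 1), s.b i = h H i

variable {h : Fin n → ℕ → Bool} {H : Fin n} {σ : ℝ} {R r : ℕ} {s : HH1State n}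

theorem HH1State.Good.active_iff (hs : s.Good h H σ R r) (x : Fin n) :
    s.Active x ↔ x = H ∨ x ∈ survivors h H r := by
  unfold HH1State.Active
  rw [hs.r_eq, hs.h_eq, mem_survivors]
  constructor
  · intro hx
    by_cases e : x = H
    · exact Or.inl e
    · exact Or.inr ⟨e, fun i hi => (hx i hi).trans (hs.b_eq i hi)⟩
  · rintro (rfl | ⟨_, hx⟩) i hi
    · exact (hs.b_eq i hi).symm
    · exact (hx i hi).trans (hs.b_eq i hi).symm

theorem HH1State.Good.count (hs : s.Good h H σ R r) (x : Fin n) : (s.count x).Good h H σ R r :=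
  ⟨hs.σ_eq, hs.R_eq, hs.h_eq, hs.r_eq, hs.b_eq⟩

/-- One of the two counters. -/
def HH1State.side (s : HH1State n) (b : Bool) : ℤ := if b then s.X1 else s.X0

theorem HH1State.X0_add_X1 (s : HH1State n) (b : Bool) : s.X0 + s.X1 = s.side b + s.side (!b) := by
  cases b <;> simp [side, add_comm]

theorem HH1State.Good.side_count (hs : s.Good h H σ R r) (x : Fin n) (b : Bool) :
    (s.count x).side b = s.side b + if h x r = b then ((s.Z x : ℤˣ) : ℤ) else 0 := by
  simp only [side, HH1State.count, hs.h_eq, hs.r_eq]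
  cases b <;> cases h x r <;> simp

/-- The counters of `s` are those obtained from the items `pre` read in round `r`. -/
def HH1State.Counted (h : Fin n → ℕ → Bool) (H : Fin n) (r : ℕ) (pre : List (Fin n))
    (s : HH1State n) : Prop :=
  s.side (h H r) = ((s.Z H : ℤˣ) : ℤ) * freq pre H + signSum s.Z (sameSide h H r) pre ∧
    s.side (!(h H r)) = signSum s.Z (otherSide h H r) pre

theorem HH1State.Counted.skip {pre : List (Fin n)} (hc : s.Counted h H r pre) {x : Fin n}
    (hx : ¬(x = H ∨ x ∈ survivors h H r)) : s.Counted h H r (pre ++ [x]) := by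
  push Not at hx
  have h1 : x ∉ sameSide h H r := fun hm => hx.2 (Finset.mem_filter.1 hm).1
  have h2 : x ∉ otherSide h H r := fun hm => hx.2 (Finset.mem_filter.1 hm).1
  obtain ⟨c1, c2⟩ := hc
  constructor
  · rw [c1, signSum_append_singleton, freq_append, freq_cons, if_neg h1, if_neg hx.1]
    simp [freq]
  · rw [c2, signSum_append_singleton, if_neg h2, add_zero]

theorem HH1State.Counted.count {pre : List (Fin n)} (hs : s.Good h H σ R r)
    (hc : s.Counted h H r pre) {x : Fin n} (hx : x = H ∨ x ∈ survivors h H r) :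
    (s.count x).Counted h H r (pre ++ [x]) := by
  obtain ⟨c1, c2⟩ := hc
  have hH : H ∉ survivors h H r := fun hm => (mem_survivors.1 hm).1 rfl
  unfold HH1State.Counted
  rw [hs.side_count, hs.side_count, c1, c2, show (s.count x).Z = s.Z from rfl,
    signSum_append_singleton, signSum_append_singleton, freq_append, freq_cons]
  rcases hx with rfl | hx
  · have h1 : x ∉ sameSide h x r := fun hm => hH (Finset.mem_filter.1 hm).1
    have h2 : x ∉ otherSide h x r := fun hm => hH (Finset.mem_filter.1 hm).1
    rw [if_neg h1, if_neg h2]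
    simp [freq]
    ring
  · have hne : x ≠ H := fun e => hH (e ▸ hx)
    rw [if_neg hne]
    by_cases e : h x r = h H r
    · have h1 : x ∈ sameSide h H r := Finset.mem_filter.2 ⟨hx, e⟩
      have h2 : x ∉ otherSide h H r := fun hm => (Finset.mem_filter.1 hm).2 e
      rw [if_pos h1, if_neg h2]
      simp [e, freq]
      ring
    · have h1 : x ∉ sameSide h H r := fun hm => e (Finset.mem_filter.1 hm).2
      have h2 : x ∈ otherSide h H r := Finset.mem_filter.2 ⟨hx, e⟩
      rw [if_neg h1, if_pos h2]
      have e' : h x r = !(h H r) := by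
        cases h1 : h x r <;> cases h2 : h H r <;> simp_all
      simp [e', freq]

/-- The signed counts of the survivors are small at all times while the list `q` is read. -/
def Quiet (h : Fin n → ℕ → Bool) (H : Fin n) (σ : ℝ) (r : ℕ) (Z : Fin n → ℤˣ)
    (q : List (Fin n)) : Prop :=
  ∀ t ≤ q.length, |(signSum Z (sameSide h H r) (q.take t) : ℝ)| ≤ thr σ r / 4 ∧
    |(signSum Z (otherSide h H r) (q.take t) : ℝ)| ≤ thr σ r / 4

theorem abs_units_mul (u : ℤˣ) (x : ℝ) : |((u : ℤ) : ℝ) * x| = |x| := by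
  rcases Int.units_eq_one_or u with rfl | rfl <;> simp

/-- In a quiet round that starts with enough occurrences of `H` ahead, the bit of `H` is recorded
after few of them. If all survivors have the sign opposite to that of `H`, then it is `H` that ends
the round. -/
theorem HH1State.run_round {rows : ℕ} (fam : Families n rows) (hσ : 0 < σ) (hr : r < R)
    (pre rem : List (Fin n)) (s : HH1State n) (hs : s.Good h H σ R r)
    (hc : s.Counted h H r pre) (hq : Quiet h H σ r s.Z (pre ++ rem))
    (hlt : |((s.X0 + s.X1 : ℤ) : ℝ)| < thr σ r)
    (hcnt : 3 / 2 * thr σ r < freq (pre ++ rem) H) :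
    ∃ (s' : HH1State n) (x : Fin n) (l : List (Fin n)),
      s.run fam rem = (s'.nextRound fam).bind (HH1State.run fam l) ∧ s'.Good h H σ R r ∧
      decide (|s'.X0| < |s'.X1|) = h H r ∧ s'.H = some x ∧ l <:+ rem ∧
      (freq (pre ++ rem) H : ℝ) ≤ 3 / 2 * thr σ r + 1 + freq l H ∧
      ((∀ j ∈ survivors h H r, j ∈ pre ++ rem → s.Z j = - s.Z H) → x = H) := by
  have hθ := thr_pos hσ r
  -- the counters while `pre` is a prefix
  have bound : ∀ (pre rem : List (Fin n)) (s : HH1State n), s.Counted h H r pre →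
      Quiet h H σ r s.Z (pre ++ rem) →
      |(signSum s.Z (sameSide h H r) pre : ℝ)| ≤ thr σ r / 4 ∧
        |(signSum s.Z (otherSide h H r) pre : ℝ)| ≤ thr σ r / 4 ∧
      ((s.X0 + s.X1 : ℤ) : ℝ) = ((s.Z H : ℤˣ) : ℤ) * (freq pre H : ℝ) +
        (signSum s.Z (sameSide h H r) pre : ℝ) + (signSum s.Z (otherSide h H r) pre : ℝ) := by
    intro pre rem s hc hq
    have h1 := hq pre.length (by simp)
    rw [List.take_left'] at h1
    · refine ⟨h1.1, h1.2, ?_⟩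
      rw [s.X0_add_X1 (h H r), hc.1, hc.2]
      push_cast
      ring
    · rfl
  -- Before the crossing the total is below the threshold and each noise term is at most a quarter
  -- of it, so the count of `H` is at most 1 + 1/4 + 1/4 thresholds. With more occurrences of `H`
  -- available the round must end.
  have few : ∀ (pre rem : List (Fin n)) (s : HH1State n), s.Counted h H r pre →
      Quiet h H σ r s.Z (pre ++ rem) → |((s.X0 + s.X1 : ℤ) : ℝ)| < thr σ r →
      (freq pre H : ℝ) ≤ 3 / 2 * thr σ r := by
    intro pre rem s hc hq hlt
    obtain ⟨b1, b2, b3⟩ := bound pre rem s hc hq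
    have e : ((s.Z H : ℤˣ) : ℤ) * (freq pre H : ℝ) = ((s.X0 + s.X1 : ℤ) : ℝ) -
      (signSum s.Z (sameSide h H r) pre : ℝ) - (signSum s.Z (otherSide h H r) pre : ℝ) := by
      rw [b3]; ring
    have e2 : (freq pre H : ℝ) = |((s.Z H : ℤˣ) : ℤ) * (freq pre H : ℝ)| := by
      rw [abs_units_mul, abs_of_nonneg (by positivity)]
    rw [e2, e]
    rw [abs_lt] at hlt
    rw [abs_le] at b1 b2 ⊢
    constructor <;> linarith
  induction rem generalizing pre s with
  | nil =>
    have := few pre [] s hc hq hlt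
    rw [List.append_nil] at hcnt
    linarith
  | cons x l ih =>
    have hsplit : pre ++ x :: l = (pre ++ [x]) ++ l := by simp
    by_cases hx : x = H ∨ x ∈ survivors h H r
    · have hact : s.r < s.R ∧ s.Active x := ⟨by rw [hs.r_eq, hs.R_eq]; exact hr,
        (hs.active_iff x).2 hx⟩
      have hc' := HH1State.Counted.count hs hc hx
      have hs' := hs.count x
      have hq' : Quiet h H σ r (s.count x).Z ((pre ++ [x]) ++ l) := by rw [← hsplit]; exact hq
      by_cases hge : thr σ r ≤ |(((s.count x).X0 + (s.count x).X1 : ℤ) : ℝ)|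
      · refine ⟨s.count x, x, l, ?_, hs', ?_, rfl, List.suffix_cons x l, ?_, fun hopp => ?_⟩
        · rw [HH1State.run, HH1State.step, if_pos hact, if_pos]
          rw [hs.σ_eq, hs.r_eq]
          exact hge
        · obtain ⟨b1, b2, b3⟩ := bound _ _ _ hc' hq'
          obtain ⟨c1, c2⟩ := hc'
          set s' := s.count x
          have e1 : (s'.side (!(h H r)) : ℝ) = signSum s'.Z (otherSide h H r) (pre ++ [x]) := by
            rw [c2]
          have e2 : ((s'.X0 + s'.X1 : ℤ) : ℝ) = s'.side (h H r) + s'.side (!(h H r)) := by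
            rw [s'.X0_add_X1 (h H r)]; push_cast; rfl
          -- The total reaches the threshold and the other side holds at most a quarter of it, so at
          -- least three quarters are on the side of `H`.
          have h1 : |(s'.side (!(h H r)) : ℝ)| < |(s'.side (h H r) : ℝ)| := by
            have h2 := abs_add_le (s'.side (h H r) : ℝ) (s'.side (!(h H r)))
            rw [← e2] at h2
            rw [← e1] at b2
            linarith
          have h2 : |s'.side (!(h H r))| < |s'.side (h H r)| := by exact_mod_cast h1
          cases hb : h H r
          · simp only [hb, HH1State.side, Bool.not_false, if_true, Bool.false_eq_true,
              if_false] at h2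
            simpa using h2.le
          · simp only [hb, HH1State.side, Bool.not_true, if_true, Bool.false_eq_true,
              if_false] at h2
            simpa using h2
        · have := few pre (x :: l) s hc hq hlt
          rw [freq_append, freq_cons]
          push_cast
          split_ifs <;> linarith
        -- Suppose a survivor with the sign opposite to that of `H` ended the round. In units of the
        -- sign of `H`, the total just decreased, so it can only have crossed the negative
        -- threshold; but the noise never pushes it below minus half of the threshold.
        · by_contra hne
          have hsx : x ∈ survivors h H r := hx.resolve_left hne
          have hz : s.Z x = - s.Z H := hopp x hsx (by simp)
          obtain ⟨b1, b2, b3⟩ := bound _ _ _ hc' hq'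
          have hZ : (s.count x).Z = s.Z := rfl
          rw [hZ] at b1 b2 b3
          have e : ((s.count x).X0 + (s.count x).X1 : ℤ) = s.X0 + s.X1 + ((s.Z x : ℤˣ) : ℤ) := by
            simp only [HH1State.count]
            split_ifs <;> ring
          have e' : (((s.count x).X0 + (s.count x).X1 : ℤ) : ℝ) = ((s.X0 + s.X1 : ℤ) : ℝ) -
              ((s.Z H : ℤ) : ℝ) := by
            rw [e, hz]
            push_cast
            ring
          have hf : (0 : ℝ) ≤ freq (pre ++ [x]) H := by positivity
          rw [abs_le] at b1 b2
          rw [abs_lt] at hlt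
          rw [le_abs] at hge
          rcases Int.units_eq_one_or (s.Z H) with hu | hu
          · rw [hu] at b3 e'
            simp only [Units.val_one, Int.cast_one, one_mul] at b3 e'
            rcases hge with hge | hge <;> linarith
          · rw [hu] at b3 e'
            simp only [Units.val_neg, Units.val_one, Int.cast_neg, Int.cast_one] at b3 e'
            rcases hge with hge | hge <;> linarith
      · obtain ⟨s', y, l', h1, h2, h3, h4, h5, h6, h7⟩ := ih (pre ++ [x]) (s.count x) hs' hc' hq'
          (not_le.1 hge) (by rw [← hsplit]; exact hcnt)
        refine ⟨s', y, l', ?_, h2, h3, h4, h5.trans (List.suffix_cons x l), ?_, ?_⟩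
        · rw [HH1State.run, HH1State.step, if_pos hact, if_neg, PMF.pure_bind, h1]
          rw [hs.σ_eq, hs.r_eq]
          exact hge
        · rw [hsplit]; exact h6
        · rw [hsplit]; exact h7
    · obtain ⟨s', y, l', h1, h2, h3, h4, h5, h6, h7⟩ := ih (pre ++ [x]) s hs (hc.skip hx)
        (by rw [← hsplit]; exact hq) hlt (by rw [← hsplit]; exact hcnt)
      refine ⟨s', y, l', ?_, h2, h3, h4, h5.trans (List.suffix_cons x l), ?_, ?_⟩
      · rw [HH1State.run, HH1State.step, if_neg fun hh => hx ((hs.active_iff x).1 hh.2),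
          PMF.pure_bind, h1]
      · rw [hsplit]; exact h6
      · rw [hsplit]; exact h7

end Round
end BPTree
namespace BPTree

/-! ### Failure probability of HH1 for fixed labels -/

section HH1

variable {n : ℕ}

theorem HH1State.run_of_le {rows : ℕ} (fam : Families n rows) (l : List (Fin n))
    (s : HH1State n) (hs : s.R ≤ s.r) : s.run fam l = PMF.pure s := by
  induction l with
  | nil => rfl
  | cons x l ih =>
    rw [HH1State.run, HH1State.step, if_neg fun hh => absurd hh.1 (not_lt.2 hs), PMF.pure_bind, ih]

open Classical in
/-- The survivors that occur in the list `q`. -/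
noncomputable def present (h : Fin n → ℕ → Bool) (H : Fin n) (r : ℕ) (q : List (Fin n)) :
    Finset (Fin n) := (survivors h H r).filter fun j => j ∈ q

/-- The two signs agree only if both are 1 or both are −1, and pairwise independence gives 1/4 to
each case. -/
theorem prob_eq_sign_le {D : PMF (Fin n → ℤˣ)} (hD : KWise 4 D) {j H : Fin n} (hj : j ≠ H) :
    prob D {Z | Z j ≠ - Z H} ≤ 1 / 2 := by
  have hp : ∀ u : ℤˣ, prob D {Z | ∀ a ∈ ({j, H} : Finset (Fin n)), Z a = (fun _ => u) a} =
      1 / 4 := by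
    intro u
    have hc : ({j, H} : Finset (Fin n)).card = 2 := Finset.card_pair hj
    rw [prob, hD _ (by omega), hc]
    simp [ENNReal.toReal_pow]
    norm_num
  have hsub : {Z : Fin n → ℤˣ | Z j ≠ - Z H} ⊆
      {Z | ∀ a ∈ ({j, H} : Finset (Fin n)), Z a = (fun _ => 1) a} ∪
      {Z | ∀ a ∈ ({j, H} : Finset (Fin n)), Z a = (fun _ => -1) a} := by
    intro Z hZ
    have hZ' : Z j ≠ - Z H := hZ
    simp only [Set.mem_union, Set.mem_ofPred_eq, Finset.mem_insert, Finset.mem_singleton,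
      forall_eq_or_imp, forall_eq]
    rcases Int.units_eq_one_or (Z j) with h1 | h1 <;>
      rcases Int.units_eq_one_or (Z H) with h2 | h2 <;> simp_all
  refine (prob_mono D hsub).trans ((prob_union_le _ _ _).trans ?_)
  rw [hp, hp]
  norm_num

theorem sum_sameSide_add_otherSide (h : Fin n → ℕ → Bool) (H : Fin n) (r : ℕ) (f : Fin n → ℝ) :
    ∑ j ∈ sameSide h H r, f j + ∑ j ∈ otherSide h H r, f j = ∑ j ∈ survivors h H r, f j :=
  Finset.sum_filter_add_sum_filter_not _ _ _

/-- The maximal bound is applied to each side with a quarter of the threshold, whence 1920 = 120 ·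
16, and the second moments of the two sides add up to that of all survivors. -/
theorem prob_not_quiet_le {D : PMF (Fin n → ℤˣ)} (hD : KWise 4 D) (h : Fin n → ℕ → Bool)
    (H : Fin n) {σ : ℝ} (hσ : 0 < σ) (r : ℕ) (l : List (Fin n)) :
    prob D {Z | ¬ Quiet h H σ r Z l} ≤
      1920 * (∑ j ∈ survivors h H r, (freq l j : ℝ) ^ 2) / thr σ r ^ 2 := by
  have hθ := thr_pos hσ r
  have h1 := prob_signSum_large hD (sameSide h H r) l (l := thr σ r / 4) (by positivity)
  have h2 := prob_signSum_large hD (otherSide h H r) l (l := thr σ r / 4) (by positivity)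
  refine (prob_mono D (T := _ ∪ _) ?_).trans ((prob_union_le _ _ _).trans
    ((add_le_add h1 h2).trans (le_of_eq ?_)))
  · intro Z hZ
    have hZ' : ¬ Quiet h H σ r Z l := hZ
    unfold Quiet at hZ'
    push Not at hZ'
    obtain ⟨t, ht, hh⟩ := hZ'
    by_cases hc : |(signSum Z (sameSide h H r) (l.take t) : ℝ)| ≤ thr σ r / 4
    · exact Or.inr ⟨t, ht, hh hc⟩
    · exact Or.inl ⟨t, ht, not_le.1 hc⟩
  · rw [← sum_sameSide_add_otherSide]
    field_simp
    ring

/-- HH1 fails with small probability for labels such that few other items share long prefixes of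
their labels with `H`. -/
theorem HH1State.prob_fail_le {rows : ℕ} (fam : Families n rows) (h : Fin n → ℕ → Bool)
    (H : Fin n) {σ : ℝ} (hσ : 0 < σ) (R : ℕ) (q : List (Fin n)) (r : ℕ) (hr1 : 1 ≤ r)
    (hr : r < R) (l : List (Fin n)) (hl : l <:+ q) (s : HH1State n) (hs : s.Good h H σ R r)
    (h0 : s.X0 = 0) (h1 : s.X1 = 0)
    (hcnt : ∑ i ∈ Finset.Ico r R, (3 / 2 * thr σ i + 1) < freq l H) :
    prob (fam.sign.bind fun Z => HH1State.run fam l { s with Z := Z }) {s | s.H ≠ some H} ≤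
      ∑ i ∈ Finset.Ico r R,
        1920 * (∑ j ∈ survivors h H i, (freq q j : ℝ) ^ 2) / thr σ i ^ 2 +
      ((present h H (R - 1) q).card : ℝ) / 2 := by
  induction hd : R - r generalizing r l s with
  | zero => omega
  | succ d ih =>
  have hθ := thr_pos hσ r
  have hε : 1920 * (∑ j ∈ survivors h H r, (freq l j : ℝ) ^ 2) / thr σ r ^ 2 ≤
      1920 * (∑ j ∈ survivors h H r, (freq q j : ℝ) ^ 2) / thr σ r ^ 2 := by
    gcongr with j _
    exact freq_mono hl.sublist j
  have hquiet := (prob_not_quiet_le fam.sign_kWise h H hσ r l).trans hε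
  have hrest : ∀ i, 0 ≤ 3 / 2 * thr σ i + 1 := fun i => by have := thr_pos hσ i; positivity
  have hsum := Finset.sum_eq_sum_Ico_succ_bot hr fun i => 3 / 2 * thr σ i + 1
  have hround : ∀ Z, Quiet h H σ r Z l → ∃ (s' : HH1State n) (x : Fin n) (l' : List (Fin n)),
      HH1State.run fam l { s with Z := Z } = (s'.nextRound fam).bind (HH1State.run fam l') ∧
      s'.Good h H σ R r ∧ decide (|s'.X0| < |s'.X1|) = h H r ∧ s'.H = some x ∧ l' <:+ l ∧
      (freq l H : ℝ) ≤ 3 / 2 * thr σ r + 1 + freq l' H ∧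
      ((∀ j ∈ survivors h H r, j ∈ l → Z j = - Z H) → x = H) := by
    intro Z hZ
    refine HH1State.run_round fam hσ hr [] l { s with Z := Z }
      ⟨hs.σ_eq, hs.R_eq, hs.h_eq, hs.r_eq, hs.b_eq⟩ ?_ hZ ?_ ?_
    · constructor <;> simp [HH1State.side, h0, h1, freq, signSum]
    · simpa [h0, h1] using hθ
    · have := Finset.sum_nonneg (s := Finset.Ico (r + 1) R) fun i _ => hrest i
      rw [List.nil_append]
      linarith
  rcases (show r + 1 ≤ R from hr).eq_or_lt with hlast | hlt
  · -- the last round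
    have hIco : Finset.Ico r R = {r} := by
      rw [← hlast]; simp
    have hR1 : R - 1 = r := by omega
    rw [hIco, Finset.sum_singleton, hR1]
    have hopp : prob fam.sign (⋃ j ∈ present h H r q, {Z | Z j ≠ - Z H}) ≤
        ((present h H r q).card : ℝ) / 2 := by
      refine (prob_biUnion_le _ _ _).trans ?_
      calc _ ≤ ∑ j ∈ present h H r q, (1 / 2 : ℝ) := Finset.sum_le_sum fun j hj =>
            prob_eq_sign_le fam.sign_kWise (mem_survivors.1 (Finset.mem_filter.1 hj).1).1
        _ = _ := by simp [div_eq_mul_inv]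
    refine (prob_bind_le fam.sign _ _ ({Z | ¬ Quiet h H σ r Z l} ∪
      ⋃ j ∈ present h H r q, {Z | Z j ≠ - Z H}) le_rfl fun Z hZ => ?_).trans ?_
    · simp only [Set.mem_union, Set.mem_ofPred_eq, not_or, not_not, Set.mem_iUnion,
        not_exists] at hZ
      obtain ⟨s', x, l', e1, e2, e3, e4, e5, e6, e7⟩ := hround Z hZ.1
      have hxH : x = H := e7 fun j hj hjl =>
        hZ.2 j (Finset.mem_filter.2 ⟨hj, hl.subset hjl⟩)
      rw [e1, HH1State.nextRound, PMF.bind_map, prob_bind]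
      refine le_of_eq ?_
      rw [← ex_const fam.sign 0]
      congr 1
      funext Z'
      classical
      simp only [Function.comp]
      -- After round `R - 1` the round number is `R` and the copy is frozen, so its candidate is the
      -- item that ended this round.
      rw [HH1State.run_of_le _ _ _ (by simp [e2.R_eq, e2.r_eq, hlast]), prob_pure]
      simp [e4, hxH]
    · rw [add_zero]
      exact (prob_union_le _ _ _).trans (add_le_add hquiet hopp)
  · rw [Finset.sum_eq_sum_Ico_succ_bot hr, add_assoc]
    set δ := ∑ i ∈ Finset.Ico (r + 1) R,
        1920 * (∑ j ∈ survivors h H i, (freq q j : ℝ) ^ 2) / thr σ i ^ 2 +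
      ((present h H (R - 1) q).card : ℝ) / 2 with hδ
    have hδ0 : 0 ≤ δ := add_nonneg (Finset.sum_nonneg fun i _ => div_nonneg (mul_nonneg
      (by norm_num) (Finset.sum_nonneg fun j _ => sq_nonneg _)) (sq_nonneg _))
      (div_nonneg (Nat.cast_nonneg _) (by norm_num))
    refine (prob_bind_le fam.sign _ _ {Z | ¬ Quiet h H σ r Z l} hδ0 fun Z hZ => ?_).trans
      (add_le_add hquiet (le_refl δ))
    · obtain ⟨s', x, l', e1, e2, e3, e4, e5, e6, e7⟩ := hround Z (not_not.1 hZ)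
      rw [e1, HH1State.nextRound, PMF.bind_map]
      clear hδ0 hround hquiet hε
      -- The induction concerns states whose signs are about to be redrawn, because every round
      -- starts with fresh signs, independent of all that has been read.
      refine ih (r + 1) (by omega) hlt l' (e5.trans hl)
        { s' with b := Function.update s'.b s'.r (decide (|s'.X0| < |s'.X1|)),
                  X0 := 0, X1 := 0, r := s'.r + 1 } ?_ rfl rfl ?_ (by omega)
      · refine ⟨e2.σ_eq, e2.R_eq, e2.h_eq, by simp [e2.r_eq], fun i hi => ?_⟩
        simp only
        rw [e3, e2.r_eq]
        rw [Finset.mem_Icc] at hi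
        rcases eq_or_ne i r with rfl | hne
        · simp
        · rw [Function.update_of_ne hne]
          exact e2.b_eq i (Finset.mem_Icc.2 (by omega))
      · linarith

/-! ### Random labels -/

theorem card_agree_le (R m : ℕ) (hm : m ≤ R) (w : Fin R → Bool) :
    (Finset.univ.filter fun v : Fin R → Bool => ∀ k : Fin R, (k : ℕ) < m → v k = w k).card =
      2 ^ (R - m) := by
  have : (Finset.univ.filter fun v : Fin R → Bool => ∀ k : Fin R, (k : ℕ) < m → v k = w k) =
      Fintype.piFinset fun k : Fin R => if (k : ℕ) < m then {w k} else Finset.univ := by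
    ext v
    simp only [Finset.mem_filter, Finset.mem_univ, true_and, Fintype.mem_piFinset]
    refine forall_congr' fun k => ?_
    by_cases hk : (k : ℕ) < m <;> simp [hk]
  rw [this, Fintype.card_piFinset]
  have h2 : ∀ k : Fin R, (if (k : ℕ) < m then {w k} else (Finset.univ : Finset Bool)).card =
      if (k : ℕ) < m then 1 else 2 := by
    intro k
    split_ifs <;> simp
  simp only [h2]
  rw [Fin.prod_univ_eq_prod_range (fun k => if k < m then 1 else 2) R,
    ← Finset.prod_range_mul_prod_Ico _ hm]
  rw [Finset.prod_eq_one, Finset.prod_congr (g := fun _ => 2) rfl]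
  · simp
  · intro k hk
    rw [Finset.mem_Ico] at hk
    simp [not_lt.2 hk.1]
  · intro k hk
    simp [Finset.mem_range.1 hk]

/-- Pairwise independence makes the pair of labels of `j` and `H` uniform, so it suffices to count
the pairs with a common prefix: 2^`R` choices for `H` and 2^(`R` − `i` + 1) for `j`. -/
theorem prob_mem_survivors_le {R : ℕ} {D : PMF (Fin n → (Fin R → Bool))} (hD : KWise 2 D)
    {j H : Fin n} (hj : j ≠ H) {i : ℕ} (hi : i - 1 ≤ R) :
    prob D {v | j ∈ survivors (fun x => labelBit (v x)) H i} ≤ 1 / 2 ^ (i - 1) := by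
  have hsub : {v : Fin n → (Fin R → Bool) | j ∈ survivors (fun x => labelBit (v x)) H i} ⊆
      ⋃ p ∈ (Finset.univ : Finset (Fin R → Bool)).sigma fun w =>
        Finset.univ.filter fun u : Fin R → Bool => ∀ k : Fin R, (k : ℕ) < i - 1 → u k = w k,
      {v | ∀ a ∈ ({j, H} : Finset (Fin n)), v a = if a = H then p.1 else p.2} := by
    intro v hv
    have hv' := (mem_survivors.1 hv).2
    simp only [Set.mem_iUnion]
    refine ⟨⟨v H, v j⟩, ?_, ?_⟩
    · simp only [Finset.mem_sigma, Finset.mem_univ, Finset.mem_filter, true_and]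
      intro k hk
      have := hv' (k + 1) (Finset.mem_Icc.2 (by omega))
      simpa [labelBit] using this
    · intro a ha
      rw [Finset.mem_insert, Finset.mem_singleton] at ha
      rcases ha with rfl | rfl
      · simp [hj]
      · simp
  refine (prob_mono D hsub).trans ((prob_biUnion_le _ _ _).trans ?_)
  have hc : ({j, H} : Finset (Fin n)).card = 2 := Finset.card_pair hj
  have hp : ∀ p : (_ : Fin R → Bool) × (Fin R → Bool),
      prob D {v | ∀ a ∈ ({j, H} : Finset (Fin n)), v a = if a = H then p.1 else p.2} =
        1 / (2 ^ R * 2 ^ R) := by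
    intro p
    rw [prob, hD _ (by omega), hc]
    simp [ENNReal.toReal_pow, pow_two]
  rw [Finset.sum_congr rfl fun p _ => hp p, Finset.sum_const, Finset.card_sigma,
    Finset.sum_congr rfl fun w _ => card_agree_le R (i - 1) hi w]
  refine le_of_eq ?_
  simp only [Finset.sum_const, Finset.card_univ, Fintype.card_fun, Fintype.card_bool,
    Fintype.card_fin, nsmul_eq_mul, smul_eq_mul]
  push_cast
  rw [pow_sub₀ _ (by norm_num) hi]
  field_simp

theorem ex_sum_survivors_le {R : ℕ} {D : PMF (Fin n → (Fin R → Bool))} (hD : KWise 2 D)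
    (H : Fin n) {i : ℕ} (hi : i - 1 ≤ R) (f : Fin n → ℝ) (hf : ∀ j, 0 ≤ f j) :
    ex D (fun v => ∑ j ∈ survivors (fun x => labelBit (v x)) H i, f j) ≤
      (∑ j ∈ Finset.univ.erase H, f j) / 2 ^ (i - 1) := by
  have e : ∀ v : Fin n → (Fin R → Bool),
      ∑ j ∈ survivors (fun x => labelBit (v x)) H i, f j = ∑ j ∈ Finset.univ.erase H,
        f j * Set.indicator {v | j ∈ survivors (fun x => labelBit (v x)) H i}
          (fun _ => (1 : ℝ)) v := by
    intro v
    rw [← Finset.sum_subset (s₁ := survivors (fun x => labelBit (v x)) H i)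
      (f := fun j => f j * Set.indicator {v | j ∈ survivors (fun x => labelBit (v x)) H i}
          (fun _ => (1 : ℝ)) v)]
    · refine Finset.sum_congr rfl fun j hj => ?_
      rw [Set.indicator_of_mem (by exact hj), mul_one]
    · intro j hj
      exact Finset.mem_erase.2 ⟨(mem_survivors.1 hj).1, Finset.mem_univ j⟩
    · intro j _ hj
      rw [Set.indicator_of_notMem (by exact hj), mul_zero]
  simp only [e, ex_sum, ex_mul_left, ← prob_eq_ex]
  rw [Finset.sum_div]
  refine Finset.sum_le_sum fun j hj => ?_
  rw [div_eq_mul_one_div]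
  exact mul_le_mul_of_nonneg_left
    (prob_mem_survivors_le hD (Finset.ne_of_mem_erase hj) hi) (hf j)

end HH1
end BPTree
namespace BPTree

/-! ### Success probability of HH1 -/

section HH1

variable {n : ℕ}

theorem pow_floor_logb_le {y : ℝ} (hy : 1 ≤ y) : (2 : ℝ) ^ ⌊Real.logb 2 y⌋₊ ≤ y := by
  have h := Nat.floor_le (Real.logb_nonneg (b := 2) (by norm_num) hy)
  rwa [Real.le_logb_iff_rpow_le (by norm_num) (by linarith), Real.rpow_natCast] at h

theorem lt_pow_floor_logb {y : ℝ} (hy : 1 ≤ y) : y < (2 : ℝ) ^ (⌊Real.logb 2 y⌋₊ + 1) := by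
  have h := Nat.lt_floor_add_one (Real.logb 2 y)
  rw [Real.logb_lt_iff_lt_rpow (by norm_num) (by linarith)] at h
  exact_mod_cast h

/-- With `s = √(2 * σ)` the hypothesis gives 2^`a` ≤ `s ^ 4`, hence `a` log 2 ≤ 4(`s` − 1), far
below `s ^ 2`. Thus the one extra occurrence of `H` spent in each round is negligible against σ. -/
theorem three_mul_le_of_pow_le {σ : ℝ} (hσ : 1000000 ≤ σ) {a : ℕ}
    (ha : (2 : ℝ) ^ a ≤ σ ^ 2 + 1) : (3 * a : ℝ) ≤ σ / 10 := by
  set s := √(2 * σ) with hs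
  have hs2 : s ^ 2 = 2 * σ := Real.sq_sqrt (by linarith)
  have hs0 : 1000 ≤ s := by
    apply Real.le_sqrt_of_sq_le
    linarith
  have h1 : (2 : ℝ) ^ a ≤ s ^ 4 := by
    rw [show s ^ 4 = (s ^ 2) ^ 2 by ring, hs2]
    nlinarith
  have h2 := Real.log_le_log (by positivity) h1
  rw [Real.log_pow, Real.log_pow] at h2
  have h3 := Real.log_le_sub_one_of_pos (show 0 < s by linarith)
  have h4 := Real.log_two_gt_d9
  have ha0 : (0 : ℝ) ≤ a := Nat.cast_nonneg a
  push_cast at h2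
  nlinarith

theorem sum_thr_le {σ : ℝ} (hσ : 0 < σ) (R : ℕ) :
    ∑ i ∈ Finset.Ico 1 R, (3 / 2 * thr σ i + 1) ≤ 9 / 64 * σ + (R - 1 : ℕ) := by
  have h := geom_sum_Ico_le_of_lt_one (m := 1) (n := R) (x := (3 / 4 : ℝ)) (by norm_num)
    (by norm_num)
  rw [Finset.sum_add_distrib, ← Finset.mul_sum]
  simp only [thr, ← Finset.mul_sum, Finset.sum_const, Nat.card_Ico, nsmul_eq_mul, mul_one]
  norm_num at h
  nlinarith

/-- Each round contributes a factor (16/9) · (1/2) = 8/9, so the series converges with sum at most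
8; the constant in `hW` is chosen so that 1920 · 2048 · 8 / 4000000000 < 1/100. -/
theorem sum_noise_le {σ W : ℝ} (hσ : 0 < σ) (hW : W ≤ σ ^ 2 / 4000000000) (R : ℕ) :
    ∑ i ∈ Finset.Ico 1 R, 1920 / thr σ i ^ 2 * (W / 2 ^ (i - 1)) ≤ 1 / 100 := by
  have h := geom_sum_Ico_le_of_lt_one (m := 1) (n := R) (x := (8 / 9 : ℝ)) (by norm_num)
    (by norm_num)
  have e : ∀ i ∈ Finset.Ico 1 R, 1920 / thr σ i ^ 2 * (W / 2 ^ (i - 1)) ≤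
      1920 * 2048 / 4000000000 * (8 / 9 : ℝ) ^ i := by
    intro i hi
    obtain ⟨k, rfl⟩ : ∃ k, i = k + 1 := ⟨i - 1, by have := Finset.mem_Ico.1 hi; omega⟩
    have h2 : 1920 / thr σ (k + 1) ^ 2 * (W / 2 ^ (k + 1 - 1)) ≤
        1920 / thr σ (k + 1) ^ 2 * (σ ^ 2 / 4000000000 / 2 ^ (k + 1 - 1)) := by
      gcongr
    refine h2.trans (le_of_eq ?_)
    have h3 : (8 / 9 : ℝ) = ((3 / 4) ^ 2)⁻¹ * 2⁻¹ := by norm_num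
    rw [thr, h3, mul_pow, mul_pow, mul_pow]
    simp only [Nat.add_sub_cancel, pow_succ (2⁻¹ : ℝ), inv_pow, ← pow_mul]
    have : (3 / 4 : ℝ) ^ (2 * (k + 1)) ≠ 0 := by positivity
    rw [mul_comm (k + 1) 2]
    field_simp
    norm_num
  refine (Finset.sum_le_sum e).trans ?_
  rw [← Finset.mul_sum]
  norm_num at h
  nlinarith

/-- HH1 with a suitable guess fails to find a very heavy item with probability at most `0.26`. -/
theorem hh1_fail_le {rows : ℕ} (fam : Families n rows) (H : Fin n) (q : List (Fin n)) {σ : ℝ}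
    (hσ : 1000000 ≤ σ) (hcnt : σ / 4 ≤ freq q H)
    (hW : ∑ j ∈ Finset.univ.erase H, (freq q j : ℝ) ^ 2 ≤ σ ^ 2 / 4000000000) :
    prob ((HH1State.start fam σ).bind (HH1State.run fam q)) {s | s.H ≠ some H} ≤ 13 / 50 := by
  classical
  have hσ0 : 0 < σ := by linarith
  have hn : (1 : ℝ) ≤ n := by
    have := H.pos
    exact_mod_cast this
  set y : ℝ := min (n : ℝ) (σ ^ 2) + 1 with hy
  set a := ⌊Real.logb 2 y⌋₊ with ha
  have hy2 : 2 ≤ y := by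
    have : 1 ≤ min (n : ℝ) (σ ^ 2) := le_min hn (by nlinarith)
    linarith
  have hR : numBits n σ = 3 * a := rfl
  have hpow1 : (2 : ℝ) ^ a ≤ y := pow_floor_logb_le (by linarith)
  have hpow2 : y < (2 : ℝ) ^ (a + 1) := lt_pow_floor_logb (by linarith)
  have ha1 : 1 ≤ a := by
    rcases Nat.eq_zero_or_pos a with h0 | h0
    · rw [h0] at hpow2
      norm_num at hpow2
      linarith
    · exact h0
  set R := numBits n σ with hRdef
  -- the number of other items that occur
  set N := ∑ j ∈ Finset.univ.erase H, (if j ∈ q then (1 : ℝ) else 0) with hN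
  have hNnat : N = (((Finset.univ.erase H).filter fun j => j ∈ q).card : ℕ) := by
    simp [hN]
  -- `N` is an integer, which improves the strict bound by one. The improvement is needed for `a =
  -- 1`, where it gives `N ≤ 1`.
  have hN1 : N + 3 ≤ 2 * 2 ^ a := by
    have hN2 : N + 2 < 2 * 2 ^ a := by
      rcases le_total (n : ℝ) (σ ^ 2) with hle | hle
      · rw [hy, min_eq_left hle, pow_succ] at hpow2
        have : N ≤ (n : ℝ) - 1 := by
          rw [hNnat]
          have h1 := Finset.card_filter_le (Finset.univ.erase H) fun j => j ∈ q
          rw [Finset.card_erase_of_mem (Finset.mem_univ H), Finset.card_univ,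
            Fintype.card_fin] at h1
          have h2 := H.pos
          rw [le_sub_iff_add_le]
          exact_mod_cast (by omega : _ + 1 ≤ n)
        linarith
      · rw [hy, min_eq_right hle, pow_succ (2 : ℝ)] at hpow2
        have : N ≤ ∑ j ∈ Finset.univ.erase H, (freq q j : ℝ) ^ 2 := by
          refine Finset.sum_le_sum fun j _ => ?_
          split_ifs with hj
          · have : (1 : ℝ) ≤ freq q j := by exact_mod_cast List.count_pos_iff.2 hj
            nlinarith
          · positivity
        nlinarith
    rw [hNnat] at hN2 ⊢
    have h3 : ((Finset.univ.erase H).filter fun j => j ∈ q).card + 2 < 2 * 2 ^ a := by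
      exact_mod_cast hN2
    exact_mod_cast (by omega : ((Finset.univ.erase H).filter fun j => j ∈ q).card + 3 ≤ 2 * 2 ^ a)
  -- With z = 2^`b` the claim is N ≤ z³, while N ≤ 4z − 3. Equality at z = 1 is the extreme case:
  -- one other item, which survives the only recorded bit with probability at most 1/2 and then has
  -- the wrong sign with probability at most 1/2.
  have hNfin : N / 2 ^ (R - 2) / 2 ≤ 1 / 4 := by
    obtain ⟨b, hb⟩ : ∃ b, a = b + 1 := ⟨a - 1, by omega⟩
    have e : R - 2 = 3 * b + 1 := by omega
    rw [e, pow_succ, pow_mul, div_div, div_le_iff₀ (by positivity)]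
    rw [hb, pow_succ] at hN1
    have e8 : ((2 : ℝ) ^ 3) ^ b = (2 ^ b) ^ 3 := by rw [← pow_mul, ← pow_mul, mul_comm]
    rw [e8]
    rcases Nat.eq_zero_or_pos b with h0 | h0
    · subst h0
      norm_num at hN1 ⊢
      linarith
    · have hz : (2 : ℝ) ≤ 2 ^ b := by
        calc (2 : ℝ) = 2 ^ 1 := by norm_num
          _ ≤ 2 ^ b := pow_le_pow_right₀ (by norm_num) h0
      generalize (2 : ℝ) ^ b = z at *
      nlinarith [mul_nonneg (sub_nonneg.2 hz) (sub_nonneg.2 hz)]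
  -- enough occurrences
  have hRσ : (R : ℝ) ≤ σ / 10 := by
    rw [hR]
    push_cast
    exact three_mul_le_of_pow_le hσ (hpow1.trans (by
      rw [hy]; linarith [min_le_right (n : ℝ) (σ ^ 2)]))
  -- The thresholds need at most 9/64 of σ and the extra occurrences at most 1/10, together less
  -- than 1/4.
  have hocc : ∑ i ∈ Finset.Ico 1 R, (3 / 2 * thr σ i + 1) < freq q H := by
    have h1 := sum_thr_le hσ0 R
    have h2 : ((R - 1 : ℕ) : ℝ) ≤ R := by exact_mod_cast Nat.sub_le R 1
    linarith
  -- fixed labels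
  have hfix : ∀ v : Fin n → (Fin R → Bool), prob
      ((fam.sign.map fun Z => (
        { σ := σ, R := R, h := fun x => labelBit (v x), Z := Z,
          b := fun _ => false, X0 := 0, X1 := 0, r := 1, H := none } : HH1State n)).bind
          (HH1State.run fam q)) {s | s.H ≠ some H} ≤
      ∑ i ∈ Finset.Ico 1 R, 1920 / thr σ i ^ 2 *
        (∑ j ∈ survivors (fun x => labelBit (v x)) H i, (freq q j : ℝ) ^ 2) +
      1 / 2 * ∑ j ∈ survivors (fun x => labelBit (v x)) H (R - 1),
        (if j ∈ q then (1 : ℝ) else 0) := by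
    intro v
    rw [PMF.bind_map]
    have hgood := HH1State.prob_fail_le fam (fun x => labelBit (v x)) H hσ0 R q 1 le_rfl
      (by omega) q (List.suffix_refl q)
      { σ := σ, R := R, h := fun x => labelBit (v x), Z := fun _ => 1, b := fun _ => false,
        X0 := 0, X1 := 0, r := 1, H := none } ⟨rfl, rfl, rfl, rfl, by simp⟩ rfl rfl hocc
    refine hgood.trans (le_of_eq ?_)
    congr 1
    · exact Finset.sum_congr rfl fun i _ => by ring
    · simp [present]
      ring
  rw [HH1State.start, PMF.bind_bind, prob_bind]
  refine (ex_mono _ hfix).trans ?_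
  rw [ex_add, ex_sum, ex_mul_left]
  have hk := fam.hash_kWise R
  have hA : ∑ i ∈ Finset.Ico 1 R, ex (fam.hash R) (fun v => 1920 / thr σ i ^ 2 *
      (∑ j ∈ survivors (fun x => labelBit (v x)) H i, (freq q j : ℝ) ^ 2)) ≤ 1 / 100 := by
    refine le_trans (Finset.sum_le_sum fun i hi => ?_) (sum_noise_le hσ0 hW R)
    rw [Finset.mem_Ico] at hi
    rw [ex_mul_left]
    exact mul_le_mul_of_nonneg_left (ex_sum_survivors_le hk H (by omega) _
      fun j => sq_nonneg _) (div_nonneg (by norm_num) (sq_nonneg _))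
  have hB := ex_sum_survivors_le hk H (i := R - 1) (by omega) (fun j => if j ∈ q then (1 : ℝ) else 0)
    (fun j => by split_ifs <;> norm_num)
  rw [show R - 1 - 1 = R - 2 by omega] at hB
  linarith

/-- HH1 finds `H` if no other item occurs. -/
theorem hh1_only {rows : ℕ} (fam : Families n rows) (H : Fin n) (x : Fin n) (q : List (Fin n))
    {σ : ℝ} (hσ : 1 ≤ σ) (hq : ∀ x' ∈ x :: q, x' = H) :
    ∀ s ∈ ((HH1State.start fam σ).bind (HH1State.run fam (x :: q))).support, s.H = some H := by
  have hstep : ∀ s : HH1State n, s.H = some H → ∀ s' ∈ (s.step fam H).support, s'.H = some H := by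
    intro s hs s' hs'
    rw [HH1State.step] at hs'
    split_ifs at hs' with h1 h2
    · rw [HH1State.nextRound, PMF.mem_support_map_iff] at hs'
      obtain ⟨Z, _, rfl⟩ := hs'
      rfl
    · rw [PMF.mem_support_pure_iff] at hs'
      rw [hs']
      rfl
    · rw [PMF.mem_support_pure_iff] at hs'
      rw [hs', hs]
  have hrun : ∀ l : List (Fin n), (∀ x' ∈ l, x' = H) → ∀ s : HH1State n, s.H = some H →
      ∀ s' ∈ (s.run fam l).support, s'.H = some H := by
    intro l
    induction l with
    | nil =>
      intro _ s hs s' hs'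
      rw [HH1State.run, PMF.mem_support_pure_iff] at hs'
      rw [hs', hs]
    | cons y l ih =>
      intro hl s hs s' hs'
      rw [HH1State.run, PMF.mem_support_bind_iff] at hs'
      obtain ⟨s1, h1, h2⟩ := hs'
      rw [hl y (by simp)] at h1
      exact ih (fun x' hx' => hl x' (by simp [hx'])) s1 (hstep s hs s1 h1) s' h2
  intro s hs
  rw [PMF.mem_support_bind_iff] at hs
  obtain ⟨s0, h0, hs⟩ := hs
  rw [HH1State.run, PMF.mem_support_bind_iff] at hs
  obtain ⟨s1, h1, hs⟩ := hs
  refine hrun q (fun x' hx' => hq x' (by simp [hx'])) s1 ?_ s hs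
  rw [HH1State.start, PMF.mem_support_bind_iff] at h0
  obtain ⟨v, _, h0⟩ := h0
  rw [PMF.mem_support_map_iff] at h0
  obtain ⟨Z, _, rfl⟩ := h0
  have hn : (1 : ℝ) ≤ n := by
    have := H.pos
    exact_mod_cast this
  -- At least three label bits exist, so the very first item is counted and becomes the candidate.
  have hR : 1 < numBits n σ := by
    have h2 : (2 : ℝ) ≤ min (n : ℝ) (σ ^ 2) + 1 := by
      have : 1 ≤ min (n : ℝ) (σ ^ 2) := le_min hn (by nlinarith)
      linarith
    have h3 := lt_pow_floor_logb (y := min (n : ℝ) (σ ^ 2) + 1) (by linarith)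
    unfold numBits
    rcases Nat.eq_zero_or_pos ⌊Real.logb 2 (min (n : ℝ) (σ ^ 2) + 1)⌋₊ with h4 | h4
    · rw [h4] at h3
      norm_num at h3
      linarith
    · omega
  have hx : x = H := hq x (by simp)
  rw [HH1State.step, if_pos ⟨hR, by simp [HH1State.Active]⟩] at h1
  split_ifs at h1
  · rw [HH1State.nextRound, PMF.mem_support_map_iff] at h1
    obtain ⟨Z', _, rfl⟩ := h1
    simp [HH1State.count, hx]
  · rw [PMF.mem_support_pure_iff] at h1
    rw [h1]
    simp [HH1State.count, hx]

end HH1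
end BPTree
namespace BPTree

/-! ### The copies of HH1 started by HH2 -/

section HH2

variable {n rows : ℕ}

/-- HH2 reads a list of items. -/
noncomputable def HH2State.runFrom (fam : Families n rows) :
    List (Fin n) → HH2State n rows → PMF (HH2State n rows)
  | [], s => PMF.pure s
  | x :: l, s => (s.step fam x).bind (HH2State.runFrom fam l)

theorem HH2State.run_eq (fam : Families n rows) (p : List (Fin n)) :
    HH2State.run fam p = (HH2State.start fam).bind (HH2State.runFrom fam p) := by
  have key : ∀ (p : List (Fin n)) (D : PMF (HH2State n rows)),
      p.foldl (fun D x => D.bind fun s => s.step fam x) D = D.bind (HH2State.runFrom fam p) := by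
    intro p
    induction p with
    | nil =>
      intro D
      exact (PMF.bind_pure D).symm
    | cons x l ih =>
      intro D
      rw [List.foldl_cons, ih, PMF.bind_bind]
      rfl
  exact key p _

/-- The number of new powers of `2` reached by the value `e`. -/
noncomputable def numCrossings (next : ℕ) (e : ℝ) : ℕ :=
  Set.ncard {k : ℕ | next ≤ k ∧ (2 : ℝ) ^ k ≤ e}

theorem numCrossings_spec (next : ℕ) (e : ℝ) :
    e < 2 ^ (next + numCrossings next e) ∧
      ∀ i < numCrossings next e, (2 : ℝ) ^ (next + i) ≤ e := by
  classical
  have hex : ∃ m : ℕ, e < 2 ^ (next + m) := by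
    obtain ⟨m, hm⟩ := pow_unbounded_of_one_lt e (show (1 : ℝ) < 2 by norm_num)
    exact ⟨m, hm.trans_le (pow_le_pow_right₀ (by norm_num) (by omega))⟩
  have hmin : ∀ i < Nat.find hex, (2 : ℝ) ^ (next + i) ≤ e :=
    fun i hi => not_lt.1 (Nat.find_min hex hi)
  have hset : {k : ℕ | next ≤ k ∧ (2 : ℝ) ^ k ≤ e} =
      (Finset.Ico next (next + Nat.find hex) : Set ℕ) := by
    ext k
    simp only [Set.mem_ofPred_eq, Finset.coe_Ico, Set.mem_Ico]
    refine and_congr_right fun hk => ⟨fun h => ?_, fun h => ?_⟩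
    · by_contra hc
      exact absurd (h.trans_lt (Nat.find_spec hex)) (not_lt.2
        (pow_le_pow_right₀ (by norm_num) (not_lt.1 hc)))
    · have := hmin (k - next) (by omega)
      rwa [Nat.add_sub_cancel' hk] at this
  have hc : numCrossings next e = Nat.find hex := by
    rw [numCrossings, hset, Set.ncard_coe_finset]
    simp
  rw [hc]
  exact ⟨Nat.find_spec hex, hmin⟩

/-- The guesses of the copies of HH1 started while `q` is read, together with the lists of items
that these copies are given. -/
noncomputable def starts (S : Fin rows × Fin n → ℤˣ) :
    (Fin rows → ℤ) → ℕ → List (Fin n) → List (ℝ × List (Fin n))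
  | _, _, [] => []
  | Y, next, x :: l =>
    let Y' : Fin rows → ℤ := fun i => Y i + ((S (i, x) : ℤˣ) : ℤ)
    List.replicate (numCrossings next (estimate Y')) (√(estimate Y'), x :: l) ++
      starts S Y' (next + numCrossings next (estimate Y')) l

/-- The law of the last but one copy, given the laws of the two present and of all later ones. -/
noncomputable def lastButOne {A : Type} : PMF A → PMF A → List (PMF A) → PMF A
  | P, _, [] => P
  | _, C, D :: L => lastButOne C D L

theorem lastButOne_append {A : Type} (L : List (PMF A)) (P C D D' : PMF A) :
    lastButOne P C (L ++ [D, D']) = D := by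
  induction L generalizing P C with
  | nil => rfl
  | cons E L ih => exact ih C E

/-- At most one of the two copies is ever kept, so their independent randomness can be integrated
out separately. -/
theorem bind_bind_lastButOne {A B B' : Type} (P : PMF B) (C : PMF B') (f : B → PMF A)
    (g : B' → PMF A) (L : List (PMF A)) :
    (P.bind fun a => C.bind fun c => lastButOne (f a) (g c) L) =
      lastButOne (P.bind f) (C.bind g) L := by
  rcases L with _ | ⟨D, _ | ⟨D', L⟩⟩ <;> simp [lastButOne]

theorem bind_lastButOne {A B : Type} (P : PMF A) (C : PMF B) (g : B → PMF A) (L : List (PMF A)) :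
    (C.bind fun c => lastButOne P (g c) L) = lastButOne P (C.bind g) L := by
  rcases L with _ | ⟨D, _ | ⟨D', L⟩⟩ <;> simp [lastButOne]

theorem mem_support_lastButOne {A : Type} {P C : PMF A} {L : List (PMF A)} {a : A}
    (h : a ∈ (lastButOne P C L).support) :
    a ∈ P.support ∨ a ∈ C.support ∨ ∃ D ∈ L, a ∈ D.support := by
  induction L generalizing P C with
  | nil => exact Or.inl h
  | cons D L ih =>
    rcases ih h with h | h | ⟨E, hE, h⟩
    · exact Or.inr (Or.inl h)
    · exact Or.inr (Or.inr ⟨D, by simp, h⟩)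
    · exact Or.inr (Or.inr ⟨E, by simp [hE], h⟩)

/-- The law of the final state of a copy of HH1 with guess `e.1` that reads `e.2`. -/
noncomputable def copyLaw (fam : Families n rows) (e : ℝ × List (Fin n)) : PMF (HH1State n) :=
  (HH1State.start fam e.1).bind (HH1State.run fam e.2)

/-- Every restart puts the law of one fresh copy in front of the list of later starts; the sketch
does not change in between, so all guesses are equal. The continuation `f` stands for reading the
remaining items. -/
theorem HH2State.restart_bind (fam : Families n rows) (f : HH1State n → PMF (HH1State n))
    (E : (Fin rows × Fin n → ℤˣ) → (Fin rows → ℤ) → ℕ → List (PMF (HH1State n))) (j : ℕ)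
    (s : HH2State n rows) :
    ((HH2State.restart fam j s).bind fun s' =>
      lastButOne (f s'.prev) (f s'.cur) (E s'.S s'.Y s'.next)) =
    lastButOne (f s.prev) (f s.cur)
      (List.replicate j ((HH1State.start fam √(estimate s.Y)).bind f) ++
        E s.S s.Y (s.next + j)) := by
  induction j generalizing s with
  | zero => simp [HH2State.restart]
  | succ j ih =>
    rw [HH2State.restart, PMF.bind_bind]
    simp only [ih]
    rw [bind_lastButOne, List.replicate_succ, List.cons_append, lastButOne]
    congr 3
    omega

/-- Once the signs of the sketch are known, the copies neither influence each other nor the restart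
times. Hence the surviving older copy has the law of HH1 run alone on its suffix of the stream. -/
theorem HH2State.runFrom_map_prev (fam : Families n rows) (q : List (Fin n))
    (s : HH2State n rows) :
    (HH2State.runFrom fam q s).map (fun s => s.prev) =
      lastButOne (HH1State.run fam q s.prev) (HH1State.run fam q s.cur)
        ((starts s.S s.Y s.next q).map (copyLaw fam)) := by
  induction q generalizing s with
  | nil => simp [HH2State.runFrom, starts, lastButOne, HH1State.run, PMF.pure_map]
  | cons x l ih =>
    rw [HH2State.runFrom, HH2State.step, PMF.bind_bind, PMF.map_bind]
    have h1 : ∀ s' : HH2State n rows,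
        (((s'.prev.step fam x).bind fun a => (s'.cur.step fam x).map fun c =>
          ({ s' with prev := a, cur := c } : HH2State n rows)).bind
            (HH2State.runFrom fam l)).map (fun s => s.prev) =
        lastButOne (HH1State.run fam (x :: l) s'.prev) (HH1State.run fam (x :: l) s'.cur)
          ((starts s'.S s'.Y s'.next l).map (copyLaw fam)) := by
      intro s'
      rw [PMF.bind_bind, PMF.map_bind, HH1State.run, HH1State.run, ← bind_bind_lastButOne]
      congr 1
      funext a
      rw [PMF.bind_map, PMF.map_bind]
      congr 1
      funext c
      exact ih _
    have h2 := fun s' : HH2State n rows => h1 s'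
    simp only [h2]
    rw [HH2State.restart_bind fam (HH1State.run fam (x :: l))
      (fun S Y k => (starts S Y k l).map (copyLaw fam))]
    simp only [starts, List.map_append, List.map_replicate]
    rfl

/-! ### Times and guesses of the restarts -/

/-- The estimate after `t` items of `q`, if the sketch was `Y` before. -/
noncomputable def estAt (S : Fin rows × Fin n → ℤˣ) (Y : Fin rows → ℤ) (q : List (Fin n))
    (t : ℕ) : ℝ := estimate fun i => Y i + sketchOf S (q.take t) i

theorem estAt_cons_succ (S : Fin rows × Fin n → ℤˣ) (Y : Fin rows → ℤ) (x : Fin n)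
    (l : List (Fin n)) (t : ℕ) : estAt S Y (x :: l) (t + 1) =
      estAt S (fun i => Y i + ((S (i, x) : ℤˣ) : ℤ)) l t := by
  simp [estAt, sketchOf, add_assoc]

theorem estAt_zero (S : Fin rows × Fin n → ℤˣ) (Y : Fin rows → ℤ) (q : List (Fin n)) :
    estAt S Y q 0 = estimate Y := by
  simp [estAt, sketchOf]

/-- Items are numbered from 0, and the item that causes a restart is already read by the new copy:
it receives `q.drop t`, while its guess comes from the estimate after `t + 1` items. The
inequalities locate the first passage of the corresponding power of two, even if one item passes
several. -/
theorem starts_spec (S : Fin rows × Fin n → ℤˣ) (q : List (Fin n)) (Y : Fin rows → ℤ) (next : ℕ)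
    (h0 : estimate Y < 2 ^ next) :
    estAt S Y q q.length < 2 ^ (next + (starts S Y next q).length) ∧
    ∀ (i : ℕ) (hi : i < (starts S Y next q).length), ∃ t < q.length,
      (starts S Y next q)[i] = (√(estAt S Y q (t + 1)), q.drop t) ∧
      estAt S Y q t < 2 ^ (next + i) ∧ 2 ^ (next + i) ≤ estAt S Y q (t + 1) := by
  induction q generalizing Y next with
  | nil => simpa [starts, estAt_zero] using h0
  | cons x l ih =>
    set Y' : Fin rows → ℤ := fun i => Y i + ((S (i, x) : ℤˣ) : ℤ) with hY'
    obtain ⟨c1, c2⟩ := numCrossings_spec next (estimate Y')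
    set c := numCrossings next (estimate Y') with hc
    have hst : starts S Y next (x :: l) =
      List.replicate c (√(estimate Y'), x :: l) ++ starts S Y' (next + c) l := rfl
    obtain ⟨i1, i2⟩ := ih Y' (next + c) c1
    constructor
    · rw [hst, List.length_append, List.length_replicate, List.length_cons, estAt_cons_succ,
        ← add_assoc]
      exact i1
    · intro i hi
      by_cases hic : i < c
      · refine ⟨0, by simp, ?_, ?_, ?_⟩
        · simp only [hst]
          rw [List.getElem_append_left (by simpa using hic)]
          simp [estAt_cons_succ, estAt_zero, hY']
        · rw [estAt_zero]
          exact h0.trans_le (pow_le_pow_right₀ (by norm_num) (by omega))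
        · rw [estAt_cons_succ, estAt_zero]
          exact c2 i hic
      · rw [hst, List.length_append, List.length_replicate] at hi
        obtain ⟨t, ht, e1, e2, e3⟩ := i2 (i - c) (by omega)
        have hi' : next + c + (i - c) = next + i := by omega
        rw [hi'] at e2 e3
        refine ⟨t + 1, by simpa using ht, ?_, ?_, ?_⟩
        · simp only [hst]
          rw [List.getElem_append_right (by simpa using not_lt.1 hic)]
          simp only [List.length_replicate]
          rw [e1, estAt_cons_succ, List.drop_succ_cons]
        · rw [estAt_cons_succ]
          exact e2
        · rw [estAt_cons_succ]
          exact e3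

theorem estimate_nonneg (Y : Fin rows → ℤ) : 0 ≤ estimate Y := by
  unfold estimate
  positivity

/-! ### Correctness of HH2 -/

theorem freq_take_add_drop (p : List (Fin n)) (t : ℕ) (j : Fin n) :
    freq (p.take t) j + freq (p.drop t) j = freq p j := by
  rw [← freq_append, List.take_append_drop]

theorem F2_eq_add (p : List (Fin n)) (H : Fin n) :
    F2 p = (freq p H : ℝ) ^ 2 + ∑ j ∈ Finset.univ.erase H, (freq p j : ℝ) ^ 2 := by
  exact (Finset.add_sum_erase _ _ (Finset.mem_univ H)).symm

/-- For an accurate tracker, the last but one copy fails with small probability. -/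
theorem copy_fail_le (fam : Families n rows) (p : List (Fin n)) (H : Fin n)
    (hH : IsHeavyHitter 10000000 p H) (S : Fin rows × Fin n → ℤˣ)
    (hW : 1 ≤ ∑ j ∈ Finset.univ.erase H, (freq p j : ℝ) ^ 2)
    (hS : ∀ t ≤ p.length, |estimate (sketchOf S (p.take t)) - F2 (p.take t)| ≤ 1 / 100 * F2 p)
    (P C : PMF (HH1State n)) :
    prob (lastButOne P C ((starts S 0 0 p).map (copyLaw fam))) {s | s.H ≠ some H} ≤ 13 / 50 := by
  set W := ∑ j ∈ Finset.univ.erase H, (freq p j : ℝ) ^ 2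
  have hfH : 10000000 ^ 2 * W ≤ (freq p H : ℝ) ^ 2 := hH
  have hF : F2 p = (freq p H : ℝ) ^ 2 + W := F2_eq_add p H
  set F := F2 p
  have hest : ∀ t, estAt S 0 p t = estimate (sketchOf S (p.take t)) := by
    intro t
    simp [estAt]
  obtain ⟨h1, h2⟩ := starts_spec S p 0 0 (by simp [estimate])
  simp only [hest, Nat.zero_add] at h1 h2
  set E := starts S 0 0 p
  have hfin := hS p.length le_rfl
  rw [List.take_length] at hfin
  rw [List.take_length] at h1
  rw [abs_le] at hfin
  -- The final second moment is at least 10¹⁴, so the estimate has passed at least the two powers 1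
  -- and 2.
  have hlen : 2 ≤ E.length := by
    by_contra hc
    have : (2 : ℝ) ^ E.length ≤ 2 ^ 1 := pow_le_pow_right₀ (by norm_num) (by omega)
    linarith
  obtain ⟨k, hk⟩ : ∃ k, E.length = k + 2 := ⟨E.length - 2, by omega⟩
  obtain ⟨t, ht, e1, e2, e3⟩ := h2 k (by omega)
  obtain ⟨t', ht', -, -, e6⟩ := h2 (k + 1) (by omega)
  have hsplit : E = E.take k ++ [E[k], E[k + 1]] := by
    conv_lhs => rw [← List.take_append_drop k E]
    rw [List.drop_eq_getElem_cons (by omega), List.drop_eq_getElem_cons (by omega),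
      List.drop_of_length_le (by omega)]
  rw [hsplit, List.map_append, List.map_cons, List.map_cons, List.map_nil, lastButOne_append, e1,
    copyLaw]
  have a1 := abs_le.1 (hS t ht.le)
  have a2 := abs_le.1 (hS (t + 1) ht)
  have a3 := abs_le.1 (hS (t' + 1) ht')
  have m1 : F2 (p.take (t + 1)) ≤ F := F2_mono (List.take_sublist _ _)
  have m2 : F2 (p.take (t' + 1)) ≤ F := F2_mono (List.take_sublist _ _)
  change _ ≤ F at m1
  rw [hk] at h1
  rw [pow_succ] at e6
  rw [pow_succ, pow_succ] at h1
  set w := (2 : ℝ) ^ k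
  set e := estimate (sketchOf S (p.take (t + 1)))
  have he0 : 0 ≤ e := estimate_nonneg _
  have b1 : e ≤ 1.01 * F := by linarith
  have b2 : 0.2475 * F ≤ e := by linarith
  have b3 : F2 (p.take t) ≤ 0.515 * F := by linarith
  have hσ : √e ^ 2 = e := Real.sq_sqrt he0
  have hσ0 := Real.sqrt_nonneg e
  set σ := √e
  have hu : √F ^ 2 = F := Real.sq_sqrt (by linarith)
  have hu0 := Real.sqrt_nonneg F
  set u := √F
  have c1 : σ ≤ 1.005 * u := by
    refine le_of_sq_le_sq ?_ (by positivity)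
    nlinarith
  have c2 : 0.999 * u ≤ freq p H := by
    refine le_of_sq_le_sq ?_ (by positivity)
    nlinarith
  have c3 : (freq (p.take t) H : ℝ) ≤ 0.718 * u := by
    refine le_of_sq_le_sq ?_ (by positivity)
    have := F2_eq_add (p.take t) H
    have : 0 ≤ ∑ j ∈ Finset.univ.erase H, (freq (p.take t) j : ℝ) ^ 2 :=
      Finset.sum_nonneg fun _ _ => sq_nonneg _
    nlinarith
  have c4 : (freq (p.take t) H : ℝ) + freq (p.drop t) H = freq p H := by
    exact_mod_cast freq_take_add_drop p t H
  -- At least (0.999 − 0.718) `u` occurrences of `H` remain, more than a quarter of the guess, which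
  -- is at most 1.005 `u`. The guess exceeds 10⁶ because its square is at least 0.2475 · 10¹⁴.
  refine hh1_fail_le fam H (p.drop t) ?_ ?_ ?_
  · refine le_of_sq_le_sq ?_ hσ0
    nlinarith
  · linarith
  · have : ∑ j ∈ Finset.univ.erase H, (freq (p.drop t) j : ℝ) ^ 2 ≤ W := by
      refine Finset.sum_le_sum fun j _ => ?_
      gcongr
      exact freq_mono (List.drop_sublist t p) j
    rw [hσ]
    linarith

/-- The initial copy is put into both slots. The sharing is harmless, because `lastButOne` returns
only one of them, or neither. -/
theorem HH2_map (fam : Families n rows) (p : List (Fin n)) :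
    HH2 fam p = fam.sketch.bind fun S => ((HH1State.start fam 1).bind fun c =>
      lastButOne (HH1State.run fam p c) (HH1State.run fam p c)
        ((starts S 0 0 p).map (copyLaw fam))).map fun s => s.H := by
  have h : (fun s : HH2State n rows => s.prev.H) = (fun s : HH1State n => s.H) ∘ fun s => s.prev :=
    rfl
  rw [HH2, HH2State.run_eq, h, ← PMF.map_comp, HH2State.start, PMF.bind_bind, PMF.map_bind,
    PMF.map_bind]
  congr 1
  funext S
  rw [PMF.bind_map, PMF.map_bind]
  congr 2
  funext c
  exact HH2State.runFrom_map_prev fam p _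

theorem prob_eq_zero_of_support {A : Type} (D : PMF A) (S : Set A) (h : ∀ a ∈ D.support, a ∉ S) :
    prob D S = 0 := by
  rw [prob, (D.toOuterMeasure_apply_eq_zero_iff S).2]
  · rfl
  · exact Set.disjoint_left.2 h

theorem HH2_correct (fam : Families n rows) (p : List (Fin n)) (H : Fin n)
    (hp : H ∈ p) (hH : IsHeavyHitter 10000000 p H)
    (htr : 19 / 20 ≤ prob fam.sketch {S | ∀ t ≤ p.length,
      |estimate (sketchOf S (p.take t)) - F2 (p.take t)| ≤ 1 / 100 * F2 p}) :
    0.6 ≤ (HH2 fam p (some H)).toReal := by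
  have hone : (HH2 fam p (some H)).toReal = 1 - prob (HH2 fam p) {o | o ≠ some H} := by
    rw [← PMF.toOuterMeasure_apply_singleton]
    change prob (HH2 fam p) {some H} = _
    rw [← compl_compl {some H}, prob_compl]
    rfl
  rw [hone]
  suffices h : prob (HH2 fam p) {o | o ≠ some H} ≤ 31 / 100 by
    norm_num
    linarith
  rw [HH2_map]
  have hpre : ∀ D : PMF (HH1State n), prob (D.map fun s => s.H) {o | o ≠ some H} =
      prob D {s | s.H ≠ some H} := fun D => prob_map _ _ _
  -- A single-item stream is treated separately: its estimate may be too small for the guess of HH1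
  -- to be large, but then HH1 succeeds with certainty.
  by_cases hW : 1 ≤ ∑ j ∈ Finset.univ.erase H, (freq p j : ℝ) ^ 2
  · refine (prob_bind_le fam.sketch _ _ {S | ∀ t ≤ p.length,
      |estimate (sketchOf S (p.take t)) - F2 (p.take t)| ≤ 1 / 100 * F2 p}ᶜ
      (δ := 13 / 50) (by norm_num) fun S hS => ?_).trans ?_
    · rw [hpre]
      have key : ∀ P C, prob (lastButOne P C ((starts S 0 0 p).map (copyLaw fam)))
          {s | s.H ≠ some H} ≤ 13 / 50 := fun P C =>
        copy_fail_le fam p H hH S hW (not_not.1 hS) P C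
      rw [HH1State.start, PMF.bind_bind, prob_bind, ← ex_const (fam.hash (numBits n 1)) (13 / 50)]
      refine ex_mono _ fun v => ?_
      rw [PMF.bind_map, prob_bind, ← ex_const fam.sign (13 / 50)]
      exact ex_mono _ fun Z => key _ _
    · rw [prob_compl]
      linarith
  · -- no other item occurs
    have hall : ∀ x ∈ p, x = H := by
      intro x hx
      by_contra hne
      refine hW ?_
      have h1 : (1 : ℝ) ≤ freq p x := by exact_mod_cast List.count_pos_iff.2 hx
      calc (1 : ℝ) ≤ (freq p x : ℝ) ^ 2 := by nlinarith
        _ ≤ _ := Finset.single_le_sum (f := fun j => (freq p j : ℝ) ^ 2)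
          (fun _ _ => sq_nonneg _) (Finset.mem_erase.2 ⟨hne, Finset.mem_univ x⟩)
    refine le_trans (le_of_eq ?_) (show (0 : ℝ) ≤ 31 / 100 by norm_num)
    refine prob_eq_zero_of_support _ _ fun o ho hne => hne ?_
    rw [PMF.mem_support_bind_iff] at ho
    obtain ⟨S, _, ho⟩ := ho
    rw [PMF.mem_support_map_iff] at ho
    obtain ⟨s, hs, rfl⟩ := ho
    rw [PMF.mem_support_bind_iff] at hs
    obtain ⟨c, hc, hs⟩ := hs
    have hcopy : ∀ (σ : ℝ) (q : List (Fin n)), 1 ≤ σ → q ≠ [] → q <:+ p →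
        ∀ s ∈ (copyLaw fam (σ, q)).support, s.H = some H := by
      intro σ q hσ hq hqp
      obtain ⟨x, l, rfl⟩ := List.exists_cons_of_ne_nil hq
      exact hh1_only fam H x l hσ fun x' hx' => hall x' (hqp.subset hx')
    have hfirst : ∀ s ∈ (HH1State.run fam p c).support, s.H = some H := fun s hs =>
      hcopy 1 p le_rfl (List.ne_nil_of_mem hp) (List.suffix_refl p) s
        ((PMF.mem_support_bind_iff _ _ _).2 ⟨c, hc, hs⟩)
    rcases mem_support_lastButOne hs with h | h | ⟨D, hD, h⟩
    · exact hfirst s h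
    · exact hfirst s h
    · obtain ⟨e, he, rfl⟩ := List.mem_map.1 hD
      obtain ⟨i, hi, rfl⟩ := List.getElem_of_mem he
      obtain ⟨t, ht, e1, -, e3⟩ := (starts_spec S p 0 0 (by simp [estimate])).2 i hi
      rw [e1] at h
      refine hcopy _ _ ?_ (by simpa using ht) (List.drop_suffix t p) s h
      exact Real.one_le_sqrt.2 ((one_le_pow₀ (by norm_num)).trans e3)

end HH2
end BPTree
namespace BPTree

/-! ### Explicit families: the leading bits of polynomials modulo a power of two -/

/-- The value at `a` of the polynomial with coefficients `c`, modulo `2 ^ k`. -/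
def polyVal (k : ℕ) {d : ℕ} (c : Fin d → Fin (2 ^ k)) (a : ℕ) : ℕ :=
  (∑ i, (c i : ℕ) * a ^ (i : ℕ)) % 2 ^ k

/-- The `R` leading bits of a number with `k` bits. -/
def topBits (k R : ℕ) (v : ℕ) : Fin R → Bool := fun i => v.testBit (k - 1 - i)

/-- Lagrange interpolation without division. The product of the other linear factors has the value
`D` at `a`, and `|D|` is at most 2^`e`; hence the greatest common divisor of `D` and the modulus is
a power of two dividing 2^`e`, and Bézout's identity provides a multiplier that turns `D` into
2^`e`. -/
theorem exists_coeff_single (T : Finset ℕ) (d w k e : ℕ) (hd : T.card ≤ d) (hw : ∀ a ∈ T, a < 2 ^ w)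
    (hk : (d - 1) * w ≤ e) (a : ℕ) (ha : a ∈ T) :
    ∃ c : Fin d → ℤ, ∀ b ∈ T, ∑ i, c i * (b : ℤ) ^ (i : ℕ) ≡
      (if b = a then 2 ^ e else 0) [ZMOD 2 ^ k] := by
  set P : Polynomial ℤ := ∏ b ∈ T.erase a, (Polynomial.X - Polynomial.C (b : ℤ)) with hP
  set D : ℤ := ∏ b ∈ T.erase a, ((a : ℤ) - b) with hD
  have hcard : (T.erase a).card ≤ d - 1 := by
    rw [Finset.card_erase_of_mem ha]
    omega
  have hDa : P.eval (a : ℤ) = D := by simp [hP, Polynomial.eval_prod, hD]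
  have hDb : ∀ b ∈ T, b ≠ a → P.eval (b : ℤ) = 0 := by
    intro b hb hne
    rw [hP, Polynomial.eval_prod]
    exact Finset.prod_eq_zero (Finset.mem_erase.2 ⟨hne, hb⟩) (by simp)
  have hD0 : D ≠ 0 := by
    refine Finset.prod_ne_zero_iff.2 fun b hb => ?_
    have := Finset.ne_of_mem_erase hb
    omega
  have hDle : D.natAbs ≤ 2 ^ e := by
    have h1 : D.natAbs ≤ (2 ^ w) ^ (T.erase a).card := by
      rw [hD, ← Finset.prod_const]
      rw [show (∏ b ∈ T.erase a, ((a : ℤ) - b)).natAbs = ∏ b ∈ T.erase a, ((a : ℤ) - b).natAbs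
        from map_prod Int.natAbsHom _ _]
      refine Finset.prod_le_prod' fun b hb => ?_
      have h1 := hw a ha
      have h2 := hw b (Finset.mem_of_mem_erase hb)
      omega
    refine h1.trans ?_
    rw [← pow_mul]
    refine Nat.pow_le_pow_right (by norm_num) (le_trans ?_ hk)
    rw [mul_comm]
    exact Nat.mul_le_mul_right w hcard
  have hg : Int.gcd D (2 ^ k) ∣ 2 ^ e := by
    have h1 : Int.gcd D (2 ^ k) ∣ 2 ^ k := by
      have := Int.gcd_dvd_natAbs_right D (2 ^ k)
      rwa [Int.natAbs_pow] at this
    obtain ⟨i, _, hi⟩ := (Nat.dvd_prime_pow Nat.prime_two).1 h1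
    have h2 : 2 ^ i ≤ 2 ^ e := by
      rw [← hi]
      exact (Nat.le_of_dvd (Int.natAbs_pos.2 hD0) (Int.gcd_dvd_natAbs_left D _)).trans hDle
    rw [hi]
    exact pow_dvd_pow 2 ((Nat.pow_le_pow_iff_right (by norm_num)).1 h2)
  obtain ⟨y, hy⟩ := hg
  set m : ℤ := Int.gcdA D (2 ^ k) * y with hm
  have hbez : D * m ≡ 2 ^ e [ZMOD 2 ^ k] := by
    have h1 := Int.gcd_eq_gcd_ab D (2 ^ k)
    have h2 : (2 : ℤ) ^ e = (Int.gcd D (2 ^ k) : ℤ) * y := by exact_mod_cast hy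
    rw [Int.modEq_iff_dvd]
    refine ⟨Int.gcdB D (2 ^ k) * y, ?_⟩
    rw [h2, h1, hm]
    ring
  refine ⟨fun i => m * P.coeff i, fun b hb => ?_⟩
  have hdeg : P.natDegree < d := by
    rw [hP, Polynomial.natDegree_prod_of_monic _ _ fun b _ => Polynomial.monic_X_sub_C _]
    simp only [Polynomial.natDegree_X_sub_C, Finset.sum_const, smul_eq_mul, mul_one]
    have := Finset.card_pos.2 ⟨a, ha⟩
    omega
  have hev : ∑ i : Fin d, m * P.coeff i * (b : ℤ) ^ (i : ℕ) = m * P.eval (b : ℤ) := by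
    rw [Polynomial.eval_eq_sum_range' hdeg, Finset.mul_sum,
      ← Fin.sum_univ_eq_sum_range (fun i => m * (P.coeff i * (b : ℤ) ^ i))]
    exact Finset.sum_congr rfl fun i _ => by ring
  simp only at hev ⊢
  rw [hev]
  split_ifs with h
  · rw [h, hDa, mul_comm]
    exact hbez
  · rw [hDb b hb h, mul_zero]

/-- Superposition of the interpolating polynomials: values on `T` can be prescribed freely among the
multiples of 2^`e`, that is, in the leading bits. -/
theorem exists_coeff (T : Finset ℕ) (d w k e : ℕ) (hd : T.card ≤ d) (hw : ∀ a ∈ T, a < 2 ^ w)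
    (hk : (d - 1) * w ≤ e) (t : ℕ → ℕ) :
    ∃ c : Fin d → Fin (2 ^ k), ∀ b ∈ T, polyVal k c b = (2 ^ e * t b) % 2 ^ k := by
  have h := fun a : T => exists_coeff_single T d w k e hd hw hk a.1 a.2
  choose f hf using h
  let g : Fin d → ℤ := fun i => ∑ a : T, t a * f a i
  have hpos : (0 : ℤ) < 2 ^ k := by positivity
  have hlt : ∀ i, (g i % 2 ^ k).toNat < 2 ^ k := by
    intro i
    have h1 := Int.emod_lt_of_pos (g i) hpos
    have h2 := Int.emod_nonneg (g i) hpos.ne'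
    zify
    rw [Int.toNat_of_nonneg h2]
    exact h1
  refine ⟨fun i => ⟨(g i % 2 ^ k).toNat, hlt i⟩, fun b hb => ?_⟩
  have hcast : ∀ i, (((g i % 2 ^ k).toNat : ℕ) : ℤ) ≡ g i [ZMOD 2 ^ k] := by
    intro i
    rw [Int.toNat_of_nonneg (Int.emod_nonneg (g i) hpos.ne')]
    exact Int.mod_modEq _ _
  have key : ((∑ i : Fin d, (g i % 2 ^ k).toNat * b ^ (i : ℕ) : ℕ) : ℤ) ≡
      ((2 ^ e * t b : ℕ) : ℤ) [ZMOD (2 ^ k : ℕ)] := by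
    push_cast
    have h1 : ∑ i : Fin d, (((g i % 2 ^ k).toNat : ℕ) : ℤ) * (b : ℤ) ^ (i : ℕ) ≡
        ∑ i : Fin d, g i * (b : ℤ) ^ (i : ℕ) [ZMOD 2 ^ k] :=
      Int.ModEq.sum fun i _ => (hcast i).mul_right _
    refine h1.trans ?_
    have h2 : ∑ i : Fin d, g i * (b : ℤ) ^ (i : ℕ) =
        ∑ a : T, (t a : ℤ) * ∑ i : Fin d, f a i * (b : ℤ) ^ (i : ℕ) := by
      simp only [g, Finset.sum_mul, Finset.mul_sum]
      rw [Finset.sum_comm]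
      exact Finset.sum_congr rfl fun _ _ => Finset.sum_congr rfl fun _ _ => by ring
    rw [h2]
    have h3 : ∑ a : T, (t a : ℤ) * ∑ i : Fin d, f a i * (b : ℤ) ^ (i : ℕ) ≡
        ∑ a : T, (t a : ℤ) * (if b = (a : ℕ) then 2 ^ e else 0) [ZMOD 2 ^ k] :=
      Int.ModEq.sum fun a _ => (hf a b hb).mul_left _
    refine h3.trans ?_
    rw [Finset.sum_eq_single ⟨b, hb⟩]
    · simp only [if_true]
      rw [mul_comm]
    · intro a _ hne
      have : b ≠ (a : ℕ) := fun h => hne (Subtype.ext h.symm)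
      simp [this]
    · simp
  exact Int.natCast_modEq_iff.1 key

theorem polyVal_add (k : ℕ) {d : ℕ} (c c' : Fin d → Fin (2 ^ k)) (a : ℕ) :
    polyVal k (c + c') a = (polyVal k c a + polyVal k c' a) % 2 ^ k := by
  unfold polyVal
  rw [← Nat.add_mod, ← Finset.sum_add_distrib]
  refine Nat.ModEq.sum fun i _ => ?_
  rw [← add_mul]
  refine Nat.ModEq.mul_right _ ?_
  rw [Pi.add_apply, Fin.val_add]
  exact Nat.mod_modEq _ _

theorem polyVal_lt (k : ℕ) {d : ℕ} (c : Fin d → Fin (2 ^ k)) (a : ℕ) : polyVal k c a < 2 ^ k :=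
  Nat.mod_lt _ (by positivity)

/-- Every label consists of the leading bits of exactly one interval of numbers. -/
theorem exists_topBits_iff (k R : ℕ) (hR : R ≤ k) (u : Fin R → Bool) :
    ∃ N < 2 ^ R, ∀ v < 2 ^ k, topBits k R v = u ↔ v / 2 ^ (k - R) = N := by
  have hbit : ∀ v, topBits k R v = topBits R R (v / 2 ^ (k - R)) := by
    intro v
    funext i
    have := i.2
    rw [topBits, topBits, Nat.testBit_div_two_pow]
    congr 1
    omega
  have hinj : Function.Injective fun N : Fin (2 ^ R) => topBits R R N := by
    intro N N' h
    apply Fin.ext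
    apply Nat.eq_of_testBit_eq
    intro i
    rcases lt_or_ge i R with hi | hi
    · have := congrFun h ⟨R - 1 - i, by omega⟩
      simp only [topBits] at this
      rwa [show R - 1 - (R - 1 - i) = i by omega] at this
    · have h2 : 2 ^ R ≤ 2 ^ i := Nat.pow_le_pow_right (by norm_num) hi
      rw [Nat.testBit_lt_two_pow (N.2.trans_le h2), Nat.testBit_lt_two_pow (N'.2.trans_le h2)]
  have hbij := (Fintype.bijective_iff_injective_and_card _).2 ⟨hinj, by simp⟩
  obtain ⟨N, hN⟩ := hbij.2 u
  refine ⟨N, N.2, fun v hv => ?_⟩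
  have hlt : v / 2 ^ (k - R) < 2 ^ R := by
    rw [Nat.div_lt_iff_lt_mul (by positivity), ← pow_add, Nat.add_sub_cancel' hR]
    exact hv
  rw [hbit]
  constructor
  · intro h
    have := @hinj ⟨_, hlt⟩ N (h.trans hN.symm)
    exact congrArg Fin.val this
  · intro h
    rw [h]
    exact hN

/-- Translation by the residue of `N - N'`, written without subtraction below zero. -/
theorem add_mod_eq_iff {x N N' M : ℕ} (hx : x < M) (hN : N < M) (hN' : N' < M) :
    (x + (N + (M - N'))) % M = N ↔ x = N' := by
  constructor
  · intro h
    have h1 : (x + (M - N') + N) % M = (0 + N) % M := by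
      rw [zero_add, Nat.mod_eq_of_lt hN, ← h]
      congr 1
      omega
    have h2 : (x + (M - N')) % M = 0 % M := Nat.ModEq.add_right_cancel' N h1
    rw [Nat.zero_mod] at h2
    obtain ⟨y, hy⟩ := Nat.dvd_of_mod_eq_zero h2
    have hy1 : y < 2 := by
      by_contra hc
      have : M * 2 ≤ M * y := Nat.mul_le_mul_left M (not_lt.1 hc)
      omega
    interval_cases y <;> omega
  · intro h
    rw [h, show N' + (N + (M - N')) = N + M by omega, Nat.add_mod_right, Nat.mod_eq_of_lt hN]

/-- Labels given by the leading bits of a random polynomial. -/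
noncomputable def polyLabels {α : Type} (pt : α → ℕ) (d k R : ℕ) : PMF (α → (Fin R → Bool)) :=
  (PMF.uniformOfFintype (Fin d → Fin (2 ^ k))).map fun c a => topBits k R (polyVal k c (pt a))

/-- Adding a fixed polynomial preserves the uniform distribution of the coefficients. If its values
on `T` are multiples of 2^(`k` − `R`), it shifts the leading bits without any carry from below, so
any pattern is moved to any other and all patterns are equally likely. -/
theorem kWise_polyLabels {α : Type} (pt : α → ℕ) (hpt : Function.Injective pt) (d w k R : ℕ)
    (hw : ∀ a, pt a < 2 ^ w) (hk : R + (d - 1) * w ≤ k) : KWise d (polyLabels pt d k R) := by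
  classical
  intro T hT v
  refine toOuterMeasure_pattern_of_forall_eq _ T (fun u u' => ?_) v
  have hRk : R ≤ k := by omega
  choose N hN1 hN2 using fun u : Fin R → Bool => exists_topBits_iff k R hRk u
  obtain ⟨c', hc'⟩ := exists_coeff (T.image pt) d w k (k - R)
    (by rw [Finset.card_image_of_injective _ hpt]; exact hT)
    (fun a ha => by obtain ⟨b, _, rfl⟩ := Finset.mem_image.1 ha; exact hw b) (by omega)
    (fun b => if h : ∃ a ∈ T, pt a = b then N (u h.choose) + (2 ^ R - N (u' h.choose)) else 0)
  have hc2 : ∀ a ∈ T, polyVal k c' (pt a) =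
      (2 ^ (k - R) * (N (u a) + (2 ^ R - N (u' a)))) % 2 ^ k := by
    intro a ha
    rw [hc' _ (Finset.mem_image_of_mem pt ha)]
    have hex : ∃ a' ∈ T, pt a' = pt a := ⟨a, ha, rfl⟩
    have : hex.choose = a := hpt hex.choose_spec.2
    rw [dif_pos hex, this]
  simp only [polyLabels, PMF.toOuterMeasure_map_apply]
  rw [← toOuterMeasure_uniform_equiv (Equiv.addRight c')]
  congr 1
  ext c
  simp only [Set.mem_preimage, Set.mem_ofPred_eq, Equiv.coe_addRight]
  refine forall₂_congr fun a ha => ?_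
  rw [hN2 _ _ (polyVal_lt k _ _), hN2 _ _ (polyVal_lt k _ _), polyVal_add, hc2 a ha,
    Nat.add_mod_mod]
  have hk2 : 2 ^ k = 2 ^ (k - R) * 2 ^ R := by rw [← pow_add, Nat.sub_add_cancel hRk]
  rw [hk2, Nat.mod_mul_right_div_self, Nat.add_mul_div_left _ _ (by positivity)]
  set x := polyVal k c (pt a) / 2 ^ (k - R) with hx
  have hxlt : x < 2 ^ R := by
    rw [hx, Nat.div_lt_iff_lt_mul (by positivity), mul_comm, ← hk2]
    exact polyVal_lt k _ _
  exact add_mod_eq_iff hxlt (hN1 (u a)) (hN1 (u' a))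

/-- The sign given by a bit. -/
def boolEquivUnits : Bool ≃ ℤˣ where
  toFun b := if b then -1 else 1
  invFun u := decide (u = -1)
  left_inv b := by cases b <;> decide
  right_inv u := by rcases Int.units_eq_one_or u with rfl | rfl <;> decide

/-- The sign at `a` given by the leading bit of a polynomial. -/
def polySign (k : ℕ) {d : ℕ} (c : Fin d → Fin (2 ^ k)) (a : ℕ) : ℤˣ :=
  boolEquivUnits ((polyVal k c a).testBit (k - 1))

/-- Signs given by the leading bit of a random polynomial. -/
noncomputable def polySigns {α : Type} (pt : α → ℕ) (d k : ℕ) : PMF (α → ℤˣ) :=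
  (PMF.uniformOfFintype (Fin d → Fin (2 ^ k))).map fun c a => polySign k c (pt a)

theorem kWise_polySigns {α : Type} (pt : α → ℕ) (hpt : Function.Injective pt) (d w k : ℕ)
    (hw : ∀ a, pt a < 2 ^ w) (hk : 1 + (d - 1) * w ≤ k) : KWise d (polySigns pt d k) := by
  have h := (kWise_polyLabels pt hpt d w k 1 hw hk).map_equiv
    ((Equiv.funUnique (Fin 1) Bool).trans boolEquivUnits)
  rw [polyLabels, PMF.map_comp] at h
  exact h

/-! ### Word length and the concrete families -/

/-- Words for the universe `[n]` and a sketch with `rows` rows have `8 * wordLen rows n` bits. -/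
def wordLen (rows n : ℕ) : ℕ := (rows * n + rows).size

theorem wordLen_pos {rows : ℕ} (hr : 0 < rows) (n : ℕ) : 0 < wordLen rows n :=
  Nat.size_pos.2 (by omega)

theorem lt_two_pow_wordLen (rows n : ℕ) : rows * n + rows < 2 ^ wordLen rows n := Nat.lt_size_self _

/-- The number of an entry of the sign matrix of the sketch. -/
def entryIndex {rows n : ℕ} (a : Fin rows × Fin n) : ℕ := a.1 * n + a.2

theorem entryIndex_injective {rows n : ℕ} :
    Function.Injective (entryIndex : Fin rows × Fin n → ℕ) := by
  rintro ⟨i, x⟩ ⟨j, y⟩ h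
  simp only [entryIndex] at h
  have hx := x.2
  have hy := y.2
  have h1 : (i : ℕ) = j := by
    have e1 : ((i : ℕ) * n + x) / n = i := by
      rw [mul_comm, Nat.mul_add_div (by omega), Nat.div_eq_of_lt hx, add_zero]
    have e2 : ((j : ℕ) * n + y) / n = j := by
      rw [mul_comm, Nat.mul_add_div (by omega), Nat.div_eq_of_lt hy, add_zero]
    rw [← e1, h, e2]
  rw [h1] at h
  exact Prod.ext (Fin.ext h1) (Fin.ext (by simpa using h))

theorem entryIndex_lt {rows n : ℕ} (a : Fin rows × Fin n) :
    entryIndex a < 2 ^ wordLen rows n := by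
  refine lt_trans ?_ (lt_two_pow_wordLen rows n)
  have h1 := a.1.2
  have h2 := a.2.2
  have : (a.1 + 1 : ℕ) * n ≤ rows * n := Nat.mul_le_mul_right n h1
  unfold entryIndex
  rw [add_mul, one_mul] at this
  omega

theorem item_lt {rows n : ℕ} (hr : 0 < rows) (x : Fin n) : (x : ℕ) < 2 ^ wordLen rows n := by
  refine lt_of_le_of_lt ?_ (lt_two_pow_wordLen rows n)
  have h2 := x.2
  have : 1 * n ≤ rows * n := Nat.mul_le_mul_right n hr
  omega

/-- The families used by the word RAM program. -/
noncomputable def polyFamilies {rows : ℕ} (hr : 0 < rows) (n : ℕ) : Families n rows where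
  hash R := polyLabels (fun x : Fin n => (x : ℕ)) 2
    -- The family has to provide labels of every length; for the lengths that HH2 asks for, the
    -- maximum is the first entry.
    (max (8 * wordLen rows n) (R + wordLen rows n)) R
  sign := polySigns (fun x : Fin n => (x : ℕ)) 4 (8 * wordLen rows n)
  sketch := polySigns entryIndex 8 (8 * wordLen rows n)
  hash_kWise R := kWise_polyLabels _ Fin.val_injective 2 (wordLen rows n) _ R (item_lt hr)
    (by simp)
  sign_kWise := kWise_polySigns _ Fin.val_injective 4 (wordLen rows n) _ (item_lt hr) (by
    have := wordLen_pos hr n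
    omega)
  sketch_kWise := kWise_polySigns _ entryIndex_injective 8 (wordLen rows n) _ entryIndex_lt (by
    have := wordLen_pos hr n
    omega)

end BPTree
namespace BPTree

/-! ### A small structured language and its translation to word RAM code -/

/-- Arithmetic operations. -/
inductive ArithOp
  | add | sub | mul | div | mod

/-- The corresponding word operation. -/
def ArithOp.toWordOp : ArithOp → WordOp
  | .add => .add
  | .sub => .sub
  | .mul => .mul
  | .div => .div
  | .mod => .mod

/-- Arithmetic expressions in the variables `V`. -/
inductive Expr (V : Type)
  | lit (c : ℤ) : Expr V
  | var (v : V) : Expr V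
  | bin (o : ArithOp) (a b : Expr V) : Expr V
  /-- bit length -/
  | len (a : Expr V) : Expr V
  /-- the least power of two that exceeds the absolute value -/
  | pow2 (a : Expr V) : Expr V

section Language

variable {V : Type}

/-- The value of an expression. -/
def Expr.eval (ν : V → ℤ) : Expr V → ℤ
  | .lit c => c
  | .var v => ν v
  | .bin o a b => o.toWordOp.eval (a.eval ν) (b.eval ν)
  | .len a => (a.eval ν).natAbs.size
  | .pow2 a => 2 ^ (a.eval ν).natAbs.size

instance : Add (Expr V) := ⟨.bin .add⟩
instance : Sub (Expr V) := ⟨.bin .sub⟩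
instance : Mul (Expr V) := ⟨.bin .mul⟩
instance : Div (Expr V) := ⟨.bin .div⟩
instance : Mod (Expr V) := ⟨.bin .mod⟩

@[simp] theorem Expr.eval_lit (ν : V → ℤ) (c : ℤ) : (Expr.lit c : Expr V).eval ν = c := rfl
@[simp] theorem Expr.eval_var (ν : V → ℤ) (v : V) : (Expr.var v).eval ν = ν v := rfl
@[simp] theorem Expr.eval_add (ν : V → ℤ) (a b : Expr V) :
    (a + b).eval ν = a.eval ν + b.eval ν := rfl
@[simp] theorem Expr.eval_sub (ν : V → ℤ) (a b : Expr V) :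
    (a - b).eval ν = a.eval ν - b.eval ν := rfl
@[simp] theorem Expr.eval_mul (ν : V → ℤ) (a b : Expr V) :
    (a * b).eval ν = a.eval ν * b.eval ν := rfl
@[simp] theorem Expr.eval_div (ν : V → ℤ) (a b : Expr V) :
    (a / b).eval ν = a.eval ν / b.eval ν := rfl
@[simp] theorem Expr.eval_mod (ν : V → ℤ) (a b : Expr V) :
    (a % b).eval ν = a.eval ν % b.eval ν := rfl
@[simp] theorem Expr.eval_len (ν : V → ℤ) (a : Expr V) :
    (Expr.len a).eval ν = (a.eval ν).natAbs.size := rfl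
@[simp] theorem Expr.eval_pow2 (ν : V → ℤ) (a : Expr V) :
    (Expr.pow2 a).eval ν = 2 ^ (a.eval ν).natAbs.size := rfl

/-- The number of temporary registers needed, minus one. -/
def Expr.depth : Expr V → ℕ
  | .lit _ => 0
  | .var _ => 0
  | .bin _ a b => max a.depth (b.depth + 1)
  | .len a => a.depth
  | .pow2 a => max a.depth 1

/-- An exponent that bounds the growth of the values. -/
def Expr.growth : Expr V → ℕ
  | .lit c => c.natAbs + 1
  | .var _ => 1
  | .bin _ a b => a.growth + b.growth
  | .len a => a.growth
  | .pow2 a => a.growth + 1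

/-- A temporary register. -/
def tmp (τ : ℕ) (i : ℕ) : V ⊕ Fin (τ + 1) := Sum.inr (Fin.ofNat (τ + 1) i)

theorem tmp_ne {τ i j : ℕ} (hi : i ≤ τ) (hj : j ≤ τ) (h : i ≠ j) :
    (tmp τ i : V ⊕ Fin (τ + 1)) ≠ tmp τ j := by
  intro e
  have := congrArg Fin.val (Sum.inr_injective e)
  simp only [Fin.val_ofNat] at this
  rw [Nat.mod_eq_of_lt (by omega), Nat.mod_eq_of_lt (by omega)] at this
  exact h this

theorem inl_ne_tmp {τ i : ℕ} (v : V) : (Sum.inl v : V ⊕ Fin (τ + 1)) ≠ tmp τ i := by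
  simp [tmp]

/-- Code that computes the value of an expression in the temporary register `i`. -/
def Expr.compile (τ : ℕ) : Expr V → ℕ → Code (V ⊕ Fin (τ + 1))
  | .lit c, i => .const (tmp τ i) c
  | .var v, i => .seq (.const (tmp τ i) 0) (.op .add (tmp τ i) (.inl v) (tmp τ i))
  | .bin o a b, i => .seq (a.compile τ i) (.seq (b.compile τ (i + 1))
      (.op o.toWordOp (tmp τ i) (tmp τ i) (tmp τ (i + 1))))
  | .len a, i => .seq (a.compile τ i) (.op .bitLength (tmp τ i) (tmp τ i) (tmp τ i))
  | .pow2 a, i => .seq (a.compile τ i) (.seq (.op .bitLength (tmp τ i) (tmp τ i) (tmp τ i))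
      (.seq (.const (tmp τ (i + 1)) 1) (.op .shiftLeft (tmp τ i) (tmp τ (i + 1)) (tmp τ i))))

theorem Expr.one_le_growth (e : Expr V) : 1 ≤ e.growth := by
  induction e <;> simp [Expr.growth] <;> omega

theorem two_pow_size_le (a : ℕ) : 2 ^ a.size ≤ 2 * a + 1 := by
  rcases Nat.eq_zero_or_pos a with rfl | h
  · simp
  · have h1 : 2 ^ (a.size - 1) ≤ a := Nat.lt_size.1 (by have := Nat.size_pos.2 h; omega)
    have h2 : 2 ^ a.size = 2 * 2 ^ (a.size - 1) := by
      rw [← pow_succ', Nat.sub_add_cancel (Nat.size_pos.2 h)]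
    omega

theorem size_le_self (a : ℕ) : a.size ≤ a := Nat.size_le.2 Nat.lt_two_pow_self

theorem ArithOp.natAbs_eval_le (o : ArithOp) (a b : ℤ) {x y : ℕ} (hx : 2 ≤ x) (hy : 2 ≤ y)
    (ha : a.natAbs ≤ x) (hb : b.natAbs ≤ y) : (o.toWordOp.eval a b).natAbs ≤ x * y := by
  have h1 : x ≤ x * y := Nat.le_mul_of_pos_right x (by omega)
  have h2 : y ≤ x * y := Nat.le_mul_of_pos_left y (by omega)
  have h3 : x + y ≤ x * y := by nlinarith
  cases o
  · simp only [toWordOp, WordOp.eval]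
    omega
  · simp only [toWordOp, WordOp.eval]
    omega
  · simp only [toWordOp, WordOp.eval, Int.natAbs_mul]
    exact Nat.mul_le_mul ha hb
  · simp only [toWordOp, WordOp.eval]
    exact (Int.natAbs_ediv_le_natAbs a b).trans (ha.trans h1)
  · simp only [toWordOp, WordOp.eval]
    rcases eq_or_ne b 0 with rfl | h0
    · rw [Int.emod_zero]
      exact ha.trans h1
    · have := Int.emod_nonneg a h0
      have h4 := Int.emod_lt_abs a h0
      rw [Int.abs_eq_natAbs] at h4
      exact le_trans (by omega) h2

theorem two_le_pow {B g : ℕ} (hB : 2 ≤ B) (hg : 1 ≤ g) : 2 ≤ B ^ g :=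
  hB.trans (Nat.le_self_pow (by omega) B)

theorem Expr.natAbs_eval_le {ν : V → ℤ} {B : ℕ} (hB : 2 ≤ B) (hν : ∀ v, (ν v).natAbs ≤ B)
    (e : Expr V) : (e.eval ν).natAbs ≤ B ^ e.growth := by
  induction e with
  | lit c =>
    exact (Nat.lt_two_pow_self).le.trans ((Nat.pow_le_pow_left hB _).trans
      (Nat.pow_le_pow_right (by omega) (Nat.le_succ _)))
  | var v => simpa [Expr.growth] using hν v
  | bin o a b iha ihb =>
    rw [Expr.growth, pow_add]
    exact o.natAbs_eval_le _ _ (two_le_pow hB a.one_le_growth) (two_le_pow hB b.one_le_growth)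
      iha ihb
  | len a iha =>
    simp only [Expr.eval_len, Int.natAbs_natCast, Expr.growth]
    exact (size_le_self _).trans iha
  | pow2 a iha =>
    simp only [Expr.eval_pow2, Expr.growth, Int.natAbs_pow, pow_succ]
    have h1 := two_pow_size_le (a.eval ν).natAbs
    have h2 := two_le_pow hB a.one_le_growth
    rcases Nat.eq_zero_or_pos (a.eval ν).natAbs with h0 | h0
    · rw [h0]
      simp
      nlinarith
    · have h3 : 2 ^ (a.eval ν).natAbs.size ≤ 2 * (a.eval ν).natAbs := by
        -- For a nonzero value the power is even, which improves the bound `2 * a + 1` to `2 * a`;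
        -- one factor of `B` then suffices.
        have h4 : Even (2 ^ (a.eval ν).natAbs.size) :=
          (Nat.even_pow.2 ⟨even_two, by have := Nat.size_pos.2 h0; omega⟩)
        obtain ⟨r, hr⟩ := h4
        omega
      have h5 : (2 : ℤ).natAbs = 2 := rfl
      rw [h5]
      nlinarith

variable [DecidableEq V]

/-- The temporary registers form a stack: code for place `i` leaves the variables and all places
below `i` alone, so a left operand survives the evaluation of the right one. The bound on the peak
covers the intermediate values as well. -/
theorem Expr.compile_exec (τ : ℕ) (e : Expr V) (i : ℕ) (hi : i + e.depth ≤ τ)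
    (M : Machine (V ⊕ Fin (τ + 1))) :
    ∃ M', (e.compile τ i).exec M = PMF.pure M' ∧
      (∀ v, M'.regs (.inl v) = M.regs (.inl v)) ∧
      M'.regs (tmp τ i) = e.eval (fun v => M.regs (.inl v)) ∧
      (∀ j < i, M'.regs (tmp τ j) = M.regs (tmp τ j)) ∧
      ∀ B, 2 ≤ B → (∀ v, (M.regs (.inl v)).natAbs ≤ B) →
        M'.peak ≤ max M.peak (B ^ e.growth) := by
  induction e generalizing i M with
  | lit c =>
    refine ⟨M.tick.store (tmp τ i) c, rfl, fun v => ?_, ?_, fun j hj => ?_, fun B hB hM => ?_⟩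
    · simp [Machine.store, Machine.tick, Function.update_of_ne (inl_ne_tmp v)]
    · simp [Machine.store]
    · simp only [Expr.depth] at hi
      simp [Machine.store, Machine.tick, Function.update_of_ne
        (tmp_ne (V := V) (show j ≤ τ by omega) (show i ≤ τ by omega) hj.ne)]
    · exact max_le_max le_rfl (Expr.natAbs_eval_le hB hM (.lit c))
  | var v =>
    refine ⟨_, by simp only [Expr.compile, Code.exec, PMF.pure_bind]; rfl, fun w => ?_, ?_,
      fun j hj => ?_, fun B hB hM => ?_⟩
    · simp [Machine.store, Machine.tick, Function.update_of_ne (inl_ne_tmp _)]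
    · simp [Machine.store, Machine.tick, WordOp.eval, Function.update_of_ne (inl_ne_tmp _)]
    · simp only [Expr.depth] at hi
      simp [Machine.store, Machine.tick, Function.update_of_ne
        (tmp_ne (V := V) (show j ≤ τ by omega) (show i ≤ τ by omega) hj.ne)]
    · have := hM v
      simp [Machine.store, Machine.tick, WordOp.eval, Function.update_of_ne (inl_ne_tmp _),
        Expr.growth]
      omega
  | bin o a b iha ihb =>
    simp only [Expr.depth] at hi
    obtain ⟨M1, e1, v1, t1, f1, p1⟩ := iha i (by omega) M
    obtain ⟨M2, e2, v2, t2, f2, p2⟩ := ihb (i + 1) (by omega) M1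
    have hv : (fun v => M1.regs (.inl v)) = fun v => M.regs (.inl v) := funext v1
    refine ⟨M2.tick.store (tmp τ i) (o.toWordOp.eval (M2.regs (tmp τ i))
      (M2.regs (tmp τ (i + 1)))), ?_, fun w => ?_, ?_, fun j hj => ?_, fun B hB hM => ?_⟩
    · simp only [Expr.compile, Code.exec, e1, e2, PMF.pure_bind]
    · simp [Machine.store, Machine.tick, Function.update_of_ne (inl_ne_tmp _), v2, v1]
    · simp only [Machine.store, Function.update_self]
      rw [t2, f2 i (by omega), t1, hv]
      rfl
    · simp only [Machine.store, Machine.tick]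
      rw [Function.update_of_ne (tmp_ne (V := V) (by omega) (by omega) hj.ne), f2 j (by omega),
        f1 j hj]
    · have q1 := p1 B hB hM
      have q2 := p2 B hB fun v => by rw [v1]; exact hM v
      have hx := two_le_pow hB a.one_le_growth
      have hy := two_le_pow hB b.one_le_growth
      have q3 := Expr.natAbs_eval_le hB hM (.bin o a b)
      simp only [Machine.store, Machine.tick]
      rw [t2, f2 i (by omega), t1, hv]
      change max M2.peak (Expr.eval _ (.bin o a b)).natAbs ≤ _
      have h1 : B ^ a.growth ≤ B ^ (Expr.bin o a b).growth :=
        Nat.pow_le_pow_right (by omega) (by simp [Expr.growth])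
      have h2 : B ^ b.growth ≤ B ^ (Expr.bin o a b).growth :=
        Nat.pow_le_pow_right (by omega) (by simp [Expr.growth])
      omega
  | len a iha =>
    simp only [Expr.depth] at hi
    obtain ⟨M1, e1, v1, t1, f1, p1⟩ := iha i (by omega) M
    refine ⟨M1.tick.store (tmp τ i) (WordOp.bitLength.eval (M1.regs (tmp τ i))
      (M1.regs (tmp τ i))), ?_, fun w => ?_, ?_, fun j hj => ?_, fun B hB hM => ?_⟩
    · simp only [Expr.compile, Code.exec, e1, PMF.pure_bind]
    · simp [Machine.store, Machine.tick, Function.update_of_ne (inl_ne_tmp _), v1]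
    · simp only [Machine.store, Function.update_self]
      rw [t1]
      rfl
    · simp only [Machine.store, Machine.tick]
      rw [Function.update_of_ne (tmp_ne (V := V) (by omega) (by omega) hj.ne), f1 j hj]
    · have q1 := p1 B hB hM
      have q3 := Expr.natAbs_eval_le hB hM (.len a)
      simp only [Machine.store, Machine.tick]
      rw [t1]
      change max M1.peak (Expr.eval _ (.len a)).natAbs ≤ _
      have h1 : B ^ a.growth = B ^ (Expr.len a).growth := rfl
      omega
  | pow2 a iha =>
    simp only [Expr.depth] at hi
    obtain ⟨M1, e1, v1, t1, f1, p1⟩ := iha i (by omega) M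
    have hne : (tmp τ (i + 1) : V ⊕ Fin (τ + 1)) ≠ tmp τ i :=
      tmp_ne (by omega) (by omega) (by omega)
    refine ⟨_, by simp only [Expr.compile, Code.exec, e1, PMF.pure_bind]; rfl, fun w => ?_, ?_,
      fun j hj => ?_, fun B hB hM => ?_⟩
    · simp [Machine.store, Machine.tick, Function.update_of_ne (inl_ne_tmp _), v1]
    · simp [Machine.store, Machine.tick, Function.update_of_ne hne.symm, WordOp.eval, t1]
    · simp only [Machine.store, Machine.tick]
      rw [Function.update_of_ne (tmp_ne (V := V) (by omega) (by omega) hj.ne),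
        Function.update_of_ne (tmp_ne (V := V) (by omega) (by omega) (by omega)),
        Function.update_of_ne (tmp_ne (V := V) (by omega) (by omega) hj.ne), f1 j hj]
    · have q1 := p1 B hB hM
      have q2 := Expr.natAbs_eval_le hB hM (.len a)
      have q3 := Expr.natAbs_eval_le hB hM (.pow2 a)
      have h1 : B ^ a.growth ≤ B ^ (Expr.pow2 a).growth :=
        Nat.pow_le_pow_right (by omega) (by simp [Expr.growth])
      have h2 : (Expr.len a).growth = a.growth := rfl
      have h3 := two_le_pow hB a.one_le_growth
      rw [h2, Expr.eval_len] at q2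
      rw [Expr.eval_pow2] at q3
      simp only [Machine.store, Machine.tick, Function.update_self, Function.update_of_ne hne.symm,
        WordOp.eval, t1, Int.toNat_natCast, one_mul, Int.natAbs_one]
      omega

/-! ### Structured programs and the correctness of their translation -/

/-- Structured programs. -/
inductive HCode (V : Type)
  | skip : HCode V
  /-- `d := e` -/
  | assign (d : V) (e : Expr V) : HCode V
  /-- `d :=` a random integer with `m` times as many bits as `e` -/
  | rand (d : V) (m : ℕ) (e : Expr V) : HCode V
  | seq (P Q : HCode V) : HCode V
  /-- if `a ≤ b` then `P` else `Q` -/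
  | ite (a b : Expr V) (P Q : HCode V) : HCode V

/-- The meaning of a structured program. -/
noncomputable def HCode.sem : HCode V → (V → ℤ) → PMF (V → ℤ)
  | .skip, ν => PMF.pure ν
  | .assign d e, ν => PMF.pure (Function.update ν d (e.eval ν))
  | .rand d m e, ν =>
      (PMF.uniformOfFintype (Fin (2 ^ (m * (e.eval ν).natAbs.size)))).map fun v : Fin _ =>
        Function.update ν d ((v : ℕ) : ℤ)
  | .seq P Q, ν => (P.sem ν).bind fun ν' => Q.sem ν'
  | .ite a b P Q, ν => if a.eval ν ≤ b.eval ν then P.sem ν else Q.sem ν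

/-- The number of temporary registers needed, minus one. -/
def HCode.depth : HCode V → ℕ
  | .skip => 0
  | .assign _ e => max e.depth 1
  | .rand _ _ e => e.depth + 1
  | .seq P Q => max P.depth Q.depth
  | .ite a b P Q => max (max a.depth (b.depth + 1)) (max P.depth Q.depth)

/-- An exponent that bounds the growth of the values. -/
def HCode.growth : HCode V → ℕ
  | .skip => 1
  | .assign _ e => e.growth
  | .rand _ m e => (m + 1) * (e.growth + 1)
  | .seq P Q => P.growth * Q.growth
  | .ite a b P Q => a.growth + b.growth + P.growth + Q.growth

/-- Translation of a structured program. -/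
def HCode.compile (τ : ℕ) : HCode V → Code (V ⊕ Fin (τ + 1))
  | .skip => .skip
  | .assign d e => .seq (e.compile τ 0) (.seq (.const (tmp τ 1) 0)
      (.op .add (.inl d) (tmp τ 0) (tmp τ 1)))
  | .rand d m e => .seq ((Expr.bin .mul (.lit m) (.len e)).compile τ 0)
      (.rand (.inl d) (tmp τ 0))
  | .seq P Q => .seq (P.compile τ) (Q.compile τ)
  | .ite a b P Q => .seq (a.compile τ 0) (.seq (b.compile τ 1)
      (.ite (tmp τ 0) (tmp τ 1) (P.compile τ) (Q.compile τ)))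

/-- The values of the variables in a machine state. -/
def Machine.vars {τ : ℕ} (M : Machine (V ⊕ Fin (τ + 1))) : V → ℤ := fun v => M.regs (.inl v)

theorem Machine.vars_store_tick {τ : ℕ} (M : Machine (V ⊕ Fin (τ + 1))) (d : V) (c : ℤ) :
    (M.tick.store (.inl d) c).vars = Function.update M.vars d c := by
  funext v
  by_cases h : v = d
  · subst h
    simp [Machine.vars, Machine.store]
  · have : (Sum.inl v : V ⊕ Fin (τ + 1)) ≠ .inl d := fun e => h (Sum.inl_injective e)
    simp [Machine.vars, Machine.store, Machine.tick, Function.update_of_ne h,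
      Function.update_of_ne this]

/-- The type of the sample depends on the content of a register; this form allows that content to be
replaced by an equal number. -/
theorem Code.exec_rand {Reg : Type} [DecidableEq Reg] (d a : Reg) (M : Machine Reg) (k : ℕ)
    (hk : (M.regs a).toNat = k) : (Code.rand d a).exec M =
      (PMF.uniformOfFintype (Fin (2 ^ k))).map fun v : Fin (2 ^ k) =>
        M.tick.store d ((v : ℕ) : ℤ) := by
  subst hk
  rw [Code.exec]
  change ((PMF.uniformOfFintype _).bind fun v => PMF.pure ((v : Fin _) : ℕ)).map _ = _
  rw [PMF.map_bind]
  simp only [PMF.pure_map]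
  rfl

theorem HCode.one_le_growth {W : Type} (P : HCode W) : 1 ≤ P.growth := by
  induction P with
  | skip => exact le_rfl
  | assign d e => exact e.one_le_growth
  | rand d m e => exact Nat.succ_le_of_lt (by simp [HCode.growth])
  | seq P Q ihP ihQ => exact Nat.succ_le_of_lt (Nat.mul_pos ihP ihQ)
  | ite a b P Q ihP ihQ => simp only [HCode.growth]; omega

/-- The law of the variables and the size of the numbers go through the same induction. Growth
exponents multiply under composition, because the second program starts from values already raised
to the exponent of the first. -/
theorem HCode.compile_exec (τ : ℕ) (P : HCode V) (hτ : P.depth ≤ τ)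
    (M : Machine (V ⊕ Fin (τ + 1))) :
    ((P.compile τ).exec M).map Machine.vars = P.sem M.vars ∧
    ∀ M' ∈ ((P.compile τ).exec M).support, ∀ B, 2 ≤ B → (∀ v, (M.vars v).natAbs ≤ B) →
      (∀ v, (M'.vars v).natAbs ≤ B ^ P.growth) ∧ M'.peak ≤ max M.peak (B ^ P.growth) := by
  induction P generalizing M with
  | skip =>
    refine ⟨PMF.pure_map _ _, fun M' hM' B hB hM => ?_⟩
    rw [HCode.compile, Code.exec, PMF.mem_support_pure_iff] at hM'
    subst hM'
    simpa [HCode.growth] using hM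
  | assign d e =>
    simp only [HCode.depth] at hτ
    obtain ⟨M1, e1, v1, t1, f1, p1⟩ := e.compile_exec τ 0 (by omega) M
    have hne : (tmp τ 0 : V ⊕ Fin (τ + 1)) ≠ tmp τ 1 := tmp_ne (by omega) (by omega) (by omega)
    have hv1 : M1.vars = M.vars := funext v1
    have hv2 : (M1.tick.store (tmp τ 1) 0).vars = M.vars := by
      rw [← hv1]
      funext v
      simp [Machine.vars, Machine.store, Machine.tick, Function.update_of_ne (inl_ne_tmp _)]
    have hex : ((HCode.assign d e).compile τ).exec M = PMF.pure
        ((M1.tick.store (tmp τ 1) 0).tick.store (.inl d) (e.eval M.vars)) := by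
      simp only [HCode.compile, Code.exec, e1, PMF.pure_bind]
      congr 2
      simp [Machine.store, Machine.tick, WordOp.eval, Function.update_of_ne hne, t1]
      rfl
    rw [hex]
    refine ⟨?_, fun M' hM' B hB hM => ?_⟩
    · rw [PMF.pure_map, Machine.vars_store_tick, hv2]
      rfl
    · rw [PMF.mem_support_pure_iff] at hM'
      subst hM'
      have q := Expr.natAbs_eval_le hB hM e
      have q1 := p1 B hB hM
      have hpow : B ≤ B ^ e.growth := Nat.le_self_pow (by have := e.one_le_growth; omega) B
      constructor
      · intro v
        rw [Machine.vars_store_tick, hv2]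
        by_cases h : v = d
        · subst h
          rw [Function.update_self]
          exact q
        · rw [Function.update_of_ne h]
          exact (hM v).trans hpow
      · simp only [Machine.store, Machine.tick, HCode.growth, Int.natAbs_zero]
        omega
  | rand d m e =>
    simp only [HCode.depth] at hτ
    obtain ⟨M1, e1, v1, t1, f1, p1⟩ := (Expr.bin .mul (.lit m) (.len e)).compile_exec τ 0
      (by simp only [Expr.depth]; omega) M
    have hv1 : M1.vars = M.vars := funext v1
    have hbits : (M1.regs (tmp τ 0)).toNat = m * (e.eval M.vars).natAbs.size := by
      rw [t1]
      change ((m : ℤ) * ((e.eval M.vars).natAbs.size : ℤ)).toNat = _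
      rw [← Nat.cast_mul, Int.toNat_natCast]
    have hex : ((HCode.rand d m e).compile τ).exec M =
        (PMF.uniformOfFintype (Fin (2 ^ (m * (e.eval M.vars).natAbs.size)))).map fun v : Fin _ =>
          M1.tick.store (.inl d) ((v : ℕ) : ℤ) := by
      rw [HCode.compile, Code.exec, e1, PMF.pure_bind, Code.exec_rand _ _ _ _ hbits]
    rw [hex]
    refine ⟨?_, fun M' hM' B hB hM => ?_⟩
    · rw [PMF.map_comp, HCode.sem]
      congr 1
      funext v
      rw [Function.comp, Machine.vars_store_tick, hv1]
    · rw [PMF.mem_support_map_iff] at hM'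
      obtain ⟨v, _, rfl⟩ := hM'
      have q := Expr.natAbs_eval_le hB hM (.pow2 e)
      have q1 := p1 B hB hM
      have g1 : B ^ (Expr.bin .mul (.lit (m : ℤ)) (.len e)).growth ≤
          B ^ ((m + 1) * (e.growth + 1)) := by
        refine Nat.pow_le_pow_right (by omega) ?_
        simp only [Expr.growth, Int.natAbs_natCast]
        nlinarith
      have g2 : (v : ℕ) ≤ B ^ ((m + 1) * (e.growth + 1)) := by
        refine v.2.le.trans ?_
        rw [mul_comm m, pow_mul, mul_comm (m + 1), pow_mul]
        simp only [Expr.eval_pow2, Int.natAbs_pow, Expr.growth] at q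
        refine (Nat.pow_le_pow_left q m).trans ?_
        exact Nat.pow_le_pow_right (by positivity) (Nat.le_succ m)
      have hpow : B ≤ B ^ ((m + 1) * (e.growth + 1)) := Nat.le_self_pow (by positivity) B
      constructor
      · intro w
        rw [Machine.vars_store_tick, hv1]
        by_cases h : w = d
        · subst h
          rw [Function.update_self, Int.natAbs_natCast]
          exact g2
        · rw [Function.update_of_ne h]
          exact (hM w).trans hpow
      · simp only [Machine.store, Machine.tick, HCode.growth, Int.natAbs_natCast]
        omega
  | seq P Q ihP ihQ =>
    simp only [HCode.depth] at hτ
    constructor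
    · simp only [HCode.compile, Code.exec, PMF.map_bind, HCode.sem]
      rw [← (ihP (by omega) M).1, PMF.bind_map]
      congr 1
      funext M1
      exact (ihQ (by omega) M1).1
    · intro M' hM' B hB hM
      simp only [HCode.compile, Code.exec] at hM'
      rw [PMF.mem_support_bind_iff] at hM'
      obtain ⟨M1, h1, h2⟩ := hM'
      obtain ⟨a1, a2⟩ := (ihP (by omega) M).2 M1 h1 B hB hM
      obtain ⟨b1, b2⟩ := (ihQ (by omega) M1).2 M' h2 (B ^ P.growth)
        (two_le_pow hB P.one_le_growth) a1
      rw [← pow_mul] at b1 b2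
      refine ⟨b1, ?_⟩
      have : B ^ P.growth ≤ B ^ (P.growth * Q.growth) :=
        Nat.pow_le_pow_right (by omega) (Nat.le_mul_of_pos_right _ Q.one_le_growth)
      simp only [HCode.growth]
      omega
  | ite a b P Q ihP ihQ =>
    simp only [HCode.depth] at hτ
    obtain ⟨M1, e1, v1, t1, f1, p1⟩ := a.compile_exec τ 0 (by omega) M
    obtain ⟨M2, e2, v2, t2, f2, p2⟩ := b.compile_exec τ 1 (by omega) M1
    have hv1 : M1.vars = M.vars := funext v1
    have hv2 : M2.vars = M.vars := (funext v2).trans hv1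
    have hv3 : M2.tick.vars = M.vars := hv2
    have ha : M2.regs (tmp τ 0) = a.eval M.vars := by
      rw [f2 0 (by omega), t1]
      rfl
    have hb : M2.regs (tmp τ 1) = b.eval M.vars := by
      rw [t2]
      exact congrArg b.eval hv1 ▸ rfl
    have hex : ((HCode.ite a b P Q).compile τ).exec M = if a.eval M.vars ≤ b.eval M.vars then
        (P.compile τ).exec M2.tick else (Q.compile τ).exec M2.tick := by
      simp only [HCode.compile, Code.exec, e1, e2, PMF.pure_bind, ha, hb]
    have hpeak : ∀ B, 2 ≤ B → (∀ v, (M.vars v).natAbs ≤ B) →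
        M2.tick.peak ≤ max M.peak (B ^ (HCode.ite a b P Q).growth) := by
      intro B hB hM
      have q1 := p1 B hB hM
      have q2 := p2 B hB fun v => by rw [v1]; exact hM v
      have h1 : B ^ a.growth ≤ B ^ (HCode.ite a b P Q).growth :=
        Nat.pow_le_pow_right (by omega) (by simp only [HCode.growth]; omega)
      have h2 : B ^ b.growth ≤ B ^ (HCode.ite a b P Q).growth :=
        Nat.pow_le_pow_right (by omega) (by simp only [HCode.growth]; omega)
      change M2.peak ≤ _
      omega
    rw [hex, HCode.sem]
    split_ifs with hc
    · obtain ⟨s1, s2⟩ := ihP (by omega) M2.tick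
      rw [hv3] at s1 s2
      refine ⟨s1, fun M' hM' B hB hM => ?_⟩
      obtain ⟨a1, a2⟩ := s2 M' hM' B hB hM
      have h1 : B ^ P.growth ≤ B ^ (HCode.ite a b P Q).growth :=
        Nat.pow_le_pow_right (by omega) (by simp only [HCode.growth]; omega)
      have := hpeak B hB hM
      exact ⟨fun v => (a1 v).trans h1, by omega⟩
    · obtain ⟨s1, s2⟩ := ihQ (by omega) M2.tick
      rw [hv3] at s1 s2
      refine ⟨s1, fun M' hM' B hB hM => ?_⟩
      obtain ⟨a1, a2⟩ := s2 M' hM' B hB hM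
      have h1 : B ^ Q.growth ≤ B ^ (HCode.ite a b P Q).growth :=
        Nat.pow_le_pow_right (by omega) (by simp only [HCode.growth]; omega)
      have := hpeak B hB hM
      exact ⟨fun v => (a1 v).trans h1, by omega⟩

/-! ### Step counts -/

/-- An upper bound for the number of steps. -/
def Code.cost {Reg : Type} : Code Reg → ℕ
  | .skip => 0
  | .const _ _ => 1
  | .op _ _ _ _ => 1
  | .rand _ _ => 1
  | .seq P Q => P.cost + Q.cost
  | .ite _ _ P Q => 1 + P.cost + Q.cost

theorem Code.time_le {Reg : Type} [DecidableEq Reg] (P : Code Reg) (M : Machine Reg) :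
    ∀ M' ∈ (P.exec M).support, M'.time ≤ M.time + P.cost := by
  induction P generalizing M with
  | skip =>
    intro M' h
    rw [Code.exec, PMF.mem_support_pure_iff] at h
    simp [h, Code.cost]
  | const d c =>
    intro M' h
    rw [Code.exec, PMF.mem_support_pure_iff] at h
    simp [h, Code.cost, Machine.store, Machine.tick]
  | op o d a b =>
    intro M' h
    rw [Code.exec, PMF.mem_support_pure_iff] at h
    simp [h, Code.cost, Machine.store, Machine.tick]
  | rand d a =>
    intro M' h
    rw [Code.exec, PMF.mem_support_map_iff] at h
    obtain ⟨v, _, rfl⟩ := h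
    simp [Code.cost, Machine.store, Machine.tick]
  | seq P Q ihP ihQ =>
    intro M' h
    rw [Code.exec, PMF.mem_support_bind_iff] at h
    obtain ⟨M1, h1, h2⟩ := h
    have := ihP M M1 h1
    have := ihQ M1 M' h2
    simp only [Code.cost]
    omega
  | ite a b P Q ihP ihQ =>
    intro M' h
    rw [Code.exec] at h
    simp only [Code.cost]
    split_ifs at h
    · have := ihP _ M' h
      simp only [Machine.tick] at this
      omega
    · have := ihQ _ M' h
      simp only [Machine.tick] at this
      omega

end Language
end BPTree
namespace BPTree

/-! ### HH2 in terms of integer data -/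

/-- The number of bits of a random word. -/
def wordBits (rows n : ℕ) : ℕ := 8 * wordLen rows n

/-- The data stored for a copy of HH1: `rows` times the square of the guess, the number of bits,
the round, the recorded bits as a number, the counters, the candidate, and the random
coefficients. -/
structure CopyData (n k : ℕ) where
  sq : ℕ
  R : ℕ
  r : ℕ
  B : ℕ
  X0 : ℤ
  X1 : ℤ
  H : Option (Fin n)
  h : Fin 2 → Fin (2 ^ k)
  z : Fin 4 → Fin (2 ^ k)

section Data

variable {n k rows : ℕ}

/-- The number of label bits for `rows` times a squared guess. -/
def bitCount (rows n sq : ℕ) : ℕ := 3 * ((min n (sq / rows) + 1).size - 1)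

/-- A power of two is an integer, so it lies below a real number exactly if it lies below its
integer part. Hence the floor of the binary logarithm is the bit length, minus one, of an integer
quotient. -/
theorem numBits_sqrt (hr : 0 < rows) (n sq : ℕ) :
    numBits n √((sq : ℝ) / rows) = bitCount rows n sq := by
  have hr' : (0 : ℝ) < rows := by exact_mod_cast hr
  have hq : √((sq : ℝ) / rows) ^ 2 = (sq : ℝ) / rows := Real.sq_sqrt (by positivity)
  rw [numBits, bitCount, hq]
  congr 1
  set y : ℝ := min (n : ℝ) ((sq : ℝ) / rows) + 1 with hy
  have hy1 : 1 ≤ y := by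
    have : 0 ≤ min (n : ℝ) ((sq : ℝ) / rows) := le_min (by positivity) (by positivity)
    linarith
  have h1 := pow_floor_logb_le hy1
  have h2 := lt_pow_floor_logb hy1
  set a := ⌊Real.logb 2 y⌋₊
  have h3 : 2 ^ a ≤ min n (sq / rows) + 1 := by
    have h4 : (2 : ℝ) ^ a - 1 ≤ n := by linarith [min_le_left (n : ℝ) ((sq : ℝ) / rows)]
    have h5 : (2 : ℝ) ^ a - 1 ≤ (sq : ℝ) / rows := by
      linarith [min_le_right (n : ℝ) ((sq : ℝ) / rows)]
    have h6 : 2 ^ a ≤ n + 1 := by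
      have : (2 : ℝ) ^ a ≤ n + 1 := by linarith
      exact_mod_cast this
    have h7 : (2 ^ a - 1) * rows ≤ sq := by
      rw [le_div_iff₀ hr'] at h5
      have : ((2 ^ a - 1 : ℕ) : ℝ) * rows ≤ sq := by
        rw [Nat.cast_sub Nat.one_le_two_pow]
        push_cast
        exact h5
      exact_mod_cast this
    have h8 : 2 ^ a - 1 ≤ sq / rows := (Nat.le_div_iff_mul_le hr).2 h7
    omega
  have h4 : min n (sq / rows) + 1 < 2 ^ (a + 1) := by
    have h5 : ((sq / rows : ℕ) : ℝ) ≤ (sq : ℝ) / rows := Nat.cast_div_le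
    have h6 : ((min n (sq / rows) + 1 : ℕ) : ℝ) ≤ y := by
      push_cast
      rw [hy]
      gcongr
    exact_mod_cast h6.trans_lt h2
  have h5 := Nat.lt_size.2 h3
  have h6 := Nat.size_le.2 h4
  omega

/-- The label length is at most three times the word length, and with the margin needed for pairwise
independence this still fits into the eightfold word length. So a single modulus serves all copies.
-/
theorem bitCount_add_le (hr : 0 < rows) (n sq : ℕ) :
    bitCount rows n sq + wordLen rows n ≤ wordBits rows n := by
  have h1 : min n (sq / rows) + 1 ≤ rows * n + rows := by
    have h2 := min_le_left n (sq / rows)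
    have h3 : 1 * n ≤ rows * n := Nat.mul_le_mul_right n hr
    omega
  have h2 := Nat.size_le_size h1
  have h3 := wordLen_pos hr n
  unfold bitCount wordBits
  change _ ≤ wordLen rows n at h2
  omega

/-- Bit `i` of the `r - 1` bits recorded before round `r`, stored as the number `B`. -/
def prefixBit (r B i : ℕ) : Bool := decide (1 ≤ i ∧ i < r) && B.testBit (r - 1 - i)

theorem prefixBit_one (B : ℕ) : prefixBit 1 B = fun _ => false := by
  funext i
  rw [prefixBit, decide_eq_false (by omega), Bool.false_and]

theorem prefixBit_of_lt {r i : ℕ} (B : ℕ) (h1 : 1 ≤ i) (h2 : i < r) :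
    prefixBit r B i = B.testBit (r - 1 - i) := by
  rw [prefixBit, decide_eq_true ⟨h1, h2⟩, Bool.true_and]

theorem prefixBit_succ {r c : ℕ} (B : ℕ) (hr : 1 ≤ r) (hc : c < 2) :
    prefixBit (r + 1) (2 * B + c) = Function.update (prefixBit r B) r (decide (c = 1)) := by
  funext i
  rcases eq_or_ne i r with rfl | hne
  · rw [Function.update_self, prefixBit_of_lt _ hr (Nat.lt_succ_self _),
      show i + 1 - 1 - i = 0 by omega, Nat.testBit_zero]
    congr 1
    exact propext ⟨fun h => by omega, fun h => by omega⟩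
  · rw [Function.update_of_ne hne]
    by_cases hi : 1 ≤ i ∧ i < r
    · rw [prefixBit_of_lt _ hi.1 hi.2, prefixBit_of_lt _ hi.1 (by omega),
        show r + 1 - 1 - i = r - 1 - i + 1 by omega, Nat.testBit_succ]
      congr 1
      omega
    · rw [prefixBit, prefixBit, decide_eq_false hi, decide_eq_false (by omega)]
      rfl

/-- The bit recorded at the end of a round with counters `a` and `b`. -/
def roundBit (a b : ℤ) : ℕ := if b * b ≤ a * a then 0 else 1

theorem roundBit_lt_two (a b : ℤ) : roundBit a b < 2 := by
  unfold roundBit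
  split_ifs <;> norm_num

theorem roundBit_eq_one_iff (a b : ℤ) : roundBit a b = 1 ↔ |a| < |b| := by
  rw [← sq_lt_sq, pow_two, pow_two, ← not_le, roundBit]
  split_ifs with h <;> simp [h]

/-- The state of HH1 described by the data. -/
noncomputable def CopyData.toHH1 (rows : ℕ) (d : CopyData n k) : HH1State n where
  σ := √((d.sq : ℝ) / rows)
  R := d.R
  h := fun x => labelBit (topBits k d.R (polyVal k d.h x))
  Z := fun x => polySign k d.z x
  b := prefixBit d.r d.B
  X0 := d.X0
  X1 := d.X1
  r := d.r
  H := d.H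

/-- A new copy. -/
def CopyData.fresh (rows sq : ℕ) (h : Fin 2 → Fin (2 ^ k)) (z : Fin 4 → Fin (2 ^ k)) :
    CopyData n k :=
  { sq := sq, R := bitCount rows n sq, r := 1, B := 0, X0 := 0, X1 := 0, H := none, h := h, z := z }

/-- The start of a new copy. -/
noncomputable def CopyData.start (n k rows sq : ℕ) : PMF (CopyData n k) :=
  (PMF.uniformOfFintype (Fin 2 → Fin (2 ^ k))).bind fun h =>
    (PMF.uniformOfFintype (Fin 4 → Fin (2 ^ k))).map fun z => CopyData.fresh rows sq h z

/-- The leading `r - 1` bits of the label of `x` agree with the recorded bits. -/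
def CopyData.Agrees (d : CopyData n k) (x : Fin n) : Prop :=
  polyVal k d.h x / 2 ^ (k + 1 - d.r) = d.B

instance (d : CopyData n k) (x : Fin n) : Decidable (d.Agrees x) := by
  unfold CopyData.Agrees
  infer_instance

/-- Bit `r` of the label of `x`, as a number. -/
def CopyData.bit (d : CopyData n k) (x : Fin n) : ℕ := polyVal k d.h x / 2 ^ (k - d.r) % 2

/-- The item `x` is counted. -/
def CopyData.count (d : CopyData n k) (x : Fin n) : CopyData n k :=
  { d with
    H := some x
    X0 := d.X0 + (1 - d.bit x) * ((polySign k d.z x : ℤˣ) : ℤ)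
    X1 := d.X1 + d.bit x * ((polySign k d.z x : ℤˣ) : ℤ) }

/-- The end of a round, with new random coefficients `z`. -/
def CopyData.next (d : CopyData n k) (z : Fin 4 → Fin (2 ^ k)) : CopyData n k :=
  { d with
    B := 2 * d.B + roundBit d.X0 d.X1
    r := d.r + 1
    X0 := 0
    X1 := 0
    z := z }

/-- The copy reads the item `x`. -/
noncomputable def CopyData.step (rows : ℕ) (d : CopyData n k) (x : Fin n) : PMF (CopyData n k) :=
  if d.r < d.R ∧ d.Agrees x then
    if (d.sq : ℤ) * 9 ^ d.r ≤ 1024 * rows * 16 ^ d.r *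
        (((d.count x).X0 + (d.count x).X1) * ((d.count x).X0 + (d.count x).X1)) then
      (PMF.uniformOfFintype (Fin 4 → Fin (2 ^ k))).map fun z => (d.count x).next z
    else PMF.pure (d.count x)
  else PMF.pure d

/-- Conditions that the data of a copy always satisfy. -/
structure CopyData.Ok (rows : ℕ) (d : CopyData n k) : Prop where
  one_le_r : 1 ≤ d.r
  r_le : d.r ≤ d.R + 1
  R_le : d.R + wordLen rows n ≤ k
  B_lt : d.B < 2 ^ (d.r - 1)

theorem CopyData.ok_fresh (hr : 0 < rows) (sq : ℕ) (h : Fin 2 → Fin (2 ^ wordBits rows n))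
    (z : Fin 4 → Fin (2 ^ wordBits rows n)) :
    (CopyData.fresh rows sq h z : CopyData n _).Ok rows :=
  -- The bound on the round is `R + 1` and not `R`, since a fresh copy is in round 1 even if `n =
  -- 0`, where `R = 0`.
  ⟨le_rfl, Nat.le_add_left _ _, bitCount_add_le hr n sq, by simp [CopyData.fresh]⟩

theorem CopyData.Ok.step {d : CopyData n k} (hd : d.Ok rows) (x : Fin n) :
    ∀ d' ∈ (d.step rows x).support, d'.Ok rows := by
  intro d' h
  obtain ⟨h1, h2, h3, h4⟩ := hd
  rw [CopyData.step] at h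
  split_ifs at h with c1 c2
  · rw [PMF.mem_support_map_iff] at h
    obtain ⟨z, _, rfl⟩ := h
    refine ⟨Nat.le_add_left _ _, Nat.succ_le_succ c1.1.le, h3, ?_⟩
    have := roundBit_lt_two (d.count x).X0 (d.count x).X1
    have : 2 ^ d.r = 2 * 2 ^ (d.r - 1) := by rw [← pow_succ', Nat.sub_add_cancel h1]
    change 2 * d.B + roundBit (d.count x).X0 (d.count x).X1 < 2 ^ d.r
    omega
  · rw [PMF.mem_support_pure_iff] at h
    subst h
    exact ⟨h1, h2, h3, h4⟩
  · rw [PMF.mem_support_pure_iff] at h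
    subst h
    exact ⟨h1, h2, h3, h4⟩

theorem CopyData.map_start (hr : 0 < rows) (sq : ℕ) :
    (CopyData.start n (wordBits rows n) rows sq).map (CopyData.toHH1 rows) =
      HH1State.start (polyFamilies hr n) √((sq : ℝ) / rows) := by
  unfold HH1State.start
  rw [numBits_sqrt hr]
  have hmax : max (8 * wordLen rows n) (bitCount rows n sq + wordLen rows n) =
      wordBits rows n := max_eq_left (bitCount_add_le hr n sq)
  simp only [polyFamilies]
  rw [hmax, polyLabels, PMF.bind_map, CopyData.start, PMF.map_bind]
  congr 1
  funext h
  rw [polySigns, PMF.map_comp, Function.comp, PMF.map_comp]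
  congr 1
  funext z
  simp only [Function.comp, CopyData.toHH1, CopyData.fresh, prefixBit_one]
  rfl

/-- The first `r - 1` bits of a label are the quotient of the polynomial value by 2^(`k` + 1 − `r`),
so agreement with all recorded bits becomes one equation between numbers. -/
theorem CopyData.Ok.active_iff {d : CopyData n k} (hd : d.Ok rows) (x : Fin n) :
    (d.toHH1 rows).Active x ↔ d.Agrees x := by
  obtain ⟨h1, h2, h3, h4⟩ := hd
  have hrk : d.r - 1 ≤ k := by omega
  have hv := polyVal_lt k d.h x
  simp only [HH1State.Active, CopyData.Agrees, CopyData.toHH1, Finset.mem_Icc]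
  set v := polyVal k d.h x
  have hq : v / 2 ^ (k + 1 - d.r) < 2 ^ (d.r - 1) := by
    rw [Nat.div_lt_iff_lt_mul (by positivity), ← pow_add]
    rwa [show d.r - 1 + (k + 1 - d.r) = k by omega]
  have hbit : ∀ i, 1 ≤ i → i ≤ d.r - 1 →
      (labelBit (topBits k d.R v) i = (v / 2 ^ (k + 1 - d.r)).testBit (d.r - 1 - i)) := by
    intro i hi1 hi2
    rw [labelBit, dif_pos (by omega), topBits, Nat.testBit_div_two_pow]
    congr 1
    simp only
    omega
  constructor
  · intro h
    apply Nat.eq_of_testBit_eq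
    intro j
    rcases lt_or_ge j (d.r - 1) with hj | hj
    · have h5 := h (d.r - 1 - j) (by omega)
      rw [hbit _ (by omega) (by omega), prefixBit_of_lt _ (by omega) (by omega)] at h5
      rwa [show d.r - 1 - (d.r - 1 - j) = j by omega] at h5
    · have h5 : 2 ^ (d.r - 1) ≤ 2 ^ j := Nat.pow_le_pow_right (by norm_num) hj
      rw [Nat.testBit_lt_two_pow (hq.trans_le h5), Nat.testBit_lt_two_pow (h4.trans_le h5)]
  · intro h i hi
    rw [hbit i hi.1 hi.2, h, prefixBit_of_lt _ hi.1 (by omega)]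

theorem CopyData.Ok.label_r {d : CopyData n k} (hd : d.Ok rows) (hR : d.r < d.R) (x : Fin n) :
    labelBit (topBits k d.R (polyVal k d.h x)) d.r = decide (d.bit x = 1) := by
  have h1 := hd.one_le_r
  rw [labelBit, dif_pos (by omega), topBits, Nat.testBit_eq_decide_div_mod_eq, CopyData.bit]
  simp only
  rw [show k - 1 - (d.r - 1) = k - d.r by omega]

theorem CopyData.bit_lt_two (d : CopyData n k) (x : Fin n) : d.bit x < 2 := Nat.mod_lt _ (by norm_num)

theorem CopyData.Ok.toHH1_count {d : CopyData n k} (hd : d.Ok rows) (hR : d.r < d.R)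
    (x : Fin n) : (d.count x).toHH1 rows = (d.toHH1 rows).count x := by
  have hb := d.bit_lt_two x
  have hl := hd.label_r hR x
  simp only [CopyData.toHH1, CopyData.count, HH1State.count, hl]
  rcases Nat.lt_succ_iff_lt_or_eq.1 hb with h | h
  · have : d.bit x = 0 := by omega
    simp [this]
  · simp [h]

/-- Both sides are nonnegative, so they can be squared; clearing denominators leaves integers, with
1024 = 32², 9 = 3² and 16 = 4². -/
theorem threshold_iff (hr : 0 < rows) (sq r : ℕ) (X : ℤ) :
    (1 / 32 : ℝ) * √((sq : ℝ) / rows) * (3 / 4 : ℝ) ^ r ≤ |(X : ℝ)| ↔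
      (sq : ℤ) * 9 ^ r ≤ 1024 * rows * 16 ^ r * (X * X) := by
  have hr' : (0 : ℝ) < rows := by exact_mod_cast hr
  have h0 : 0 ≤ (1 / 32 : ℝ) * √((sq : ℝ) / rows) * (3 / 4 : ℝ) ^ r := by positivity
  rw [← abs_of_nonneg h0, ← sq_le_sq, mul_pow, mul_pow, Real.sq_sqrt (by positivity), ← pow_mul,
    mul_comm r 2, pow_mul, div_pow (3 : ℝ) 4 2, div_pow ((3 : ℝ) ^ 2) _ r]
  have e : (1 / 32 : ℝ) ^ 2 * ((sq : ℝ) / rows) * ((3 ^ 2) ^ r / (4 ^ 2) ^ r) =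
      (sq * 9 ^ r) / (1024 * rows * 16 ^ r) := by
    norm_num
    field_simp
  rw [e, div_le_iff₀ (by positivity)]
  rw [← Int.cast_le (R := ℝ)]
  push_cast
  rw [show (X : ℝ) ^ 2 * (1024 * rows * 16 ^ r) = 1024 * rows * 16 ^ r * ((X : ℝ) * X) by ring]

theorem CopyData.Ok.map_next {d : CopyData n (wordBits rows n)} (hr : 0 < rows) (hd : d.Ok rows) :
    ((PMF.uniformOfFintype (Fin 4 → Fin (2 ^ wordBits rows n))).map fun z => d.next z).map
      (CopyData.toHH1 rows) = (d.toHH1 rows).nextRound (polyFamilies hr n) := by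
  obtain ⟨h1, h2, h3, h4⟩ := hd
  rw [HH1State.nextRound, PMF.map_comp]
  simp only [polyFamilies, polySigns]
  rw [PMF.map_comp]
  congr 1
  funext z
  simp only [Function.comp, CopyData.toHH1, CopyData.next,
    prefixBit_succ d.B h1 (roundBit_lt_two d.X0 d.X1), roundBit_eq_one_iff]
  rfl

theorem CopyData.Ok.map_step {d : CopyData n (wordBits rows n)} (hr : 0 < rows) (hd : d.Ok rows)
    (x : Fin n) : (d.step rows x).map (CopyData.toHH1 rows) =
      (d.toHH1 rows).step (polyFamilies hr n) x := by
  rw [CopyData.step, HH1State.step]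
  have hact : ((d.toHH1 rows).r < (d.toHH1 rows).R ∧ (d.toHH1 rows).Active x) ↔
      (d.r < d.R ∧ d.Agrees x) := and_congr Iff.rfl (hd.active_iff x)
  by_cases hc : d.r < d.R ∧ d.Agrees x
  · rw [if_pos hc, if_pos (hact.2 hc)]
    have hcount := hd.toHH1_count hc.1 x
    have hthr := threshold_iff hr d.sq d.r ((d.count x).X0 + (d.count x).X1)
    rw [← hcount]
    have hiff : ((1 / 32 : ℝ) * (d.toHH1 rows).σ * (3 / 4 : ℝ) ^ (d.toHH1 rows).r ≤
        |(((((d.count x).toHH1 rows).X0 + ((d.count x).toHH1 rows).X1 : ℤ)) : ℝ)|) ↔ _ := hthr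
    have hok : (d.count x).Ok rows := ⟨hd.one_le_r, hd.r_le, hd.R_le, hd.B_lt⟩
    split_ifs with c1 c2 c2
    · exact hok.map_next hr
    · exact absurd (hiff.2 c1) c2
    · exact absurd (hiff.1 c2) c1
    · rw [PMF.pure_map]
  · rw [if_neg hc, if_neg (mt hact.1 hc), PMF.pure_map]

/-! ### The data of HH2 -/

/-- The data stored by HH2. -/
structure StoreData (n rows k : ℕ) where
  S : Fin 8 → Fin (2 ^ k)
  Y : Fin rows → ℤ
  e : ℕ
  prev : CopyData n k
  cur : CopyData n k

/-- The state of HH2 described by the data. -/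
noncomputable def StoreData.toHH2 (F : StoreData n rows k) : HH2State n rows where
  S := fun a => polySign k F.S (entryIndex a)
  Y := F.Y
  next := F.e
  prev := F.prev.toHH1 rows
  cur := F.cur.toHH1 rows

/-- The sum of the squares of the sketch. -/
def StoreData.total (F : StoreData n rows k) : ℕ := ∑ i, (F.Y i).natAbs ^ 2

theorem StoreData.estimate_eq (F : StoreData n rows k) : estimate F.Y = (F.total : ℝ) / rows := by
  rw [estimate, StoreData.total]
  push_cast
  congr 1
  refine Finset.sum_congr rfl fun i _ => ?_
  rw [Nat.cast_natAbs, Int.cast_abs, sq_abs]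

/-- Update of the sketch. -/
def StoreData.track (F : StoreData n rows k) (x : Fin n) : StoreData n rows k :=
  { F with Y := fun i => F.Y i + ((polySign k F.S (entryIndex (i, x)) : ℤˣ) : ℤ) }

/-- One possible restart. -/
noncomputable def StoreData.restart (F : StoreData n rows k) : PMF (StoreData n rows k) :=
  if rows * 2 ^ F.e ≤ F.total then
    (CopyData.start n k rows F.total).map fun c => { F with prev := F.cur, cur := c, e := F.e + 1 }
  else PMF.pure F

/-- HH2 reads the item `x`. At most two restarts are possible at a time. -/
noncomputable def StoreData.step (F : StoreData n rows k) (x : Fin n) :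
    PMF (StoreData n rows k) :=
  (F.track x).restart.bind fun F1 => F1.restart.bind fun F2 =>
    (F2.prev.step rows x).bind fun a => (F2.cur.step rows x).map fun c =>
      { F2 with prev := a, cur := c }

/-- The start of HH2. -/
noncomputable def StoreData.start (n rows k : ℕ) : PMF (StoreData n rows k) :=
  (PMF.uniformOfFintype (Fin 8 → Fin (2 ^ k))).bind fun S =>
    (CopyData.start n k rows rows).map fun c => { S := S, Y := 0, e := 0, prev := c, cur := c }

theorem numCrossings_eq {next c : ℕ} {e : ℝ} (h1 : e < 2 ^ (next + c))
    (h2 : ∀ i < c, (2 : ℝ) ^ (next + i) ≤ e) : numCrossings next e = c := by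
  obtain ⟨h3, h4⟩ := numCrossings_spec next e
  rcases lt_trichotomy (numCrossings next e) c with h | h | h
  · exact absurd (h2 _ h) (not_le.2 h3)
  · exact h
  · exact absurd (h4 _ h) (not_le.2 h1)

theorem le_estimate_iff (hr : 0 < rows) (F : StoreData n rows k) (j : ℕ) :
    (2 : ℝ) ^ j ≤ estimate F.Y ↔ rows * 2 ^ j ≤ F.total := by
  have hr' : (0 : ℝ) < rows := by exact_mod_cast hr
  rw [F.estimate_eq, le_div_iff₀ hr', mul_comm]
  exact_mod_cast Iff.rfl

/-- Below 2^(`F.e` + 2) the estimate can have reached at most two new powers, so two conditional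
restarts in a row perform exactly as many restarts as HH2. -/
theorem StoreData.map_restart (hr : 0 < rows) (F : StoreData n rows (wordBits rows n))
    (hF : F.total < rows * 2 ^ (F.e + 2)) :
    (F.restart.bind fun F1 => F1.restart).map StoreData.toHH2 =
      HH2State.restart (polyFamilies hr n) F.toHH2.crossings F.toHH2 := by
  have hcr : F.toHH2.crossings = numCrossings F.e (estimate F.Y) := rfl
  have hlt : ∀ j, estimate F.Y < 2 ^ j ↔ F.total < rows * 2 ^ j := by
    intro j
    rw [← not_le, le_estimate_iff hr, not_le]
  have hone : ∀ G : StoreData n rows (wordBits rows n), rows * 2 ^ G.e ≤ G.total →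
      ∀ (A : Type) (f : HH2State n rows → PMF A), (G.restart.bind fun F1 => f F1.toHH2) =
        (HH1State.start (polyFamilies hr n) √(estimate G.Y)).bind fun c =>
          f { G.toHH2 with prev := G.toHH2.cur, cur := c, next := G.toHH2.next + 1 } := by
    intro G hG A f
    rw [StoreData.restart, if_pos hG, PMF.bind_map, G.estimate_eq, ← CopyData.map_start hr,
      PMF.bind_map]
    rfl
  have hzero : ∀ G : StoreData n rows (wordBits rows n), G.total < rows * 2 ^ G.e →
      G.restart = PMF.pure G := by
    intro G hG
    rw [StoreData.restart, if_neg (not_le.2 hG)]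
  by_cases h1 : rows * 2 ^ F.e ≤ F.total
  · by_cases h2 : rows * 2 ^ (F.e + 1) ≤ F.total
    · have hc : F.toHH2.crossings = 2 := by
        rw [hcr]
        refine numCrossings_eq ((hlt _).2 hF) fun i hi => ?_
        interval_cases i
        · exact (le_estimate_iff hr F _).2 h1
        · exact (le_estimate_iff hr F _).2 h2
      rw [hc, HH2State.restart, PMF.map_bind]
      rw [StoreData.restart, if_pos h1, PMF.bind_map]
      change ((CopyData.start n (wordBits rows n) rows F.total).bind _) =
        (HH1State.start (polyFamilies hr n) √(estimate F.Y)).bind _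
      rw [F.estimate_eq, ← CopyData.map_start hr, PMF.bind_map]
      congr 1
      funext c
      simp only [Function.comp]
      set G : StoreData n rows (wordBits rows n) :=
        { F with prev := F.cur, cur := c, e := F.e + 1 } with hG
      have := hone G h2 _ fun s => PMF.pure s
      rw [← PMF.bind_pure_comp]
      exact this
    · have hc : F.toHH2.crossings = 1 := by
        rw [hcr]
        refine numCrossings_eq ((hlt _).2 (not_le.1 h2)) fun i hi => ?_
        interval_cases i
        exact (le_estimate_iff hr F _).2 h1
      rw [hc, HH2State.restart, PMF.map_bind]
      rw [StoreData.restart, if_pos h1, PMF.bind_map]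
      change ((CopyData.start n (wordBits rows n) rows F.total).bind _) =
        (HH1State.start (polyFamilies hr n) √(estimate F.Y)).bind _
      rw [F.estimate_eq, ← CopyData.map_start hr, PMF.bind_map]
      congr 1
      funext c
      simp only [Function.comp]
      rw [hzero _ (not_le.1 h2), PMF.pure_map]
      rfl
  · have hc : F.toHH2.crossings = 0 := by
      rw [hcr]
      exact numCrossings_eq ((hlt _).2 (not_le.1 h1)) fun i hi => absurd hi (Nat.not_lt_zero i)
    rw [hc, hzero F (not_le.1 h1), PMF.pure_bind, hzero F (not_le.1 h1), PMF.pure_map]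
    rfl

/-- The simulation identities hold only for data satisfying the invariants; the invariants hold on
the support, and this suffices. -/
theorem bind_congr_support {A B : Type} (D : PMF A) (f g : A → PMF B)
    (h : ∀ a ∈ D.support, f a = g a) : D.bind f = D.bind g := by
  ext b
  rw [PMF.bind_apply, PMF.bind_apply]
  refine tsum_congr fun a => ?_
  by_cases ha : a ∈ D.support
  · rw [h a ha]
  · rw [(D.apply_eq_zero_iff a).2 ha, zero_mul, zero_mul]

/-! ### Invariants of the stored data and the simulation of HH2 -/

/-- Conditions that the data of HH2 satisfy after `t` items. -/
structure StoreData.Ok (t : ℕ) (F : StoreData n rows k) : Prop where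
  prev_ok : F.prev.Ok rows
  cur_ok : F.cur.Ok rows
  total_lt : F.total < rows * 2 ^ F.e
  Y_le : ∀ i, (F.Y i).natAbs ≤ t
  e_le : 2 ^ F.e ≤ 2 * t ^ 2 + 1
  prev_X : F.prev.X0.natAbs ≤ t ∧ F.prev.X1.natAbs ≤ t
  cur_X : F.cur.X0.natAbs ≤ t ∧ F.cur.X1.natAbs ≤ t
  prev_sq : F.prev.sq ≤ rows * (t ^ 2 + 1)
  cur_sq : F.cur.sq ≤ rows * (t ^ 2 + 1)
  prev_R : 2 ^ F.prev.R ≤ (n + 1) ^ 3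
  cur_R : 2 ^ F.cur.R ≤ (n + 1) ^ 3

theorem two_pow_bitCount_le (rows n sq : ℕ) : 2 ^ bitCount rows n sq ≤ (n + 1) ^ 3 := by
  rw [bitCount, mul_comm, pow_mul]
  refine Nat.pow_le_pow_left ?_ 3
  have h := Nat.lt_size.1 (Nat.sub_lt (Nat.size_pos.2 (Nat.succ_pos (min n (sq / rows)))) one_pos)
  simp only [Nat.succ_eq_add_one] at h
  have := min_le_left n (sq / rows)
  omega

theorem units_natAbs (u : ℤˣ) : ((u : ℤˣ) : ℤ).natAbs = 1 := by
  rcases Int.units_eq_one_or u with rfl | rfl <;> rfl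

/-- Each row changes by one, and (y ± 1)² ≤ 2y² + 2. From a total below `rows * 2 ^ e` this leads to
one below `rows * 2 ^ (e + 2)`: at most two powers are crossed by an item. -/
theorem StoreData.total_track_le (F : StoreData n rows k) (x : Fin n) :
    (F.track x).total ≤ 2 * F.total + 2 * rows := by
  unfold StoreData.total
  have : ∀ i, ((F.track x).Y i).natAbs ^ 2 ≤ 2 * (F.Y i).natAbs ^ 2 + 2 := by
    intro i
    have h1 : ((F.track x).Y i).natAbs ≤ (F.Y i).natAbs + 1 := by
      refine (Int.natAbs_add_le _ _).trans ?_
      rw [units_natAbs]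
    have h2 := Nat.pow_le_pow_left h1 2
    zify at h2 ⊢
    nlinarith [sq_nonneg (((F.Y i).natAbs : ℤ) - 1)]
  refine (Finset.sum_le_sum fun i _ => this i).trans ?_
  rw [Finset.sum_add_distrib, ← Finset.mul_sum]
  simp [mul_comm]

theorem StoreData.total_le {F : StoreData n rows k} {t : ℕ} (h : ∀ i, (F.Y i).natAbs ≤ t) :
    F.total ≤ rows * t ^ 2 := by
  refine (Finset.sum_le_sum fun i _ => Nat.pow_le_pow_left (h i) 2).trans ?_
  simp

theorem CopyData.step_bounds (d : CopyData n k) (x : Fin n) {t : ℕ}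
    (hX : d.X0.natAbs ≤ t ∧ d.X1.natAbs ≤ t) : ∀ d' ∈ (d.step rows x).support,
    (d'.X0.natAbs ≤ t + 1 ∧ d'.X1.natAbs ≤ t + 1) ∧ d'.sq = d.sq ∧ d'.R = d.R := by
  intro d' h
  have hb := d.bit_lt_two x
  have hu := units_natAbs (polySign k d.z x)
  have hcnt : (d.count x).X0.natAbs ≤ t + 1 ∧ (d.count x).X1.natAbs ≤ t + 1 := by
    simp only [CopyData.count]
    rcases Nat.lt_succ_iff_lt_or_eq.1 hb with h | h
    · have : d.bit x = 0 := by omega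
      rw [this]
      constructor <;> simp <;> omega
    · rw [h]
      constructor <;> simp <;> omega
  rw [CopyData.step] at h
  split_ifs at h with c1 c2
  · rw [PMF.mem_support_map_iff] at h
    obtain ⟨z, _, rfl⟩ := h
    simp [CopyData.next, CopyData.count]
  · rw [PMF.mem_support_pure_iff] at h
    subst h
    exact ⟨hcnt, rfl, rfl⟩
  · rw [PMF.mem_support_pure_iff] at h
    subst h
    exact ⟨⟨by omega, by omega⟩, rfl, rfl⟩

theorem CopyData.start_spec {sq : ℕ} (hr : 0 < rows) :
    ∀ d ∈ (CopyData.start n (wordBits rows n) rows sq).support,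
      d.Ok rows ∧ d.X0 = 0 ∧ d.X1 = 0 ∧ d.sq = sq ∧ 2 ^ d.R ≤ (n + 1) ^ 3 := by
  intro d hd
  rw [CopyData.start, PMF.mem_support_bind_iff] at hd
  obtain ⟨h, _, hd⟩ := hd
  rw [PMF.mem_support_map_iff] at hd
  obtain ⟨z, _, rfl⟩ := hd
  exact ⟨CopyData.ok_fresh hr sq h z, rfl, rfl, rfl, two_pow_bitCount_le rows n sq⟩

/-- The conditions that hold after the sketch has been updated, if `m` restarts are still
possible. -/
structure StoreData.Mid (t m : ℕ) (F : StoreData n rows k) : Prop where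
  prev_ok : F.prev.Ok rows
  cur_ok : F.cur.Ok rows
  total_lt : F.total < rows * 2 ^ (F.e + m)
  Y_le : ∀ i, (F.Y i).natAbs ≤ t + 1
  e_le : 2 ^ F.e ≤ 2 * (t + 1) ^ 2 + 1
  prev_X : F.prev.X0.natAbs ≤ t ∧ F.prev.X1.natAbs ≤ t
  cur_X : F.cur.X0.natAbs ≤ t ∧ F.cur.X1.natAbs ≤ t
  prev_sq : F.prev.sq ≤ rows * ((t + 1) ^ 2 + 1)
  cur_sq : F.cur.sq ≤ rows * ((t + 1) ^ 2 + 1)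
  prev_R : 2 ^ F.prev.R ≤ (n + 1) ^ 3
  cur_R : 2 ^ F.cur.R ≤ (n + 1) ^ 3

theorem StoreData.Ok.track {F : StoreData n rows k} {t : ℕ} (hF : F.Ok t) (x : Fin n) :
    (F.track x).Mid t 2 := by
  obtain ⟨h1, h2, h3, h4, h5, h6, h7, h8, h9, h10, h11⟩ := hF
  have ht : t ^ 2 ≤ (t + 1) ^ 2 := Nat.pow_le_pow_left (Nat.le_succ t) 2
  have hsq : rows * (t ^ 2 + 1) ≤ rows * ((t + 1) ^ 2 + 1) := Nat.mul_le_mul_left _ (by omega)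
  refine ⟨h1, h2, ?_, fun i => ?_, ?_, h6, h7, h8.trans hsq, h9.trans hsq, h10, h11⟩
  · have := F.total_track_le x
    change _ < rows * 2 ^ (F.e + 2)
    have h12 : rows * 1 ≤ rows * 2 ^ F.e := Nat.mul_le_mul_left _ Nat.one_le_two_pow
    rw [pow_add, ← mul_assoc]
    omega
  · refine (Int.natAbs_add_le _ _).trans ?_
    rw [units_natAbs]
    exact Nat.succ_le_succ (h4 i)
  · change 2 ^ F.e ≤ _
    omega

theorem StoreData.Mid.restart {F : StoreData n rows (wordBits rows n)} {t m : ℕ} (hr : 0 < rows)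
    (hF : F.Mid t (m + 1)) : ∀ F' ∈ F.restart.support, F'.Mid t m := by
  obtain ⟨h1, h2, h3, h4, h5, h6, h7, h8, h9, h10, h11⟩ := hF
  intro F' hF'
  have htot := StoreData.total_le h4
  rw [StoreData.restart] at hF'
  split_ifs at hF' with hc
  · rw [PMF.mem_support_map_iff] at hF'
    obtain ⟨c, hc', rfl⟩ := hF'
    obtain ⟨c1, c2, c3, c4, c5⟩ := CopyData.start_spec hr c hc'
    refine ⟨h2, c1, ?_, h4, ?_, h7, ?_, h9, ?_, h11, c5⟩
    · change F.total < rows * 2 ^ (F.e + 1 + m)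
      rwa [add_assoc, add_comm 1 m]
    · change 2 ^ (F.e + 1) ≤ _
      -- A restart requires that the total has reached `rows * 2 ^ e`, while each row is at most `t
      -- + 1` in absolute value; so 2^`e` ≤ (`t` + 1)² before the exponent increases.
      have := Nat.le_of_mul_le_mul_left (hc.trans htot) hr
      rw [pow_succ]
      omega
    · simp [c2, c3]
    · simp only [c4]
      exact htot.trans (Nat.mul_le_mul_left _ (Nat.le_succ _))
  · rw [PMF.mem_support_pure_iff] at hF'
    subst hF'
    refine ⟨h1, h2, ?_, h4, h5, h6, h7, h8, h9, h10, h11⟩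
    refine (not_le.1 hc).trans_le (Nat.mul_le_mul_left _ ?_)
    exact Nat.pow_le_pow_right (by norm_num) (Nat.le_add_right _ _)

theorem StoreData.Ok.step {F : StoreData n rows (wordBits rows n)} {t : ℕ} (hr : 0 < rows)
    (hF : F.Ok t) (x : Fin n) : ∀ F' ∈ (F.step x).support, F'.Ok (t + 1) := by
  intro F' hF'
  rw [StoreData.step, PMF.mem_support_bind_iff] at hF'
  obtain ⟨F1, m1, hF'⟩ := hF'
  rw [PMF.mem_support_bind_iff] at hF'
  obtain ⟨F2, m2, hF'⟩ := hF'
  rw [PMF.mem_support_bind_iff] at hF'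
  obtain ⟨a, ma, hF'⟩ := hF'
  rw [PMF.mem_support_map_iff] at hF'
  obtain ⟨c, mc, rfl⟩ := hF'
  have hM := ((hF.track x).restart hr F1 m1).restart hr F2 m2
  obtain ⟨h1, h2, h3, h4, h5, h6, h7, h8, h9, h10, h11⟩ := hM
  obtain ⟨a1, a2, a3⟩ := F2.prev.step_bounds x h6 a ma
  obtain ⟨c1, c2, c3⟩ := F2.cur.step_bounds x h7 c mc
  exact ⟨h1.step x a ma, h2.step x c mc, h3, h4, h5, a1, c1, by simpa [a2] using h8,
    by simpa [c2] using h9, by simpa [a3] using h10, by simpa [c3] using h11⟩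

theorem StoreData.ok_start (hr : 0 < rows) :
    ∀ F ∈ (StoreData.start n rows (wordBits rows n)).support, F.Ok 0 := by
  intro F hF
  rw [StoreData.start, PMF.mem_support_bind_iff] at hF
  obtain ⟨S, _, hF⟩ := hF
  rw [PMF.mem_support_map_iff] at hF
  obtain ⟨c, hc, rfl⟩ := hF
  obtain ⟨c1, c2, c3, c4, c5⟩ := CopyData.start_spec hr c hc
  exact ⟨c1, c1, by simpa [StoreData.total] using hr, by simp, by simp, by simp [c2, c3],
    by simp [c2, c3], by simp [c4], by simp [c4], c5, c5⟩

theorem StoreData.Ok.map_step {F : StoreData n rows (wordBits rows n)} {t : ℕ} (hr : 0 < rows)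
    (hF : F.Ok t) (x : Fin n) :
    (F.step x).map StoreData.toHH2 = F.toHH2.step (polyFamilies hr n) x := by
  have hM := hF.track x
  have htr : (F.track x).toHH2 = F.toHH2.track x := rfl
  rw [HH2State.step, ← htr, ← StoreData.map_restart hr _ hM.total_lt, PMF.bind_map,
    PMF.bind_bind, StoreData.step, PMF.map_bind]
  refine bind_congr_support _ _ _ fun F1 m1 => ?_
  rw [PMF.map_bind]
  refine bind_congr_support _ _ _ fun F2 m2 => ?_
  have hM2 := (hM.restart hr F1 m1).restart hr F2 m2
  simp only [Function.comp]
  change _ = (HH1State.step (polyFamilies hr n) (F2.prev.toHH1 rows) x).bind fun a =>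
    (HH1State.step (polyFamilies hr n) (F2.cur.toHH1 rows) x).map _
  rw [← hM2.prev_ok.map_step hr x, ← hM2.cur_ok.map_step hr x, PMF.bind_map, PMF.map_bind]
  congr 1
  funext a
  simp only [Function.comp, PMF.map_comp]
  rfl

theorem StoreData.map_start (hr : 0 < rows) :
    (StoreData.start n rows (wordBits rows n)).map StoreData.toHH2 =
      HH2State.start (polyFamilies hr n) := by
  have h1 : √((rows : ℝ) / rows) = 1 := by
    rw [div_self (by exact_mod_cast hr.ne'), Real.sqrt_one]
  have h2 : (polyFamilies hr n).sketch = (PMF.uniformOfFintype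
      (Fin 8 → Fin (2 ^ wordBits rows n))).map fun c a =>
        polySign (wordBits rows n) c (entryIndex a) := rfl
  rw [HH2State.start, h2, PMF.bind_map, StoreData.start, PMF.map_bind]
  congr 1
  funext S
  rw [Function.comp, ← h1, ← CopyData.map_start hr, PMF.map_comp, PMF.map_comp]
  rfl

/-- The random data after one pass over the stream. -/
noncomputable def StoreData.run (n rows k : ℕ) (p : List (Fin n)) : PMF (StoreData n rows k) :=
  p.foldl (fun D x => D.bind fun F => F.step x) (StoreData.start n rows k)

theorem StoreData.run_append (p : List (Fin n)) (x : Fin n) :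
    StoreData.run n rows k (p ++ [x]) = (StoreData.run n rows k p).bind fun F => F.step x := by
  simp [StoreData.run]

theorem StoreData.run_ok (hr : 0 < rows) (p : List (Fin n)) :
    ∀ F ∈ (StoreData.run n rows (wordBits rows n) p).support, F.Ok p.length := by
  induction p using List.reverseRecOn with
  | nil => exact StoreData.ok_start hr
  | append_singleton p x ih =>
    intro F hF
    rw [StoreData.run_append, PMF.mem_support_bind_iff] at hF
    obtain ⟨F0, h0, hF⟩ := hF
    rw [List.length_append]
    exact (ih F0 h0).step hr x F hF

theorem StoreData.map_run (hr : 0 < rows) (p : List (Fin n)) :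
    (StoreData.run n rows (wordBits rows n) p).map StoreData.toHH2 =
      HH2State.run (polyFamilies hr n) p := by
  induction p using List.reverseRecOn with
  | nil => exact StoreData.map_start hr
  | append_singleton p x ih =>
    have h : HH2State.run (polyFamilies hr n) (p ++ [x]) =
        (HH2State.run (polyFamilies hr n) p).bind fun s => s.step (polyFamilies hr n) x := by
      simp [HH2State.run]
    rw [h, ← ih, StoreData.run_append, PMF.map_bind, PMF.bind_map]
    exact bind_congr_support _ _ _ fun F hF => (StoreData.run_ok hr p F hF).map_step hr x

end Data
end BPTree
namespace BPTree

/-! ### The program for HH2 -/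

/-- The variables that describe a copy of HH1. -/
inductive Slot
  | sq | R | D | B | X0 | X1 | r | p9 | p16 | H
  | h (i : Fin 2)
  | z (i : Fin 4)
  deriving DecidableEq, Fintype

/-- The variables of the program; the older copy of HH1 is stored in `cp false`, the newer one in
`cp true`. -/
inductive Cell (rows : ℕ)
  | inp | n | Q | e | np
  | Y (i : Fin rows)
  | S (i : Fin 8)
  | cp (c : Bool) (f : Slot)
  deriving DecidableEq, Fintype

section Program

variable {n k rows : ℕ}

/-- The values of the variables of a copy. -/
def CopyData.enc (d : CopyData n k) : Slot → ℤ
  | .sq => d.sq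
  | .R => d.R
  | .D => 2 ^ (k + 1 - d.r)
  | .B => d.B
  | .X0 => d.X0
  | .X1 => d.X1
  | .r => d.r
  | .p9 => 9 ^ d.r
  | .p16 => 16 ^ d.r
  | .H => encode d.H
  | .h i => (d.h i : ℕ)
  | .z i => (d.z i : ℕ)

/-- The values of all variables, the last input being `x`. -/
def StoreData.enc (x : ℤ) (F : StoreData n rows k) : Cell rows → ℤ
  | .inp => x
  | .n => n
  | .Q => 2 ^ k
  | .e => F.e
  | .np => 2 ^ F.e
  | .Y i => F.Y i
  | .S i => (F.S i : ℕ)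
  | .cp false f => F.prev.enc f
  | .cp true f => F.cur.enc f

/-- Replace the values of the variables of one copy. -/
def setCopy (ν : Cell rows → ℤ) (c : Bool) (K : Slot → ℤ) : Cell rows → ℤ
  | .cp c' f => if c' = c then K f else ν (.cp c' f)
  | v => ν v

@[simp] theorem setCopy_cp (ν : Cell rows → ℤ) (c : Bool) (K : Slot → ℤ) (f : Slot) :
    setCopy ν c K (.cp c f) = K f := if_pos rfl
@[simp] theorem setCopy_inp (ν : Cell rows → ℤ) (c : Bool) (K : Slot → ℤ) :
    setCopy ν c K .inp = ν .inp := rfl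
@[simp] theorem setCopy_n (ν : Cell rows → ℤ) (c : Bool) (K : Slot → ℤ) :
    setCopy ν c K .n = ν .n := rfl
@[simp] theorem setCopy_Q (ν : Cell rows → ℤ) (c : Bool) (K : Slot → ℤ) :
    setCopy ν c K .Q = ν .Q := rfl

@[simp] theorem update_setCopy (ν : Cell rows → ℤ) (c : Bool) (K : Slot → ℤ) (f : Slot) (a : ℤ) :
    Function.update (setCopy ν c K) (.cp c f) a = setCopy ν c (Function.update K f a) := by
  funext v
  rcases v with _ | _ | _ | _ | _ | i | i | ⟨c', g⟩ <;> simp [Function.update_apply, setCopy]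
  split_ifs <;> simp_all

theorem setCopy_prev (x : ℤ) (F : StoreData n rows k) (d : CopyData n k) :
    setCopy (F.enc x) false d.enc = StoreData.enc x { F with prev := d } := by
  funext v
  rcases v with _ | _ | _ | _ | _ | i | i | ⟨_ | _, g⟩ <;> rfl

theorem setCopy_cur (x : ℤ) (F : StoreData n rows k) (d : CopyData n k) :
    setCopy (F.enc x) true d.enc = StoreData.enc x { F with cur := d } := by
  funext v
  rcases v with _ | _ | _ | _ | _ | i | i | ⟨_ | _, g⟩ <;> rfl

theorem setCopy_self (ν : Cell rows → ℤ) (c : Bool) :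
    setCopy ν c (fun f => ν (.cp c f)) = ν := by
  funext v
  rcases v with _ | _ | _ | _ | _ | i | i | ⟨c', g⟩ <;> simp [setCopy]
  rintro rfl
  rfl

/-! #### Random words -/

/-- Random words for all the variables of a list. -/
def draw (rows : ℕ) (l : List (Cell rows)) : HCode (Cell rows) :=
  l.foldr (fun v P => .seq (.rand v 8 (.lit rows * .var .n + .lit rows)) P) .skip

theorem uniform_pi_succ (A : Type) [Fintype A] [Nonempty A] (d : ℕ) :
    PMF.uniformOfFintype (Fin (d + 1) → A) = (PMF.uniformOfFintype A).bind fun a =>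
      (PMF.uniformOfFintype (Fin d → A)).map fun g => (Fin.cons a g : Fin (d + 1) → A) := by
  classical
  ext c
  rw [PMF.bind_apply, tsum_fintype, Finset.sum_eq_single (c 0)]
  · rw [PMF.map_apply, tsum_fintype, Finset.sum_eq_single (Fin.tail c)]
    · rw [if_pos (Fin.cons_self_tail c).symm]
      simp only [PMF.uniformOfFintype_apply, Fintype.card_pi, Finset.prod_const, Finset.card_univ,
        Fintype.card_fin, pow_succ, Nat.cast_mul]
      rw [mul_comm, ENNReal.mul_inv]
      · exact Or.inr (ENNReal.natCast_ne_top _)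
      · exact Or.inl (ENNReal.natCast_ne_top _)
    · intro g _ hg
      refine if_neg fun h => hg ?_
      rw [h, Fin.tail_cons]
    · simp
  · intro a _ ha
    rw [PMF.map_apply, tsum_fintype, Finset.sum_eq_zero, mul_zero]
    intro g _
    refine if_neg fun h => ha ?_
    rw [h, Fin.cons_zero]
  · simp

theorem uniform_pi_zero (A : Type) [Fintype A] [Nonempty A] (c : Fin 0 → A) :
    PMF.uniformOfFintype (Fin 0 → A) = PMF.pure c := by
  ext b
  simp [PMF.uniformOfFintype_apply, Subsingleton.elim b c]

theorem HCode.sem_rand {V : Type} [DecidableEq V] (d : V) (m : ℕ) (e : Expr V) (ν : V → ℤ) {j : ℕ}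
    (hj : m * (e.eval ν).natAbs.size = j) : (HCode.rand d m e).sem ν =
      (PMF.uniformOfFintype (Fin (2 ^ j))).map fun v : Fin (2 ^ j) =>
        Function.update ν d ((v : ℕ) : ℤ) := by
  subst hj
  rfl

theorem HCode.sem_ite_pos {V : Type} [DecidableEq V] {a b : Expr V} {P Q : HCode V} {ν : V → ℤ}
    (h : a.eval ν ≤ b.eval ν) : (HCode.ite a b P Q).sem ν = P.sem ν := if_pos h

theorem HCode.sem_ite_neg {V : Type} [DecidableEq V] {a b : Expr V} {P Q : HCode V} {ν : V → ℤ}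
    (h : ¬ a.eval ν ≤ b.eval ν) : (HCode.ite a b P Q).sem ν = Q.sem ν := if_neg h

/-- A uniform vector is drawn one coordinate at a time. The cell `n` must not be among the targets,
since the number of bits is computed from it anew for every word. -/
theorem draw_sem {d : ℕ} (f : Fin d → Cell rows) (hf : Function.Injective f)
    (hn : ∀ i, f i ≠ .n) (ν : Cell rows → ℤ) (hν : ν .n = n) :
    (draw rows (List.ofFn f)).sem ν =
      (PMF.uniformOfFintype (Fin d → Fin (2 ^ wordBits rows n))).map fun g =>
        Function.extend f (fun i => ((g i : ℕ) : ℤ)) ν := by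
  induction d generalizing ν with
  | zero =>
    rw [uniform_pi_zero _ finZeroElim, PMF.pure_map]
    simp only [List.ofFn_zero, draw, List.foldr_nil, HCode.sem]
    congr 1
    funext v
    rw [Function.extend_apply' _ _ _ (fun ⟨i, _⟩ => i.elim0)]
  | succ d ih =>
    have hbits : 8 * ((Expr.lit (rows : ℤ) * Expr.var .n + Expr.lit (rows : ℤ) :
        Expr (Cell rows)).eval ν).natAbs.size = wordBits rows n := by
      simp only [Expr.eval_add, Expr.eval_mul, Expr.eval_lit, Expr.eval_var, hν]
      rw [← Nat.cast_mul, ← Nat.cast_add, Int.natAbs_natCast]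
      rfl
    have hcons : draw rows (List.ofFn f) = .seq (.rand (f 0) 8
        (.lit rows * .var .n + .lit rows)) (draw rows (List.ofFn fun i => f i.succ)) := by
      rw [List.ofFn_succ]
      rfl
    rw [hcons, HCode.sem, HCode.sem_rand _ _ _ _ hbits, PMF.bind_map, uniform_pi_succ,
      PMF.map_bind]
    congr 1
    funext a
    rw [Function.comp, ih (fun i => f i.succ) (fun i j h => Fin.succ_injective _ (hf h))
      (fun i => hn _) _ (by rw [Function.update_of_ne (hn 0).symm, hν]), PMF.map_comp]
    congr 1
    funext g v
    simp only [Function.comp]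
    have hf' : Function.Injective fun i : Fin d => f i.succ :=
      fun i j h => Fin.succ_injective _ (hf h)
    by_cases hv : ∃ i, f i = v
    · obtain ⟨i, rfl⟩ := hv
      rw [hf.extend_apply]
      refine Fin.cases ?_ (fun j => ?_) i
      · rw [Function.extend_apply' _ _ _ (fun ⟨j, hj⟩ => Fin.succ_ne_zero j (hf hj)),
          Function.update_self, Fin.cons_zero]
      · rw [Fin.cons_succ]
        exact hf'.extend_apply _ _ j
    · rw [Function.extend_apply' _ _ _ hv, Function.extend_apply' _ _ _
        (fun ⟨i, hi⟩ => hv ⟨_, hi⟩), Function.update_of_ne (fun h => hv ⟨0, h.symm⟩)]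

theorem extend_setCopy {d : ℕ} (f : Fin d → Slot) (hf : Function.Injective f) (c : Bool)
    (g : Fin d → ℤ) (ν : Cell rows → ℤ) (K : Slot → ℤ) :
    Function.extend (fun i => Cell.cp c (f i)) g (setCopy ν c K) =
      setCopy ν c (Function.extend f g K) := by
  have hf' : Function.Injective fun i => (Cell.cp c (f i) : Cell rows) :=
    fun i j h => hf (Cell.cp.inj h).2
  funext v
  by_cases hv : ∃ i, Cell.cp c (f i) = v
  · obtain ⟨i, rfl⟩ := hv
    rw [setCopy_cp, hf.extend_apply]
    exact hf'.extend_apply _ _ i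
  · rw [Function.extend_apply' _ _ _ hv]
    rcases v with _ | _ | _ | _ | _ | i | i | ⟨c', s⟩
    all_goals try rfl
    simp only [setCopy]
    split_ifs with hc
    · subst hc
      rw [Function.extend_apply' _ _ _ (fun ⟨i, hi⟩ => hv ⟨i, by rw [hi]⟩)]
    · rfl

theorem draw_setCopy {d : ℕ} (f : Fin d → Slot) (hf : Function.Injective f) (c : Bool)
    (ν : Cell rows → ℤ) (hν : ν .n = n) (K : Slot → ℤ) :
    (draw rows (List.ofFn fun i => .cp c (f i))).sem (setCopy ν c K) =
      (PMF.uniformOfFintype (Fin d → Fin (2 ^ wordBits rows n))).map fun g =>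
        setCopy ν c (Function.extend f (fun i => ((g i : ℕ) : ℤ)) K) := by
  rw [draw_sem (n := n) (fun i => .cp c (f i)) (fun i j h => hf (Cell.cp.inj h).2)
    (fun i => by simp) (setCopy ν c K) hν]
  simp only [extend_setCopy f hf]

/-! #### Polynomials -/

/-- The value of the polynomial whose coefficients are the values of a list of variables. -/
def horner (pt : Expr (Cell rows)) : List (Cell rows) → Expr (Cell rows)
  | [] => .lit 0
  | v :: l => .var v + pt * horner pt l

/-- The value of a polynomial modulo the number in `Q`. -/
def polyE {d : ℕ} (f : Fin d → Cell rows) (pt : Expr (Cell rows)) : Expr (Cell rows) :=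
  horner pt (List.ofFn f) % .var .Q

/-- The sign given by the value of a polynomial. -/
def signE {d : ℕ} (f : Fin d → Cell rows) (pt : Expr (Cell rows)) : Expr (Cell rows) :=
  .lit 1 - .lit 2 * (polyE f pt / (.var .Q / .lit 2))

theorem eval_horner (ν : Cell rows → ℤ) {d : ℕ} (f : Fin d → Cell rows) (pt : Expr (Cell rows)) :
    (horner pt (List.ofFn f)).eval ν = ∑ i, ν (f i) * pt.eval ν ^ (i : ℕ) := by
  induction d with
  | zero => simp [horner]
  | succ d ih =>
    rw [List.ofFn_succ, Fin.sum_univ_succ]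
    simp only [horner, Expr.eval_add, Expr.eval_mul, Expr.eval_var, ih, Fin.val_zero, pow_zero,
      mul_one, Fin.val_succ, Finset.mul_sum]
    congr 1
    refine Finset.sum_congr rfl fun i _ => ?_
    ring

theorem eval_polyE {ν : Cell rows → ℤ} {d : ℕ} {f : Fin d → Cell rows} {c : Fin d → Fin (2 ^ k)}
    (hf : ∀ i, ν (f i) = (c i : ℕ)) (hQ : ν .Q = 2 ^ k) {pt : Expr (Cell rows)} {a : ℕ}
    (ha : pt.eval ν = a) : (polyE f pt).eval ν = polyVal k c a := by
  simp only [polyE, Expr.eval_mod, eval_horner, Expr.eval_var, hf, hQ, ha, polyVal]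
  push_cast
  rfl

theorem eval_signE {ν : Cell rows → ℤ} {d : ℕ} {f : Fin d → Cell rows} {c : Fin d → Fin (2 ^ k)}
    (hk : 0 < k) (hf : ∀ i, ν (f i) = (c i : ℕ)) (hQ : ν .Q = 2 ^ k) {pt : Expr (Cell rows)}
    {a : ℕ} (ha : pt.eval ν = a) : (signE f pt).eval ν = ((polySign k c a : ℤˣ) : ℤ) := by
  have h2 : (2 : ℤ) ^ k / 2 = ((2 ^ (k - 1) : ℕ) : ℤ) := by
    obtain ⟨j, rfl⟩ : ∃ j, k = j + 1 := ⟨k - 1, by omega⟩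
    rw [pow_succ, Int.mul_ediv_cancel _ (by norm_num)]
    simp
  have hlt : polyVal k c a / 2 ^ (k - 1) < 2 := by
    rw [Nat.div_lt_iff_lt_mul (by positivity), ← pow_succ', Nat.sub_add_cancel hk]
    exact polyVal_lt k c a
  simp only [signE, Expr.eval_sub, Expr.eval_mul, Expr.eval_div, Expr.eval_lit, eval_polyE hf hQ ha,
    Expr.eval_var, hQ, h2]
  rw [← Int.natCast_div, polySign, Nat.testBit_eq_decide_div_mod_eq, Nat.mod_eq_of_lt hlt]
  rcases Nat.lt_succ_iff_lt_or_eq.1 hlt with h | h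
  · rw [Nat.lt_one_iff.1 h]
    rfl
  · rw [h]
    rfl

/-! #### One step of HH1 -/

/-- The label of the current item. -/
def labelE (rows : ℕ) (c : Bool) : Expr (Cell rows) := polyE (fun i => .cp c (.h i)) (.var .inp)

/-- The bit of the label that matters in the current round. -/
def bitE (rows : ℕ) (c : Bool) : Expr (Cell rows) :=
  labelE rows c / (.var (.cp c .D) / .lit 2) % .lit 2

/-- The sign of the current item. -/
def itemSignE (rows : ℕ) (c : Bool) : Expr (Cell rows) :=
  signE (fun i => .cp c (.z i)) (.var .inp)

/-- Count the current item. -/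
def countCode (rows : ℕ) (c : Bool) : HCode (Cell rows) :=
  .seq (.assign (.cp c .H) (.var .inp)) <|
  .seq (.assign (.cp c .X0) (.var (.cp c .X0) + (.lit 1 - bitE rows c) * itemSignE rows c))
    (.assign (.cp c .X1) (.var (.cp c .X1) + bitE rows c * itemSignE rows c))

/-- The end of a round. -/
def roundCode (rows : ℕ) (c : Bool) : HCode (Cell rows) :=
  .seq (.ite (.var (.cp c .X1) * .var (.cp c .X1)) (.var (.cp c .X0) * .var (.cp c .X0))
    (.assign (.cp c .B) (.lit 2 * .var (.cp c .B)))
    (.assign (.cp c .B) (.lit 2 * .var (.cp c .B) + .lit 1))) <|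
  .seq (.assign (.cp c .D) (.var (.cp c .D) / .lit 2)) <|
  .seq (.assign (.cp c .p9) (.var (.cp c .p9) * .lit 9)) <|
  .seq (.assign (.cp c .p16) (.var (.cp c .p16) * .lit 16)) <|
  .seq (.assign (.cp c .r) (.var (.cp c .r) + .lit 1)) <|
  .seq (.assign (.cp c .X0) (.lit 0)) <|
  .seq (.assign (.cp c .X1) (.lit 0)) (draw rows (List.ofFn fun i => .cp c (.z i)))

/-- HH1 reads the current item. -/
def copyCode (rows : ℕ) (c : Bool) : HCode (Cell rows) :=
  .ite (.var (.cp c .r) + .lit 1) (.var (.cp c .R))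
    (.ite (labelE rows c / .var (.cp c .D)) (.var (.cp c .B))
      (.ite (.var (.cp c .B)) (labelE rows c / .var (.cp c .D))
        (.seq (countCode rows c)
          (.ite (.var (.cp c .sq) * .var (.cp c .p9))
            (.lit 1024 * .lit rows * .var (.cp c .p16) *
              ((.var (.cp c .X0) + .var (.cp c .X1)) * (.var (.cp c .X0) + .var (.cp c .X1))))
            (roundCode rows c) .skip)) .skip) .skip) .skip

theorem eval_bitE {ν : Cell rows → ℤ} {c : Bool} {d : CopyData n k} {x : Fin n}
    (hx : ν .inp = (x : ℕ)) (hQ : ν .Q = 2 ^ k) (hr : d.r ≤ k)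
    (hh : ∀ i, ν (.cp c (.h i)) = (d.h i : ℕ)) (hD : ν (.cp c .D) = 2 ^ (k + 1 - d.r)) :
    (bitE rows c).eval ν = d.bit x := by
  have h2 : (2 : ℤ) ^ (k + 1 - d.r) / 2 = 2 ^ (k - d.r) := by
    rw [show k + 1 - d.r = k - d.r + 1 by omega, pow_succ, Int.mul_ediv_cancel _ (by norm_num)]
  simp only [bitE, labelE, Expr.eval_mod, Expr.eval_div, Expr.eval_lit, Expr.eval_var, hD, h2,
    eval_polyE hh hQ (show (Expr.var Cell.inp).eval ν = ((x : ℕ) : ℤ) from hx), CopyData.bit]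
  push_cast
  rfl

theorem countCode_sem {ν : Cell rows → ℤ} {c : Bool} {d : CopyData n k} {x : Fin n} (hk : 0 < k)
    (hx : ν .inp = (x : ℕ)) (hQ : ν .Q = 2 ^ k) (hr : d.r ≤ k) :
    (countCode rows c).sem (setCopy ν c d.enc) = PMF.pure (setCopy ν c (d.count x).enc) := by
  have hb : ∀ K : Slot → ℤ, (∀ i, K (.h i) = (d.h i : ℕ)) → K .D = 2 ^ (k + 1 - d.r) →
      (bitE rows c).eval (setCopy ν c K) = d.bit x := fun K h1 h2 =>
    eval_bitE hx hQ hr (by simpa using h1) (by simpa using h2)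
  have hs : ∀ K : Slot → ℤ, (∀ i, K (.z i) = (d.z i : ℕ)) →
      (itemSignE rows c).eval (setCopy ν c K) = ((polySign k d.z x : ℤˣ) : ℤ) := by
    intro K h1
    rw [itemSignE]
    exact eval_signE (f := fun i => Cell.cp c (.z i)) (c := d.z) (pt := .var .inp) (a := x)
      (ν := setCopy ν c K) hk (by simpa using h1) hQ hx
  have e1 : (HCode.assign (.cp c .H) (.var .inp) : HCode (Cell rows)).sem (setCopy ν c d.enc) =
      PMF.pure (setCopy ν c (Function.update d.enc .H (x : ℕ))) := by
    rw [HCode.sem, update_setCopy, Expr.eval_var, setCopy_inp, hx]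
  have e2 : ∀ (f : Slot) (E : Expr (Cell rows)) (K : Slot → ℤ),
      (HCode.assign (.cp c f) (.var (.cp c f) + E)).sem (setCopy ν c K) =
      PMF.pure (setCopy ν c (Function.update K f (K f + E.eval (setCopy ν c K)))) := by
    intro f E K
    rw [HCode.sem, update_setCopy, Expr.eval_add, Expr.eval_var, setCopy_cp]
  rw [countCode, HCode.sem, e1, PMF.pure_bind, HCode.sem, e2, PMF.pure_bind, e2]
  simp only [Expr.eval_mul, Expr.eval_sub, Expr.eval_lit]
  rw [hb _ (fun i => by simp [CopyData.enc]) (by simp [CopyData.enc]),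
    hs _ (fun i => by simp [CopyData.enc]), hb _ (fun i => by simp [CopyData.enc])
    (by simp [CopyData.enc]), hs _ (fun i => by simp [CopyData.enc])]
  congr 2
  funext f
  cases f <;> simp [CopyData.enc, CopyData.count, encode]

theorem z_injective : Function.Injective Slot.z := fun _ _ h => Slot.z.inj h
theorem h_injective : Function.Injective Slot.h := fun _ _ h => Slot.h.inj h

theorem roundCode_sem {ν : Cell rows → ℤ} {c : Bool} {d : CopyData n (wordBits rows n)}
    (hn : ν .n = n) (hr : d.r ≤ wordBits rows n) :
    (roundCode rows c).sem (setCopy ν c d.enc) =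
      (PMF.uniformOfFintype (Fin 4 → Fin (2 ^ wordBits rows n))).map fun z =>
        setCopy ν c (d.next z).enc := by
  have h2 : (2 : ℤ) ^ (wordBits rows n + 1 - d.r) / 2 = 2 ^ (wordBits rows n - d.r) := by
    rw [show wordBits rows n + 1 - d.r = wordBits rows n - d.r + 1 by omega, pow_succ,
      Int.mul_ediv_cancel _ (by norm_num)]
  have hB : (HCode.ite (.var (.cp c .X1) * .var (.cp c .X1))
      (.var (.cp c .X0) * .var (.cp c .X0))
      (.assign (.cp c .B) (.lit 2 * .var (.cp c .B)))
      (.assign (.cp c .B) (.lit 2 * .var (.cp c .B) + .lit 1)) : HCode (Cell rows)).sem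
        (setCopy ν c d.enc) = PMF.pure (setCopy ν c (Function.update d.enc .B
          ((2 * d.B + roundBit d.X0 d.X1 : ℕ) : ℤ))) := by
    by_cases h : d.X1 * d.X1 ≤ d.X0 * d.X0
    · rw [HCode.sem_ite_pos (by simpa [CopyData.enc] using h), HCode.sem, update_setCopy, roundBit,
        if_pos h]
      simp [CopyData.enc]
    · rw [HCode.sem_ite_neg (by simpa [CopyData.enc] using h), HCode.sem, update_setCopy, roundBit,
        if_neg h]
      simp [CopyData.enc]
  rw [roundCode, HCode.sem, hB, PMF.pure_bind]
  simp only [HCode.sem, PMF.pure_bind, update_setCopy, Expr.eval_var, Expr.eval_add,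
    Expr.eval_mul, Expr.eval_div, Expr.eval_lit, setCopy_cp]
  rw [draw_setCopy (n := n) _ z_injective _ _ hn]
  congr 1
  funext z
  congr 1
  funext f
  rcases f with _ | _ | _ | _ | _ | _ | _ | _ | _ | _ | i | i
  case z => exact z_injective.extend_apply _ _ i
  all_goals
    rw [Function.extend_apply' _ _ _ (by simp)]
    simp [CopyData.enc, CopyData.next, pow_succ, h2]

theorem copyCode_sem {ν : Cell rows → ℤ} {c : Bool} {d : CopyData n (wordBits rows n)} {x : Fin n}
    (hrows : 0 < rows) (hd : d.Ok rows) (hx : ν .inp = (x : ℕ)) (hn : ν .n = n)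
    (hQ : ν .Q = 2 ^ wordBits rows n) :
    (copyCode rows c).sem (setCopy ν c d.enc) =
      (d.step rows x).map fun d' => setCopy ν c d'.enc := by
  obtain ⟨h1, h2, h3, h4⟩ := hd
  have hw := wordLen_pos hrows n
  have hr : d.r ≤ wordBits rows n := by omega
  have hk : 0 < wordBits rows n := by omega
  have hl : (labelE rows c / .var (.cp c .D)).eval (setCopy ν c d.enc) =
      ((polyVal (wordBits rows n) d.h x / 2 ^ (wordBits rows n + 1 - d.r) : ℕ) : ℤ) := by
    simp only [Expr.eval_div, Expr.eval_var, setCopy_cp, labelE]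
    rw [eval_polyE (c := d.h) (a := x) (fun i => setCopy_cp ν c d.enc (.h i)) hQ (show (Expr.var Cell.inp).eval _ = ((x : ℕ) : ℤ) from hx)]
    simp only [CopyData.enc]
    push_cast
    rfl
  have hB : (Expr.var (Cell.cp c .B)).eval (setCopy ν c d.enc) = ((d.B : ℕ) : ℤ) := by
    simp [CopyData.enc]
  have hc1 : (Expr.var (Cell.cp c .r) + .lit 1 : Expr (Cell rows)).eval (setCopy ν c d.enc) ≤
      (Expr.var (Cell.cp c .R)).eval (setCopy ν c d.enc) ↔ d.r < d.R := by
    simp only [Expr.eval_add, Expr.eval_var, Expr.eval_lit, setCopy_cp, CopyData.enc]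
    norm_cast
  rw [copyCode, CopyData.step]
  by_cases c1 : d.r < d.R
  · rw [HCode.sem_ite_pos (hc1.2 c1)]
    by_cases c2 : d.Agrees x
    -- The only test available is `≤`, so equality of the label prefix with the recorded bits is
    -- tested by the two inequalities.
    · rw [HCode.sem_ite_pos (by rw [hl, hB]; exact_mod_cast c2.le),
        HCode.sem_ite_pos (by rw [hl, hB]; exact_mod_cast c2.ge), if_pos ⟨c1, c2⟩,
        HCode.sem, countCode_sem hk hx hQ hr, PMF.pure_bind]
      have hsplit : ((Expr.var (Cell.cp c .sq) * Expr.var (Cell.cp c .p9) : Expr (Cell rows)).eval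
            (setCopy ν c (d.count x).enc) ≤
          ((Expr.lit 1024 : Expr (Cell rows)) * Expr.lit rows * Expr.var (Cell.cp c .p16) *
              ((Expr.var (Cell.cp c .X0) + Expr.var (Cell.cp c .X1)) *
                (Expr.var (Cell.cp c .X0) + Expr.var (Cell.cp c .X1)))).eval
            (setCopy ν c (d.count x).enc)) ↔
          (d.sq : ℤ) * 9 ^ d.r ≤ 1024 * rows * 16 ^ d.r *
            (((d.count x).X0 + (d.count x).X1) * ((d.count x).X0 + (d.count x).X1)) := by
        simp only [Expr.eval_mul, Expr.eval_add, Expr.eval_var, Expr.eval_lit, setCopy_cp]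
        exact Iff.rfl
      by_cases c3 : (d.sq : ℤ) * 9 ^ d.r ≤ 1024 * rows * 16 ^ d.r *
            (((d.count x).X0 + (d.count x).X1) * ((d.count x).X0 + (d.count x).X1))
      · rw [HCode.sem_ite_pos (hsplit.2 c3), if_pos c3, roundCode_sem (d := d.count x) hn hr, PMF.map_comp]
        rfl
      · rw [HCode.sem_ite_neg (mt hsplit.1 c3), if_neg c3, PMF.pure_map]
        rfl
    · rw [if_neg (fun h => c2 h.2), PMF.pure_map]
      by_cases c3 : polyVal (wordBits rows n) d.h x / 2 ^ (wordBits rows n + 1 - d.r) ≤ d.B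
      · rw [HCode.sem_ite_pos (by rw [hl, hB]; exact_mod_cast c3), HCode.sem_ite_neg
          (by rw [hl, hB]; exact fun h => c2 (le_antisymm c3 (by exact_mod_cast h)))]
        rfl
      · rw [HCode.sem_ite_neg (by rw [hl, hB]; exact_mod_cast c3)]
        rfl
  · rw [HCode.sem_ite_neg (mt hc1.1 c1), if_neg (fun h => c1 h.1), PMF.pure_map]
    rfl

end Program
end BPTree
namespace BPTree

section Program

variable {n k rows : ℕ}

/-! #### Starting a copy -/

/-- Overwrite the older copy by the newer one. -/
def saveCode (rows : ℕ) (l : List Slot) : HCode (Cell rows) :=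
  l.foldr (fun f P => .seq (.assign (.cp false f) (.var (.cp true f))) P) .skip

theorem saveCode_sem (l : List Slot) (ν : Cell rows → ℤ) :
    (saveCode rows l).sem ν = PMF.pure (setCopy ν false fun f =>
      if f ∈ l then ν (.cp true f) else ν (.cp false f)) := by
  induction l generalizing ν with
  | nil =>
    simp only [List.not_mem_nil, if_false, setCopy_self]
    rfl
  | cons f l ih =>
    have hcons : saveCode rows (f :: l) =
        .seq (.assign (.cp false f) (.var (.cp true f))) (saveCode rows l) := rfl
    rw [hcons, HCode.sem, HCode.sem, PMF.pure_bind, ih]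
    congr 1
    funext v
    rcases v with _ | _ | _ | _ | _ | i | i | ⟨_ | _, g⟩
    case cp.false =>
      by_cases h1 : g = f
      · subst h1
        simp [setCopy]
      · simp [setCopy, h1]
    all_goals simp [setCopy]

theorem saveCode_all_sem (ν : Cell rows → ℤ) :
    (saveCode rows Finset.univ.toList).sem ν =
      PMF.pure (setCopy ν false fun f => ν (.cp true f)) := by
  simp [saveCode_sem]

/-- Start a new copy for the value `E` of `rows` times the squared guess. -/
def startCode (rows : ℕ) (E : Expr (Cell rows)) : HCode (Cell rows) :=
  .seq (.assign (.cp true .sq) E) <|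
  .seq (.ite (.var .n) (.var (.cp true .sq) / .lit rows)
    (.assign (.cp true .R) (.lit 3 * (.len (.var .n + .lit 1) - .lit 1)))
    (.assign (.cp true .R)
      (.lit 3 * (.len (.var (.cp true .sq) / .lit rows + .lit 1) - .lit 1)))) <|
  .seq (.assign (.cp true .D) (.var .Q)) <|
  .seq (.assign (.cp true .B) (.lit 0)) <|
  .seq (.assign (.cp true .X0) (.lit 0)) <|
  .seq (.assign (.cp true .X1) (.lit 0)) <|
  .seq (.assign (.cp true .r) (.lit 1)) <|
  .seq (.assign (.cp true .p9) (.lit 9)) <|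
  .seq (.assign (.cp true .p16) (.lit 16)) <|
  .seq (.assign (.cp true .H) (.lit (-1))) <|
  .seq (draw rows (List.ofFn fun i => .cp true (.h i))) (draw rows (List.ofFn fun i => .cp true (.z i)))

theorem bitsCode_sem {ν : Cell rows → ℤ} {K : Slot → ℤ} {sq : ℕ} (hn : ν .n = n) (hK : K .sq = sq) :
    (HCode.ite (.var .n) (.var (.cp true .sq) / .lit rows)
      (.assign (.cp true .R) (.lit 3 * (.len (.var .n + .lit 1) - .lit 1)))
      (.assign (.cp true .R)
        (.lit 3 * (.len (.var (.cp true .sq) / .lit rows + .lit 1) - .lit 1))) :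
      HCode (Cell rows)).sem (setCopy ν true K) =
    PMF.pure (setCopy ν true (Function.update K .R (bitCount rows n sq : ℕ))) := by
  have hs : ∀ a : ℕ, ((3 * ((a + 1).size - 1) : ℕ) : ℤ) =
      3 * (((((a : ℕ) : ℤ) + 1).natAbs.size : ℤ) - 1) := by
    intro a
    have h1 : (((a : ℕ) : ℤ) + 1).natAbs = a + 1 := by omega
    have h2 := Nat.size_pos.2 (Nat.succ_pos a)
    rw [h1, Nat.cast_mul, Nat.cast_sub h2]
    rfl
  have hdiv : (K .sq / (rows : ℤ)) = ((sq / rows : ℕ) : ℤ) := by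
    rw [hK]
    push_cast
    rfl
  by_cases h : n ≤ sq / rows
  · rw [HCode.sem_ite_pos (by
      simp only [Expr.eval_var, Expr.eval_div, Expr.eval_lit, setCopy_cp, setCopy_n, hn, hdiv]
      exact_mod_cast h), HCode.sem, update_setCopy]
    simp only [Expr.eval_mul, Expr.eval_lit, Expr.eval_sub, Expr.eval_len, Expr.eval_add,
      Expr.eval_var, setCopy_n, hn]
    rw [bitCount, min_eq_left h, hs]
  · rw [HCode.sem_ite_neg (by
      simp only [Expr.eval_var, Expr.eval_div, Expr.eval_lit, setCopy_cp, setCopy_n, hn, hdiv]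
      exact_mod_cast h), HCode.sem, update_setCopy]
    simp only [Expr.eval_mul, Expr.eval_lit, Expr.eval_sub, Expr.eval_len, Expr.eval_add,
      Expr.eval_div, Expr.eval_var, setCopy_cp, hdiv]
    rw [bitCount, min_eq_right (not_le.1 h).le, hs]

theorem startCode_sem {ν : Cell rows → ℤ} {E : Expr (Cell rows)} {sq : ℕ} (hn : ν .n = n)
    (hQ : ν .Q = 2 ^ wordBits rows n) (hE : E.eval ν = sq) :
    (startCode rows E).sem ν =
      (CopyData.start n (wordBits rows n) rows sq).map fun d => setCopy ν true d.enc := by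
  have ha : ∀ (f : Slot) (E : Expr (Cell rows)) (K : Slot → ℤ),
      (HCode.assign (.cp true f) E).sem (setCopy ν true K) =
      PMF.pure (setCopy ν true (Function.update K f (E.eval (setCopy ν true K)))) := by
    intro f E K
    rw [HCode.sem, update_setCopy]
  have h0 : (HCode.assign (.cp true .sq) E : HCode (Cell rows)).sem ν = PMF.pure (setCopy ν true
      (Function.update (fun f => ν (.cp true f)) .sq (sq : ℤ))) := by
    rw [HCode.sem, hE, ← update_setCopy, setCopy_self]
  rw [startCode, HCode.sem, h0, PMF.pure_bind, HCode.sem,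
    bitsCode_sem (sq := sq) hn (Function.update_self _ _ _), PMF.pure_bind]
  simp only [HCode.sem.eq_4, ha, PMF.pure_bind, Expr.eval_var, Expr.eval_lit, setCopy_Q, hQ]
  rw [draw_setCopy (n := n) _ h_injective _ _ hn, PMF.bind_map, CopyData.start, PMF.map_bind]
  congr 1
  funext h
  rw [Function.comp, draw_setCopy (n := n) _ z_injective _ _ hn, PMF.map_comp]
  congr 1
  funext z
  rw [Function.comp]
  congr 1
  funext f
  rcases f with _ | _ | _ | _ | _ | _ | _ | _ | _ | _ | i | i
  case z => exact z_injective.extend_apply _ _ i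
  case h =>
    rw [Function.extend_apply' _ _ _ (by simp)]
    exact h_injective.extend_apply _ _ i
  all_goals
    rw [Function.extend_apply' _ _ _ (by simp), Function.extend_apply' _ _ _ (by simp)]
    simp [CopyData.enc, CopyData.fresh, encode]

/-! #### The tracker -/

/-- Update the given rows of the sketch. -/
def trackCode (l : List (Fin rows)) : HCode (Cell rows) :=
  l.foldr (fun i P => .seq (.assign (.Y i) (.var (.Y i) +
    signE (fun j => .S j) (.lit (i : ℕ) * .var .n + .var .inp))) P) .skip

/-- The sum of the squares of the given rows of the sketch. -/
def squaresE (l : List (Fin rows)) : Expr (Cell rows) :=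
  l.foldr (fun i E => .var (.Y i) * .var (.Y i) + E) (.lit 0)

theorem update_Y (x : ℤ) (F : StoreData n rows k) (i : Fin rows) (a : ℤ) :
    Function.update (F.enc x) (.Y i) a =
      StoreData.enc x { F with Y := Function.update F.Y i a } := by
  funext v
  rcases v with _ | _ | _ | _ | _ | j | j | ⟨_ | _, g⟩ <;>
    simp [Function.update_apply, StoreData.enc]

/-- The new value of a row depends only on its old value, the sketch coefficients and the item, so
rows already updated do not interfere; `Nodup` ensures that no row is updated twice. -/
theorem trackCode_sem (hk : 0 < k) (x : Fin n) (l : List (Fin rows)) (hl : l.Nodup)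
    (F : StoreData n rows k) : (trackCode l).sem (F.enc (x : ℕ)) =
      PMF.pure (StoreData.enc (x : ℕ) { F with
        Y := fun i => if i ∈ l then (F.track x).Y i else F.Y i }) := by
  induction l generalizing F with
  | nil => rfl
  | cons i l ih =>
    have hcons : trackCode (i :: l) = .seq (.assign (.Y i) (.var (.Y i) +
      signE (fun j => .S j) (.lit (i : ℕ) * .var .n + .var .inp))) (trackCode l) := rfl
    have hs : (signE (fun j => .S j) (.lit (i : ℕ) * .var .n + .var .inp) :
        Expr (Cell rows)).eval (F.enc (x : ℕ)) =
        ((polySign k F.S (entryIndex (i, x)) : ℤˣ) : ℤ) := by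
      refine eval_signE (c := F.S) hk (fun j => rfl) rfl ?_
      simp [StoreData.enc, entryIndex]
    have hi := List.nodup_cons.1 hl
    rw [hcons, HCode.sem, HCode.sem, PMF.pure_bind, Expr.eval_add, hs, Expr.eval_var, update_Y,
      ih hi.2]
    congr 3
    funext j
    by_cases hj : j = i
    · subst hj
      simp [hi.1, StoreData.enc, StoreData.track]
    · simp [hj, StoreData.track]

theorem trackCode_all_sem (hk : 0 < k) (x : Fin n) (F : StoreData n rows k) :
    (trackCode (List.finRange rows)).sem (F.enc (x : ℕ)) =
      PMF.pure ((F.track x).enc (x : ℕ)) := by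
  rw [trackCode_sem hk x _ (List.nodup_finRange rows)]
  simp only [List.mem_finRange, if_true]
  rfl

theorem eval_squaresE (x : ℤ) (F : StoreData n rows k) :
    (squaresE (List.finRange rows)).eval (F.enc x) = (F.total : ℤ) := by
  have h : ∀ l : List (Fin rows), (squaresE l).eval (F.enc x) =
      (l.map fun i => F.Y i * F.Y i).sum := by
    intro l
    induction l with
    | nil => rfl
    | cons i l ih =>
      rw [List.map_cons, List.sum_cons, ← ih]
      rfl
  rw [h, ← Fin.sum_univ_def, StoreData.total]
  push_cast
  refine Finset.sum_congr rfl fun i _ => ?_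
  rw [sq_abs, pow_two]

/-! #### HH2 -/

/-- One possible restart. -/
noncomputable def restartCode (rows : ℕ) : HCode (Cell rows) :=
  .ite (.lit rows * .var .np) (squaresE (List.finRange rows))
    (.seq (saveCode rows Finset.univ.toList) <|
      .seq (.assign .e (.var .e + .lit 1)) <|
      .seq (.assign .np (.var .np * .lit 2)) (startCode rows (squaresE (List.finRange rows)))) .skip

/-- HH2 reads the current item. -/
noncomputable def updateCode (rows : ℕ) : HCode (Cell rows) :=
  .seq (trackCode (List.finRange rows)) <|
  .seq (restartCode rows) <|
  .seq (restartCode rows) <| .seq (copyCode rows false) (copyCode rows true)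

/-- Preparations before the first item. -/
noncomputable def setupCode (rows : ℕ) : HCode (Cell rows) :=
  .seq (.assign .n (.var .inp)) <|
  .seq (.assign .Q (.pow2 (.lit rows * .var .n + .lit rows))) <|
  .seq (.assign .Q (.var .Q * .var .Q)) <|
  .seq (.assign .Q (.var .Q * .var .Q)) <|
  .seq (.assign .Q (.var .Q * .var .Q)) <|
  .seq (.assign .np (.lit 1)) <|
  .seq (draw rows (List.ofFn fun i => .S i)) <|
  .seq (startCode rows (.lit rows)) (saveCode rows Finset.univ.toList)

theorem restartCode_sem (x : ℤ) (F : StoreData n rows (wordBits rows n)) :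
    (restartCode rows).sem (F.enc x) = F.restart.map (StoreData.enc x) := by
  have hle : (Expr.lit (rows : ℤ) * .var .np : Expr (Cell rows)).eval (F.enc x) ≤
      (squaresE (List.finRange rows)).eval (F.enc x) ↔ rows * 2 ^ F.e ≤ F.total := by
    rw [eval_squaresE]
    simp only [Expr.eval_mul, Expr.eval_lit, Expr.eval_var, StoreData.enc]
    norm_cast
  by_cases h : rows * 2 ^ F.e ≤ F.total
  · have hsave : setCopy (F.enc x) false (fun f => F.enc x (.cp true f)) =
        StoreData.enc x { F with prev := F.cur } := setCopy_prev x F F.cur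
    have he : ∀ G : StoreData n rows (wordBits rows n),
        Function.update (Function.update (G.enc x) .e (G.e + 1 : ℤ)) .np (2 ^ G.e * 2) =
          StoreData.enc x { G with e := G.e + 1 } := by
      intro G
      funext v
      rcases v with _ | _ | _ | _ | _ | j | j | ⟨_ | _, g⟩ <;>
        simp [StoreData.enc, pow_succ]
    have hstep : (HCode.seq (.assign .e (.var .e + .lit 1)) <|
        .seq (.assign .np (.var .np * .lit 2)) (startCode rows (squaresE (List.finRange rows)))).sem
          (StoreData.enc x { F with prev := F.cur }) =
        (startCode rows (squaresE (List.finRange rows))).sem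
          (StoreData.enc x { F with prev := F.cur, e := F.e + 1 }) := by
      rw [HCode.sem, HCode.sem, PMF.pure_bind, HCode.sem, HCode.sem, PMF.pure_bind]
      exact congrArg _ (he { F with prev := F.cur })
    rw [restartCode, HCode.sem_ite_pos (hle.2 h), StoreData.restart, if_pos h, HCode.sem,
      saveCode_all_sem, PMF.pure_bind, hsave, hstep,
      startCode_sem (n := n) (sq := F.total)
        (ν := StoreData.enc x { F with prev := F.cur, e := F.e + 1 }) rfl rfl (eval_squaresE x _),
      PMF.map_comp]
    congr 1
    funext c
    exact setCopy_cur x _ c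
  · rw [restartCode, HCode.sem_ite_neg (mt hle.1 h), StoreData.restart, if_neg h, PMF.pure_map]
    rfl

theorem copyCode_prev_sem (hr : 0 < rows) (x : Fin n) {F : StoreData n rows (wordBits rows n)}
    (hF : F.prev.Ok rows) : (copyCode rows false).sem (F.enc (x : ℕ)) =
      (F.prev.step rows x).map fun a => StoreData.enc (x : ℕ) { F with prev := a } := by
  have h := copyCode_sem (ν := F.enc (x : ℕ)) (c := false) hr hF (x := x) rfl rfl rfl
  simp only [setCopy_prev] at h
  exact h

theorem copyCode_cur_sem (hr : 0 < rows) (x : Fin n) {F : StoreData n rows (wordBits rows n)}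
    (hF : F.cur.Ok rows) : (copyCode rows true).sem (F.enc (x : ℕ)) =
      (F.cur.step rows x).map fun a => StoreData.enc (x : ℕ) { F with cur := a } := by
  have h := copyCode_sem (ν := F.enc (x : ℕ)) (c := true) hr hF (x := x) rfl rfl rfl
  simp only [setCopy_cur] at h
  exact h

theorem wordBits_pos (hr : 0 < rows) (n : ℕ) : 0 < wordBits rows n :=
  Nat.mul_pos (by norm_num) (wordLen_pos hr n)

theorem updateCode_sem (hr : 0 < rows) (x : Fin n) {F : StoreData n rows (wordBits rows n)} {t : ℕ}
    (hF : F.Ok t) : (updateCode rows).sem (F.enc (x : ℕ)) =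
      (F.step x).map (StoreData.enc (x : ℕ)) := by
  have hM := hF.track x
  rw [updateCode, HCode.sem, trackCode_all_sem (wordBits_pos hr n), PMF.pure_bind, HCode.sem,
    restartCode_sem, PMF.bind_map, StoreData.step, PMF.map_bind]
  refine bind_congr_support _ _ _ fun F1 m1 => ?_
  rw [Function.comp, HCode.sem, restartCode_sem, PMF.bind_map, PMF.map_bind]
  refine bind_congr_support _ _ _ fun F2 m2 => ?_
  have hM2 := (hM.restart hr F1 m1).restart hr F2 m2
  rw [Function.comp, HCode.sem, copyCode_prev_sem hr x hM2.prev_ok, PMF.bind_map, PMF.map_bind]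
  congr 1
  funext a
  rw [Function.comp, copyCode_cur_sem (F := { F2 with prev := a }) hr x hM2.cur_ok, PMF.map_comp]
  rfl

theorem setupCode_sem (n rows : ℕ) :
    (setupCode rows).sem (Function.update (fun _ => 0) .inp (n : ℤ)) =
      (StoreData.start n rows (wordBits rows n)).map (StoreData.enc (n : ℤ)) := by
  -- Three squarings turn 2^`w` into the modulus 2^(8`w`).
  have hQ : ∀ w : ℕ, (2 : ℤ) ^ w * 2 ^ w * (2 ^ w * 2 ^ w) *
      (2 ^ w * 2 ^ w * (2 ^ w * 2 ^ w)) = 2 ^ (8 * w) := by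
    intro w
    rw [mul_comm 8 w, pow_mul]
    ring
  have hsize : ((rows : ℤ) * n + rows).natAbs.size = wordLen rows n := by
    rw [← Nat.cast_mul, ← Nat.cast_add, Int.natAbs_natCast, wordLen]
  rw [setupCode]
  simp only [HCode.sem.eq_4, HCode.sem.eq_2, PMF.pure_bind, Expr.eval_var, Expr.eval_mul,
    Expr.eval_pow2, Expr.eval_add, Expr.eval_lit, Function.update_self, hsize, hQ]
  rw [draw_sem (n := n) (fun i => .S i) (fun i j h => Cell.S.inj h) (fun i => by simp) _
    (by simp), PMF.bind_map, StoreData.start, PMF.map_bind]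
  congr 1
  funext S
  rw [Function.comp, startCode_sem (n := n) (sq := rows), PMF.bind_map, PMF.map_comp,
    ← PMF.bind_pure_comp]
  · congr 1
    funext c
    rw [Function.comp, saveCode_all_sem]
    congr 1
    funext v
    have hS : Function.Injective fun i => (Cell.S i : Cell rows) := fun i j h => Cell.S.inj h
    rcases v with _ | _ | _ | _ | _ | j | j | ⟨_ | _, g⟩
    case S =>
      simp only [setCopy]
      exact hS.extend_apply _ _ j
    case cp.false => rfl
    case cp.true => rfl
    all_goals
      simp only [setCopy]
      rw [Function.extend_apply' _ _ _ (by simp)]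
      simp [wordBits]
      rfl
  · rw [Function.extend_apply' _ _ _ (by simp)]
    simp
  · rw [Function.extend_apply' _ _ _ (by simp)]
    simp [wordBits]
  · rfl

end Program
end BPTree
namespace BPTree

section Program

variable {n k rows : ℕ}

/-! #### Bounds for the values of the variables -/

theorem natAbs_encode_le (H : Option (Fin n)) : (encode H).natAbs ≤ n + 1 := by
  cases H with
  | none => simp [encode]
  | some x =>
    have := x.2
    simp only [encode, Int.natAbs_natCast]
    omega

/-- The round number is logarithmic: 2^`R` ≤ (`n` + 1)³ and `r` ≤ `R` + 1, so even 16^`r` is at most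
`N ^ 16`. -/
theorem CopyData.Ok.natAbs_enc_le {d : CopyData n k} (hd : d.Ok rows) {N G t : ℕ} (hN : 2 ≤ N)
    (hn : n + 1 ≤ N) (ht : t + 1 ≤ N) (hG : 16 ≤ G) (hk : 2 ^ k ≤ N ^ G)
    (hsq : rows * (t ^ 2 + 1) ≤ N ^ G) (h1 : d.X0.natAbs ≤ t ∧ d.X1.natAbs ≤ t)
    (h2 : d.sq ≤ rows * (t ^ 2 + 1)) (h3 : 2 ^ d.R ≤ (n + 1) ^ 3) (f : Slot) :
    (d.enc f).natAbs ≤ N ^ G := by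
  obtain ⟨o1, o2, o3, o4⟩ := hd
  have hp : ∀ {a}, a ≤ 16 → N ^ a ≤ N ^ G := fun ha =>
    Nat.pow_le_pow_right (by omega) (ha.trans hG)
  have hN1 : N ≤ N ^ G := by simpa using hp (a := 1) (by norm_num)
  have hR : 2 ^ d.R ≤ N ^ 3 := h3.trans (Nat.pow_le_pow_left hn 3)
  have hr : 2 ^ d.r ≤ N ^ 4 := by
    calc 2 ^ d.r ≤ 2 ^ (d.R + 1) := Nat.pow_le_pow_right (by norm_num) o2
      _ = 2 ^ d.R * 2 := pow_succ 2 d.R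
      _ ≤ N ^ 3 * N := Nat.mul_le_mul hR hN
      _ = N ^ 4 := (pow_succ N 3).symm
  have h16 : 16 ^ d.r ≤ N ^ G := by
    calc 16 ^ d.r = (2 ^ d.r) ^ 4 := by rw [← pow_mul, mul_comm, pow_mul]; norm_num
      _ ≤ (N ^ 4) ^ 4 := Nat.pow_le_pow_left hr 4
      _ = N ^ 16 := by rw [← pow_mul]
      _ ≤ N ^ G := hp le_rfl
  have hs : ∀ m : ℕ, m < 2 ^ m := fun m => Nat.lt_two_pow_self
  cases f <;> simp only [CopyData.enc, Int.natAbs_natCast, Int.natAbs_pow]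
  case sq => exact h2.trans hsq
  case R => exact (hs _).le.trans (hR.trans (hp (by norm_num)))
  case D => exact (Nat.pow_le_pow_right (by norm_num) (by omega)).trans hk
  case B =>
    refine o4.le.trans (le_trans ?_ (hr.trans (hp (by norm_num))))
    exact Nat.pow_le_pow_right (by norm_num) (Nat.sub_le _ _)
  case X0 => omega
  case X1 => omega
  case r => exact (hs _).le.trans (hr.trans (hp (by norm_num)))
  case p9 => exact (Nat.pow_le_pow_left (by norm_num) _).trans h16
  case p16 => exact h16
  case H => exact (natAbs_encode_le _).trans (hn.trans hN1)
  case h i => exact (d.h i).2.le.trans hk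
  case z i => exact (d.z i).2.le.trans hk

/-- An exponent that bounds the values of the variables after each item. -/
def varExponent (rows : ℕ) : ℕ := 8 * (rows + 3) + 16

theorem StoreData.Ok.natAbs_enc_le {F : StoreData n rows (wordBits rows n)} {t : ℕ} (hF : F.Ok t)
    {y : ℤ} (hy : y.natAbs ≤ n) (v : Cell rows) :
    (F.enc y v).natAbs ≤ (n + t + 2) ^ varExponent rows := by
  set N := n + t + 2 with hN
  have hN2 : 2 ≤ N := by omega
  have hp : ∀ {a}, a ≤ varExponent rows → N ^ a ≤ N ^ varExponent rows := fun ha =>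
    Nat.pow_le_pow_right (by omega) ha
  have hN1 : N ≤ N ^ varExponent rows := by
    simpa using hp (a := 1) (by unfold varExponent; omega)
  have hrows : rows ≤ N ^ rows := Nat.lt_two_pow_self.le.trans (Nat.pow_le_pow_left hN2 rows)
  have hk : 2 ^ wordBits rows n ≤ N ^ varExponent rows := by
    have h1 : rows * n + rows ≤ N ^ (rows + 1) := by
      calc rows * n + rows = rows * (n + 1) := by ring
        _ ≤ N ^ rows * N := Nat.mul_le_mul hrows (by omega)
        _ = N ^ (rows + 1) := (pow_succ N rows).symm
    have h2 : 2 ^ wordLen rows n ≤ N ^ (rows + 3) := by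
      have h3 := two_pow_size_le (rows * n + rows)
      have h4 : 1 ≤ N ^ (rows + 1) := Nat.one_le_pow _ _ (by omega)
      have h5 : N ^ (rows + 1) * 4 ≤ N ^ (rows + 1) * N ^ 2 :=
        Nat.mul_le_mul_left _ (Nat.pow_le_pow_left hN2 2)
      rw [← pow_add] at h5
      change 2 ^ wordLen rows n ≤ _ at h3
      change _ ≤ N ^ (rows + 1 + 2)
      omega
    calc 2 ^ wordBits rows n = (2 ^ wordLen rows n) ^ 8 := by
          rw [wordBits, mul_comm, pow_mul]
      _ ≤ (N ^ (rows + 3)) ^ 8 := Nat.pow_le_pow_left h2 8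
      _ = N ^ (8 * (rows + 3)) := by rw [← pow_mul, mul_comm]
      _ ≤ _ := hp (Nat.le_add_right _ _)
  have ht2 : t ^ 2 + 1 ≤ N ^ 2 := by
    have := Nat.pow_le_pow_left (show t + 1 ≤ N by omega) 2
    nlinarith
  have hsq : rows * (t ^ 2 + 1) ≤ N ^ varExponent rows := by
    calc rows * (t ^ 2 + 1) ≤ N ^ rows * N ^ 2 := Nat.mul_le_mul hrows ht2
      _ = N ^ (rows + 2) := (pow_add N rows 2).symm
      _ ≤ _ := hp (by unfold varExponent; omega)
  have he : 2 ^ F.e ≤ N ^ varExponent rows := by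
    calc 2 ^ F.e ≤ 2 * t ^ 2 + 1 := hF.e_le
      _ ≤ 2 * N ^ 2 := by omega
      _ ≤ N * N ^ 2 := Nat.mul_le_mul_right _ hN2
      _ = N ^ 3 := by ring
      _ ≤ _ := hp (by unfold varExponent; omega)
  have hG : 16 ≤ varExponent rows := Nat.le_add_left _ _
  rcases v with _ | _ | _ | _ | _ | j | j | ⟨_ | _, g⟩ <;>
    simp only [StoreData.enc, Int.natAbs_natCast, Int.natAbs_pow]
  case inp => omega
  case n => omega
  case Q => exact hk
  case e => exact (Nat.lt_two_pow_self).le.trans he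
  case np => exact he
  case Y =>
    have := hF.Y_le j
    omega
  case S => exact (F.S j).2.le.trans hk
  case cp.false =>
    exact hF.prev_ok.natAbs_enc_le hN2 (by omega) (by omega) hG hk hsq hF.prev_X hF.prev_sq
      hF.prev_R g
  case cp.true =>
    exact hF.cur_ok.natAbs_enc_le hN2 (by omega) (by omega) hG hk hsq hF.cur_X hF.cur_sq
      hF.cur_R g

/-! #### The word RAM program -/

/-- The number of temporary registers of the program, minus one. -/
noncomputable def tempRegs (rows : ℕ) : ℕ := max (setupCode rows).depth (updateCode rows).depth

theorem setupCode_depth_le (rows : ℕ) : (setupCode rows).depth ≤ tempRegs rows := le_max_left _ _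
theorem updateCode_depth_le (rows : ℕ) : (updateCode rows).depth ≤ tempRegs rows :=
  le_max_right _ _

/-- The word RAM program for HH2. -/
noncomputable def hhProgram (rows : ℕ) : StreamProgram (Cell rows ⊕ Fin (tempRegs rows + 1)) where
  inp := .inl .inp
  out := .inl (.cp false .H)
  setup := (setupCode rows).compile (tempRegs rows)
  update := (updateCode rows).compile (tempRegs rows)

theorem Machine.vars_store {V : Type} [DecidableEq V] {τ : ℕ} (M : Machine (V ⊕ Fin (τ + 1)))
    (d : V) (c : ℤ) : (M.store (.inl d) c).vars = Function.update M.vars d c :=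
  M.vars_store_tick d c

theorem update_inp (y x : ℤ) (F : StoreData n rows k) :
    Function.update (F.enc y) .inp x = F.enc x := by
  funext v
  rcases v with _ | _ | _ | _ | _ | j | j | ⟨_ | _, g⟩ <;> simp [StoreData.enc]

theorem hhProgram_run_nil (n rows : ℕ) : ((hhProgram rows).run ([] : List (Fin n))) =
    ((setupCode rows).compile (tempRegs rows)).exec
      (Machine.store { regs := fun _ => 0, time := 0, peak := 0 } (.inl .inp) (n : ℤ)) := rfl

theorem hhProgram_run_append (rows : ℕ) (p : List (Fin n)) (x : Fin n) :
    (hhProgram rows).run (p ++ [x]) = ((hhProgram rows).run p).bind fun M =>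
      ((updateCode rows).compile (tempRegs rows)).exec (M.store (.inl .inp) ((x : ℕ) : ℤ)) := by
  -- The fold that defines a run goes over the list of the item numbers, obtained by lifting the
  -- coercion to lists.
  have h : ((p ++ [x]) >>= fun a => (pure (a : ℕ) : List ℕ)) =
      (p >>= fun a => (pure (a : ℕ) : List ℕ)) ++ [(x : ℕ)] := List.flatMap_append
  rw [StreamProgram.run, h, List.foldl_append]
  rfl

/-- The number `y` is what the input register still holds, namely `n` at first and later the last
item. It is overwritten before each update and does not affect the answer. -/
theorem hhProgram_map_vars (hr : 0 < rows) (p : List (Fin n)) : ∃ y : ℤ, y.natAbs ≤ n ∧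
    ((hhProgram rows).run p).map Machine.vars =
      (StoreData.run n rows (wordBits rows n) p).map (StoreData.enc y) := by
  induction p using List.reverseRecOn with
  | nil =>
    refine ⟨n, by simp, ?_⟩
    rw [hhProgram_run_nil, ((setupCode rows).compile_exec _ (setupCode_depth_le rows) _).1,
      Machine.vars_store]
    exact setupCode_sem n rows
  | append_singleton p x ih =>
    obtain ⟨y, _, ih⟩ := ih
    refine ⟨((x : ℕ) : ℤ), by simp, ?_⟩
    have h1 : ∀ M : Machine (Cell rows ⊕ Fin (tempRegs rows + 1)),
        (((updateCode rows).compile (tempRegs rows)).exec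
          (M.store (.inl .inp) ((x : ℕ) : ℤ))).map Machine.vars =
        (updateCode rows).sem (Function.update M.vars .inp ((x : ℕ) : ℤ)) := by
      intro M
      rw [((updateCode rows).compile_exec _ (updateCode_depth_le rows) _).1, Machine.vars_store]
    rw [hhProgram_run_append, PMF.map_bind]
    simp only [h1]
    have h2 := congrArg (fun D => D.bind fun ν : Cell rows → ℤ =>
      (updateCode rows).sem (Function.update ν .inp ((x : ℕ) : ℤ))) ih
    simp only [PMF.bind_map] at h2
    refine h2.trans ?_
    rw [StoreData.run_append, PMF.map_bind]
    refine bind_congr_support _ _ _ fun F hF => ?_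
    rw [Function.comp, update_inp]
    exact updateCode_sem hr x (StoreData.run_ok hr p F hF)

theorem hhProgram_natAbs_vars_le (hr : 0 < rows) (p : List (Fin n)) :
    ∀ M ∈ ((hhProgram rows).run p).support, ∀ v,
      (M.vars v).natAbs ≤ (n + p.length + 2) ^ varExponent rows := by
  intro M hM v
  obtain ⟨y, hy, h⟩ := hhProgram_map_vars hr p
  have hmem : M.vars ∈ (((hhProgram rows).run p).map Machine.vars).support :=
    (PMF.mem_support_map_iff _ _ _).2 ⟨M, hM, rfl⟩
  rw [h, PMF.mem_support_map_iff] at hmem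
  obtain ⟨F, hF, e⟩ := hmem
  rw [← e]
  exact (StoreData.run_ok hr p F hF).natAbs_enc_le hy v

theorem hhProgram_implements (hr : 0 < rows) (n : ℕ) :
    (hhProgram rows).Implements (polyFamilies hr n) := by
  intro p
  obtain ⟨y, _, h⟩ := hhProgram_map_vars hr p
  have h1 := congrArg (fun D => D.map fun ν : Cell rows → ℤ => ν (.cp false .H)) h
  simp only [PMF.map_comp] at h1
  rw [HH2, ← StoreData.map_run hr, PMF.map_comp, PMF.map_comp]
  exact h1

/-- An exponent that bounds all the numbers that the program ever stores. -/
noncomputable def peakExponent (rows : ℕ) : ℕ :=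
  (setupCode rows).growth + varExponent rows * (updateCode rows).growth

/-- Growth does not accumulate along the stream: before every item the variables are bounded afresh
by the invariants, through `hhProgram_natAbs_vars_le`, and only one update is charged on top of
that. -/
theorem hhProgram_peak_le (hr : 0 < rows) (p : List (Fin n)) :
    ∀ M ∈ ((hhProgram rows).run p).support, M.peak ≤ (n + p.length + 2) ^ peakExponent rows := by
  induction p using List.reverseRecOn with
  | nil =>
    intro M hM
    rw [hhProgram_run_nil] at hM
    have h := (((setupCode rows).compile_exec _ (setupCode_depth_le rows) _).2 M hM (n + 2) (by omega)
      (fun v => by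
        rw [Machine.vars_store]
        by_cases hv : v = .inp
        · subst hv
          simp
        · rw [Function.update_of_ne hv]
          simp [Machine.vars])).2
    have h1 : (n + 2) ^ (setupCode rows).growth ≤ (n + 2) ^ peakExponent rows :=
      Nat.pow_le_pow_right (by omega) (Nat.le_add_right _ _)
    have h2 : n + 2 ≤ (n + 2) ^ (setupCode rows).growth :=
      Nat.le_self_pow (by have := (setupCode rows).one_le_growth; omega) _
    simp only [Machine.store, Int.natAbs_natCast] at h
    simp only [List.length_nil, add_zero]
    omega
  | append_singleton p x ih =>
    intro M' hM'
    rw [hhProgram_run_append, PMF.mem_support_bind_iff] at hM'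
    obtain ⟨M, hM, hM'⟩ := hM'
    set N := n + p.length + 2 with hN
    have hE : 1 ≤ varExponent rows := by
      unfold varExponent
      omega
    have hN1 : N ≤ N ^ varExponent rows := Nat.le_self_pow (by omega) N
    have hx := x.2
    have h := (((updateCode rows).compile_exec _ (updateCode_depth_le rows) _).2 M' hM'
      (N ^ varExponent rows) (by omega) (fun v => by
        rw [Machine.vars_store]
        by_cases hv : v = .inp
        · subst hv
          rw [Function.update_self, Int.natAbs_natCast]
          omega
        · rw [Function.update_of_ne hv]
          exact hhProgram_natAbs_vars_le hr p M hM v)).2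
    have h1 := ih M hM
    have h2 : N ^ peakExponent rows ≤ (n + (p ++ [x]).length + 2) ^ peakExponent rows := by
      refine Nat.pow_le_pow_left ?_ _
      rw [List.length_append]
      omega
    have h3 : (N ^ varExponent rows) ^ (updateCode rows).growth ≤ N ^ peakExponent rows := by
      rw [← pow_mul]
      exact Nat.pow_le_pow_right (by omega) (Nat.le_add_left _ _)
    have h4 : N ≤ N ^ peakExponent rows := by
      refine Nat.le_self_pow ?_ N
      have := (setupCode rows).one_le_growth
      unfold peakExponent
      omega
    simp only [Machine.store, Int.natAbs_natCast] at h
    omega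

/-- HH2 can be implemented with `O(1)` words of memory and `O(1)` update time. -/
theorem exists_streamProgram (hr : 0 < rows) :
    ∃ (Reg : Type) (_ : Fintype Reg) (_ : DecidableEq Reg) (P : StreamProgram Reg) (C : ℕ),
      Fintype.card Reg ≤ C ∧ ∀ n : ℕ, (∃ fam : Families n rows, P.Implements fam) ∧
        ∀ p : List (Fin n), ∀ M ∈ (P.run p).support, M.peak ≤ (n + p.length + 2) ^ C ∧
          ∀ x : Fin n, ∀ M' ∈ (P.update.exec (M.store P.inp ((x : ℕ) : ℤ))).support,
            M'.time ≤ M.time + C := by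
  refine ⟨_, inferInstance, inferInstance, hhProgram rows,
    Fintype.card (Cell rows ⊕ Fin (tempRegs rows + 1)) + peakExponent rows +
      (hhProgram rows).update.cost, by omega, fun n =>
      ⟨⟨_, hhProgram_implements hr n⟩, fun p M hM => ⟨?_, fun x M' hM' => ?_⟩⟩⟩
  · exact (hhProgram_peak_le hr p M hM).trans (Nat.pow_le_pow_right (by omega) (by omega))
  · have h := Code.time_le _ _ M' hM'
    simp only [Machine.store] at h
    omega

end Program
end BPTree
theorem mainTheorem5 :
    ∃ K : ℝ, 0 < K ∧ ∃ rows : ℕ, 0 < rows ∧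
      -- the tracker has accuracy `1/100` at all times with probability at least `1 - 1/20`
      (∀ (n : ℕ) (fam : BPTree.Families n rows) (p : List (Fin n)),
        (19 / 20 : ℝ) ≤ (fam.sketch.toOuterMeasure
          {S | ∀ t ≤ p.length,
            |BPTree.estimate (BPTree.sketchOf S (p.take t)) - BPTree.F2 (p.take t)|
              ≤ 1 / 100 * BPTree.F2 p}).toReal) ∧
      -- HH2 returns the heavy hitter with probability at least `0.6`
      (∀ (n : ℕ) (fam : BPTree.Families n rows) (p : List (Fin n)) (H : Fin n),
        H ∈ p → BPTree.IsHeavyHitter K p H →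
          (0.6 : ℝ) ≤ (BPTree.HH2 fam p (some H)).toReal) ∧
      -- HH2 runs with `O(1)` words of memory and `O(1)` update time
      (∃ (Reg : Type) (_ : Fintype Reg) (_ : DecidableEq Reg) (P : BPTree.StreamProgram Reg)
        (C : ℕ), Fintype.card Reg ≤ C ∧ ∀ n : ℕ,
          (∃ fam : BPTree.Families n rows, P.Implements fam) ∧
          (∀ (p : List (Fin n)), ∀ M ∈ (P.run p).support,
            M.peak ≤ (n + p.length + 2) ^ C ∧
            ∀ x : Fin n,
              ∀ M' ∈ (P.update.exec (M.store P.inp ((x : ℕ) : ℤ))).support,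
                M'.time ≤ M.time + C)) := by
  -- Only the lower bound on the number of rows is retained, so that the large numeral is never
  -- unfolded.
  obtain ⟨rows, hrows⟩ : ∃ rows : ℕ, 300000000 ≤ rows := ⟨_, le_rfl⟩
  have hr : 0 < rows := (by norm_num : 0 < 300000000).trans_le hrows
  exact ⟨10000000, by norm_num, rows, hr,
    fun n fam p => BPTree.tracker_accuracy hrows fam.sketch_kWise p,
    fun n fam p H hp hH => BPTree.HH2_correct fam p H hp hH
      (BPTree.tracker_accuracy hrows fam.sketch_kWise p),
    BPTree.exists_streamProgram hr⟩
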